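/- All algebras are over $\mathbb C$. For an associative algebra $R$ put $R_1=R$ and let $R_{i+1}$ be the span of all $[a,b]=ab-ba$ with $a\in R$, $b\in R_i$. Let $F^dR$ be the two-sided ideal $\sum_m\sum_{i_1+\dots+i_m-m=d}R\,R_{i_1}R\cdots R\,R_{i_m}R$, and let $R_{[[ab]]}=\varprojlim R/F^dR$. If $\pi:R\to P$ is the abelianization of $R$, let $\mathcal O^{(d)}$ be the sheaf on $\mathrm{Spec}\,P$ whose stalk at $p$ is the Ore localization of $R/F^{d+1}R$ at the elements with image outside $p$, and whose sections are the families of germs which locally are given by one fraction $t^{-1}a$. The formal spectrum $\mathrm{Spf}(R)$ is $\mathrm{Spec}\,P$ with the sheaf of topological algebras $\varprojlim_d\mathcal O^{(d)}$. The NC-affine space is $A^n_{NC}=\mathrm{Spf}(\mathbb C\langle x_1,\dots,x_n\rangle_{[[ab]]})$, with structure sheaf $\mathcal O^{NC}$. For every $d\ge2$ let $B_d$ be an ordered basis of the degree $d$ part of the free Lie algebra on $x_1,\dots,x_n$, and order $B=\coprod_{d\ge 2}B_d$ lexicographically, as $\beta_1,\beta_2,\dots$. Let $\Lambda$ be the set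 of finitely supported functions $\lambda:B\to\mathbb Z_{\ge0}$, put $M_\lambda=\beta_1^{\lambda(\beta_1)}\beta_2^{\lambda(\beta_2)}\cdots\in\mathbb C\langle x_1,\dots,x_n\rangle$ and $\mathrm{ord}(\lambda)=\sum_{d}\sum_{\beta\in B_d}(d-1)\lambda(\beta)$. For a polynomial $f$ let $[[f]]\in\mathbb C\langle x_1,\dots,x_n\rangle$ be obtained by replacing every monomial $x_1^{a_1}\cdots x_n^{a_n}$ by the noncommutative monomial with the factors in this order. Theorem. The natural homomorphism $\mathbb C\langle x_1,\dots,x_n\rangle_{[[ab]]}\to\mathbb C[x_1,\dots,x_n]$ is the abelianization (it is surjective with kernel $F^1$), so that $\mathcal O^{NC}$ is a sheaf on the affine space $A^n=\mathrm{Spec}\,\mathbb C[x_1,\dots,x_n]$. There is a unique family of bilinear differential operators $C^\nu_{\lambda\mu}$ ($\lambda,\mu,\nu\in\Lambda$) with polynomial coefficients such that for all polynomials $f,g$ one has the finite sum $$[[f]]M_\lambda\cdot[[g]]M_\mu=\sum_\nu[[C^\nu_{\lambda\mu}(f,g)]]M_\nu\quad\text{in }\mathbb C\langle x_1,\dots,x_n\rangle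 ,$$ and for every $\nu$ only finitely many $C^\nu_{\lambda\mu}$ are nonzero. For a nonempty Zariski open $U\subset A^n$ let $\mathcal O(U)$ be the algebra of rational functions regular in $U$, and let $\mathcal A(U)$ be the space of possibly infinite formal sums $\sum_{\lambda\in\Lambda}[[f_\lambda]]M_\lambda$, $f_\lambda\in\mathcal O(U)$, with the multiplication $$\Big(\sum_\lambda[[f_\lambda]]M_\lambda\Big)\Big(\sum_\mu[[g_\mu]]M_\mu\Big)=\sum_\nu\Big[\Big[\sum_{\lambda,\mu}C^\nu_{\lambda\mu}(f_\lambda,g_\mu)\Big]\Big]M_\nu .$$ Then there are isomorphisms of algebras $\Phi_U:\mathcal A(U)\to\Gamma(U,\mathcal O^{NC})$ for all nonempty open $U$, such that: they commute with the restriction to smaller nonempty open sets; for a polynomial $f$, $\Phi_U$ sends $[[f]]M_\lambda$ to the section defined by the element $[[f]]M_\lambda$ of $\mathbb C\langle x_1,\dots,x_n\rangle$; and for every $d\geq 0$, $\Phi_U(\sum[[f_\lambda]]M_\lambda)$ has image $0$ in $\Gamma(U,\mathcal O^{(d)})$ if and only if $f_\lambda=0$ for all $\lambda$ with $\mathrm{ord}(\lambda)\le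 d$. -/

import Mathlib

/-! ## The NC-filtration and the NC-completion of an associative algebra -/

noncomputable section

namespace NCGeom

/-- The lower central series of the commutator Lie algebra of `R`, numbered from `0`:
`lieCentral R k` is spanned by the iterated commutators with `k` brackets. -/
def lieCentral (R : Type*) [Ring R] [Algebra ℂ R] : ℕ → Submodule ℂ R
  | 0 => ⊤
  | k + 1 => Submodule.span ℂ {x | ∃ a : R, ∃ b ∈ lieCentral R k, x = a * b - b * a}

/-- The products `r₁ l₁ r₂ l₂ ⋯ rₘ lₘ r` (for all `m`) where `lⱼ` lies in the term of the lower
central series with `kⱼ` brackets and `k₁ + ⋯ + kₘ = d`. -/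
def ncProducts (R : Type*) [Ring R] [Algebra ℂ R] (d : ℕ) : Set R :=
  {x | ∃ (w : List (ℕ × R × R)) (r : R), (∀ e ∈ w, e.2.2 ∈ lieCentral R e.1) ∧
    (w.map fun e => e.1).sum = d ∧ x = (w.map fun e => e.2.1 * e.2.2).prod * r}

/-- The `d`-th layer `F^d R` of the NC-filtration: all sums of products containing `d` instances
of commutator brackets. -/
def ncFiltration (R : Type*) [Ring R] [Algebra ℂ R] (d : ℕ) : Ideal R :=
  Ideal.span (ncProducts R d)

instance ncFiltration_isTwoSided (R : Type*) [Ring R] [Algebra ℂ R] (d : ℕ) :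
    (ncFiltration R d).IsTwoSided where
  mul_mem_of_left {a} b ha := by
    unfold ncFiltration at ha ⊢
    induction ha using Submodule.span_induction with
    | mem x hx =>
      obtain ⟨w, r, hw, hs, rfl⟩ := hx
      exact Ideal.subset_span ⟨w, r * b, hw, hs, by rw [mul_assoc]⟩
    | zero => simp
    | add x y _ _ hx hy => rw [add_mul]; exact Ideal.add_mem _ hx hy
    | smul c x _ hx => rw [smul_eq_mul, mul_assoc]; exact Ideal.mul_mem_left _ _ hx

theorem lieCentral_succ_le (R : Type*) [Ring R] [Algebra ℂ R] (k : ℕ) :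
    lieCentral R (k + 1) ≤ lieCentral R k := by
  induction k with
  | zero => simp [lieCentral]
  | succ k ih =>
    rw [lieCentral, lieCentral]
    refine Submodule.span_mono ?_
    rintro x ⟨a, b, hb, rfl⟩
    exact ⟨a, b, ih hb, rfl⟩

theorem ncProducts_succ_subset (R : Type*) [Ring R] [Algebra ℂ R] (d : ℕ) :
    ncProducts R (d + 1) ⊆ ncProducts R d := by
  rintro x ⟨w, r, hw, hs, rfl⟩
  suffices h : ∃ w' : List (ℕ × R × R), (∀ e ∈ w', e.2.2 ∈ lieCentral R e.1) ∧
      (w'.map fun e => e.1).sum = d ∧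
      (w'.map fun e => e.2.1 * e.2.2).prod = (w.map fun e => e.2.1 * e.2.2).prod by
    obtain ⟨w', h1, h2, h3⟩ := h
    exact ⟨w', r, h1, h2, by rw [h3]⟩
  induction w generalizing d with
  | nil => simp at hs
  | cons e w ih =>
    rcases e with ⟨k, a, l⟩
    rcases k with _ | k
    · have hs' : (w.map fun e => e.1).sum = d + 1 := by simpa using hs
      obtain ⟨w', h1, h2, h3⟩ := ih d (fun e he => hw e (List.mem_cons_of_mem _ he)) hs'
      refine ⟨(0, a, l) :: w', ?_, by simpa using h2, by simp [h3]⟩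
      intro e he
      rcases List.mem_cons.1 he with rfl | he
      · exact hw _ (by simp)
      · exact h1 e he
    · refine ⟨(k, a, l) :: w, ?_, ?_, by simp⟩
      · intro e he
        rcases List.mem_cons.1 he with rfl | he
        · exact lieCentral_succ_le R k (hw (k + 1, a, l) (by simp))
        · exact hw e (List.mem_cons_of_mem _ he)
      · simp only [List.map_cons, List.sum_cons] at hs ⊢
        omega

theorem ncFiltration_succ_le (R : Type*) [Ring R] [Algebra ℂ R] (d : ℕ) :
    ncFiltration R (d + 1) ≤ ncFiltration R d :=
  Ideal.span_mono (ncProducts_succ_subset R d)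

theorem lieCentral_succ_map_eq_zero {R P : Type*} [Ring R] [Algebra ℂ R] [CommRing P] [Algebra ℂ P]
    (π : R →ₐ[ℂ] P) (k : ℕ) (x : R) (hx : x ∈ lieCentral R (k + 1)) : π x = 0 := by
  rw [lieCentral] at hx
  induction hx using Submodule.span_induction with
  | mem x hx =>
    obtain ⟨a, b, _, rfl⟩ := hx
    simp [mul_comm]
  | zero => simp
  | add x y _ _ hx hy => simp [hx, hy]
  | smul c x _ hx => simp [hx]

/-- A homomorphism to a commutative algebra kills `F^d` for `d ≥ 1`. -/
theorem ncFiltration_succ_map_eq_zero {R P : Type*} [Ring R] [Algebra ℂ R] [CommRing P]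
    [Algebra ℂ P] (π : R →ₐ[ℂ] P) (d : ℕ) (x : R) (hx : x ∈ ncFiltration R (d + 1)) : π x = 0 := by
  have h : ncFiltration R (d + 1) ≤ RingHom.ker π := by
    refine Ideal.span_le.2 ?_
    rintro x ⟨w, r, hw, hs, rfl⟩
    have h0 : ∃ e ∈ w, e.1 ≠ 0 := by
      by_contra! hcon
      have : (w.map fun e => e.1).sum = 0 := List.sum_eq_zero (by simpa using hcon)
      omega
    obtain ⟨e, he, hk⟩ := h0
    obtain ⟨k, hk⟩ := Nat.exists_eq_succ_of_ne_zero hk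
    have h2 : π e.2.2 = 0 := lieCentral_succ_map_eq_zero π k _ (by
      have := hw e he
      rwa [hk] at this)
    have h3 : π ((w.map fun e => e.2.1 * e.2.2).prod) = 0 := by
      rw [map_list_prod, List.map_map]
      exact List.prod_eq_zero (List.mem_map.2 ⟨e, he, by simp [h2]⟩)
    change π _ = 0
    rw [map_mul, h3, zero_mul]
  exact h hx

/-- The NC-completion `lim R / F^d R`, as an algebra of compatible families. -/
def ncCompletion (R : Type*) [Ring R] [Algebra ℂ R] :
    Subalgebra ℂ (∀ d : ℕ, R ⧸ ncFiltration R d) where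
  carrier := {x | ∀ d, Ideal.Quotient.factorₐ ℂ (ncFiltration_succ_le R d) (x (d + 1)) = x d}
  mul_mem' {x y} hx hy d := by
    rw [Pi.mul_apply, Pi.mul_apply, map_mul, hx d, hy d]
  add_mem' {x y} hx hy d := by
    rw [Pi.add_apply, Pi.add_apply, map_add, hx d, hy d]
  algebraMap_mem' r d := by
    rw [Pi.algebraMap_apply, Pi.algebraMap_apply, AlgHom.commutes]

/-- The canonical homomorphism from `R` to its NC-completion. -/
def toNCCompletion (R : Type*) [Ring R] [Algebra ℂ R] : R →ₐ[ℂ] ncCompletion R :=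
  AlgHom.codRestrict (AlgHom.pi fun d => Ideal.Quotient.mkₐ ℂ (ncFiltration R d)) _
    fun _ _ => rfl

/-! ### Rings of fractions -/

section Frac

variable {R : Type*} [Ring R] (S : Submonoid R) [OreLocalization.OreSet S]

/-- The ring of left fractions `s⁻¹ r` with respect to an Ore set `S`. -/
def FracRing : Type _ := OreLocalization S R

instance : Ring (FracRing S) := inferInstanceAs (Ring (OreLocalization S R))

instance [Algebra ℂ R] : Algebra ℂ (FracRing S) :=
  inferInstanceAs (Algebra ℂ (OreLocalization S R))

variable {S}

/-- The fraction `s⁻¹ r`. -/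
def FracRing.frac (r : R) (s : S) : FracRing S := OreLocalization.oreDiv r s

theorem FracRing.frac_mul_frac (r₁ r₂ : R) (s₁ s₂ : S) (r' : R) (s' : S)
    (h : (s' : R) * r₁ = r' * s₂) :
    FracRing.frac r₁ s₁ * FracRing.frac r₂ s₂ = FracRing.frac (r' * r₂) (s' * s₁) :=
  OreLocalization.oreDiv_mul_char r₁ r₂ s₁ s₂ r' s' h

theorem FracRing.frac_add_frac (r₁ r₂ : R) (s₁ s₂ : S) (r' : R) (s' : S)
    (h : (s' : R) * s₁ = r' * s₂) :
    FracRing.frac r₁ s₁ + FracRing.frac r₂ s₂ = FracRing.frac (s' * r₁ + r' * r₂) (s' * s₁) :=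
  OreLocalization.oreDiv_add_char s₁ s₂ r' s' h

variable (S)

/-- The canonical homomorphism from a ring to its ring of fractions. -/
def FracRing.of : R →+* FracRing S := OreLocalization.numeratorRingHom

theorem FracRing.of_apply (r : R) : FracRing.of S r = FracRing.frac r 1 := rfl

theorem FracRing.algebraMap_apply [Algebra ℂ R] (c : ℂ) :
    algebraMap ℂ (FracRing S) c = FracRing.frac (algebraMap ℂ R c) 1 := rfl

/-- The homomorphism of rings of fractions induced by a ring homomorphism `f` that maps the
denominators to denominators, sending `s⁻¹ r` to `f(s)⁻¹ f(r)`. -/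
def FracRing.map {R' : Type*} [Ring R'] (S' : Submonoid R') [OreLocalization.OreSet S']
    (f : R →+* R') (hf : ∀ s ∈ S, f s ∈ S') : FracRing S →+* FracRing S' :=
  OreLocalization.universalHom ((FracRing.of S').comp f)
    (Units.liftRight (((FracRing.of S').comp f).toMonoidHom.comp S.subtype)
      (fun s => OreLocalization.numeratorUnit (⟨f s, hf s s.2⟩ : S'))
      (fun _ => rfl))
    (fun _ => rfl)

theorem FracRing.map_of {R' : Type*} [Ring R'] (S' : Submonoid R') [OreLocalization.OreSet S']
    (f : R →+* R') (hf : ∀ s ∈ S, f s ∈ S') (r : R) :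
    FracRing.map S S' f hf (FracRing.of S r) = FracRing.of S' (f r) :=
  OreLocalization.universalHom_commutes _ _ _

end Frac

/-! ## The formal spectrum

Throughout, `π : A → P` is a homomorphism to a commutative algebra; the construction is applied
when `π` is the abelianization of `A`, so that `Spec P` is the underlying space. -/

/-- The truncation `A / F^{d+1} A`, an NC-nilpotent algebra of degree `d`. -/
def Trunc (A : Type*) [Ring A] [Algebra ℂ A] (d : ℕ) : Type _ := A ⧸ ncFiltration A (d + 1)

instance (A : Type*) [Ring A] [Algebra ℂ A] (d : ℕ) : Ring (Trunc A d) :=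
  inferInstanceAs (Ring (A ⧸ ncFiltration A (d + 1)))

instance (A : Type*) [Ring A] [Algebra ℂ A] (d : ℕ) : Algebra ℂ (Trunc A d) :=
  inferInstanceAs (Algebra ℂ (A ⧸ ncFiltration A (d + 1)))

/-- The projection `A → A / F^{d+1} A`. -/
def Trunc.mk (A : Type*) [Ring A] [Algebra ℂ A] (d : ℕ) : A →ₐ[ℂ] Trunc A d :=
  Ideal.Quotient.mkₐ ℂ (ncFiltration A (d + 1))

theorem Trunc.mk_surjective (A : Type*) [Ring A] [Algebra ℂ A] (d : ℕ) :
    Function.Surjective (Trunc.mk A d) :=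
  Ideal.Quotient.mk_surjective

/-- The projection `A / F^{d+2} A → A / F^{d+1} A`. -/
def Trunc.proj (A : Type*) [Ring A] [Algebra ℂ A] (d : ℕ) : Trunc A (d + 1) →ₐ[ℂ] Trunc A d :=
  Ideal.Quotient.factorₐ ℂ (ncFiltration_succ_le A (d + 1))

theorem Trunc.proj_mk (A : Type*) [Ring A] [Algebra ℂ A] (d : ℕ) (a : A) :
    Trunc.proj A d (Trunc.mk A (d + 1) a) = Trunc.mk A d a := rfl

section Spf

variable {A P : Type*} [Ring A] [Algebra ℂ A] [CommRing P] [Algebra ℂ P] (π : A →ₐ[ℂ] P)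

/-- The homomorphism `A / F^{d+1} A → P` induced by `π`. -/
def truncMap (d : ℕ) : Trunc A d →ₐ[ℂ] P :=
  Ideal.Quotient.liftₐ (ncFiltration A (d + 1)) π (ncFiltration_succ_map_eq_zero π d)

theorem truncMap_mk (d : ℕ) (a : A) : truncMap π d (Trunc.mk A d a) = π a := rfl

/-- The elements of `A / F^{d+1} A` whose image in `P` does not lie in the prime `p`. -/
def denoms (d : ℕ) (p : PrimeSpectrum P) : Submonoid (Trunc A d) :=
  p.asIdeal.primeCompl.comap (truncMap π d)

theorem mem_denoms_iff (d : ℕ) (p : PrimeSpectrum P) (s : Trunc A d) :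
    s ∈ denoms π d p ↔ truncMap π d s ∉ p.asIdeal := Iff.rfl

/-- The iterated commutator `[s, [s, ⋯ [s, a]]]` with `k` brackets. -/
def adIter {R : Type*} [Ring R] (s a : R) : ℕ → R
  | 0 => a
  | k + 1 => s * adIter s a k - adIter s a k * s

theorem adIter_mem {R : Type*} [Ring R] [Algebra ℂ R] (s a : R) (k : ℕ) :
    adIter s a k ∈ lieCentral R k := by
  induction k with
  | zero => simp [lieCentral]
  | succ k ih => exact Submodule.subset_span ⟨s, _, ih, rfl⟩

theorem adIter_map {R R' : Type*} [Ring R] [Ring R'] (f : R →+* R') (s a : R) (k : ℕ) :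
    f (adIter s a k) = adIter (f s) (f a) k := by
  induction k with
  | zero => rfl
  | succ k ih => simp [adIter, ih]

theorem adIter_trunc (d : ℕ) (s a : Trunc A d) : adIter s a (d + 1) = 0 := by
  obtain ⟨s, rfl⟩ := Trunc.mk_surjective A d s
  obtain ⟨a, rfl⟩ := Trunc.mk_surjective A d a
  refine (adIter_map (Trunc.mk A d).toRingHom s a (d + 1)).symm.trans
    (Ideal.Quotient.eq_zero_iff_mem.2 ?_)
  exact Ideal.subset_span ⟨[(d + 1, 1, adIter s a (d + 1))], 1,
    by simpa using adIter_mem s a (d + 1), by simp, by simp⟩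

theorem exists_pow_mul_eq {R : Type*} [Ring R] (s a : R) (k : ℕ) :
    ∃ b : R, s ^ k * a = b * s + adIter s a k := by
  induction k with
  | zero => exact ⟨0, by simp [adIter]⟩
  | succ k ih =>
    obtain ⟨b, hb⟩ := ih
    refine ⟨s * b + adIter s a k, ?_⟩
    rw [pow_succ', mul_assoc, hb, adIter]
    noncomm_ring

/-- The left Ore condition in `A / F^{d+1} A`, with a denominator that is a power of `s`. -/
theorem exists_ore (d : ℕ) (s a : Trunc A d) : ∃ b : Trunc A d, s ^ (d + 1) * a = b * s := by
  obtain ⟨b, hb⟩ := exists_pow_mul_eq s a (d + 1)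
  exact ⟨b, by rw [hb, adIter_trunc, add_zero]⟩

theorem pow_mul_eq_adIter {R : Type*} [Ring R] (s a : R) (h : a * s = 0) (k : ℕ) :
    s ^ k * a = adIter s a k ∧ adIter s a k * s = 0 := by
  induction k with
  | zero => exact ⟨by simp [adIter], by simpa [adIter] using h⟩
  | succ k ih =>
    have h1 : adIter s a (k + 1) = s * adIter s a k := by rw [adIter, ih.2, sub_zero]
    refine ⟨by rw [h1, pow_succ', mul_assoc, ih.1], by rw [h1, mul_assoc, ih.2, mul_zero]⟩

instance denomsOreSet (d : ℕ) (p : PrimeSpectrum P) : OreLocalization.OreSet (denoms π d p) where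
  ore_right_cancel r₁ r₂ s h := by
    refine ⟨s ^ (d + 1), ?_⟩
    have h0 : (r₁ - r₂) * (s : Trunc A d) = 0 := by rw [sub_mul, h, sub_self]
    have h1 := (pow_mul_eq_adIter (s : Trunc A d) (r₁ - r₂) h0 (d + 1)).1
    rw [adIter_trunc, mul_sub, sub_eq_zero] at h1
    simpa using h1
  oreNum r s := (exists_ore d (s : Trunc A d) r).choose
  oreDenom _ s := s ^ (d + 1)
  ore_eq r s := by
    simpa using (exists_ore d (s : Trunc A d) r).choose_spec

/-- The stalk at `p` of the structure sheaf of `Spec (A / F^{d+1} A)`: the Ore localization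
inverting every element whose image in `P` does not lie in `p`. -/
abbrev Stalk (d : ℕ) (p : PrimeSpectrum P) : Type _ := FracRing (denoms π d p)

theorem proj_mem_denoms (d : ℕ) (p : PrimeSpectrum P) (s : Trunc A (d + 1))
    (hs : s ∈ denoms π (d + 1) p) : Trunc.proj A d s ∈ denoms π d p := by
  obtain ⟨s, rfl⟩ := Trunc.mk_surjective A (d + 1) s
  rw [mem_denoms_iff, truncMap_mk] at hs
  rwa [Trunc.proj_mk, mem_denoms_iff, truncMap_mk]

/-- The transition homomorphism between the stalks for `d + 1` and for `d`. -/
def stalkProj (d : ℕ) (p : PrimeSpectrum P) : Stalk π (d + 1) p →+* Stalk π d p :=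
  FracRing.map _ _ (Trunc.proj A d).toRingHom (proj_mem_denoms π d p)

open TopologicalSpace (Opens)

/-- A family of germs is a section of the structure sheaf of `Spec (A / F^{d+1} A)` if locally it
is given by one fraction `t⁻¹ a`. -/
def IsLocallyFraction (d : ℕ) (U : Opens (PrimeSpectrum P)) (s : ∀ p : U, Stalk π d p.1) : Prop :=
  ∀ p : U, ∃ V : Opens (PrimeSpectrum P), p.1 ∈ V ∧ ∃ hV : V ≤ U, ∃ a t : Trunc A d,
    ∀ (q : PrimeSpectrum P) (hq : q ∈ V), ∃ ht : t ∈ denoms π d q,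
      s ⟨q, hV hq⟩ = FracRing.frac a ⟨t, ht⟩

/-- The sections over `U` of the structure sheaf of `Spec (A / F^{d+1} A)`. -/
def specSections (d : ℕ) (U : Opens (PrimeSpectrum P)) :
    Subalgebra ℂ (∀ p : U, Stalk π d p.1) where
  carrier := {s | IsLocallyFraction π d U s}
  mul_mem' {x y} hx hy p := by
    obtain ⟨V, hpV, hV, a, t, h⟩ := hx p
    obtain ⟨W, hpW, hW, b, u, k⟩ := hy p
    obtain ⟨c, hc⟩ := exists_ore d u a
    refine ⟨V ⊓ W, ⟨hpV, hpW⟩, inf_le_left.trans hV, c * b, u ^ (d + 1) * t, fun q hq => ?_⟩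
    obtain ⟨ht, h⟩ := h q hq.1
    obtain ⟨hu, k⟩ := k q hq.2
    refine ⟨mul_mem (pow_mem hu _) ht, ?_⟩
    rw [Pi.mul_apply, h, k]
    exact FracRing.frac_mul_frac a b ⟨t, ht⟩ ⟨u, hu⟩ c ⟨u ^ (d + 1), pow_mem hu _⟩ hc
  add_mem' {x y} hx hy p := by
    obtain ⟨V, hpV, hV, a, t, h⟩ := hx p
    obtain ⟨W, hpW, hW, b, u, k⟩ := hy p
    obtain ⟨c, hc⟩ := exists_ore d u t
    refine ⟨V ⊓ W, ⟨hpV, hpW⟩, inf_le_left.trans hV, u ^ (d + 1) * a + c * b, u ^ (d + 1) * t,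
      fun q hq => ?_⟩
    obtain ⟨ht, h⟩ := h q hq.1
    obtain ⟨hu, k⟩ := k q hq.2
    refine ⟨mul_mem (pow_mem hu _) ht, ?_⟩
    rw [Pi.add_apply, h, k]
    exact FracRing.frac_add_frac a b ⟨t, ht⟩ ⟨u, hu⟩ c ⟨u ^ (d + 1), pow_mem hu _⟩ hc
  algebraMap_mem' r p :=
    ⟨U, p.2, le_rfl, algebraMap ℂ (Trunc A d) r, 1, fun q _ =>
      ⟨one_mem _, FracRing.algebraMap_apply (denoms π d q) r⟩⟩

/-- The sections over `U` of the structure sheaf of `Spf A`, the inverse limit of the structure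
sheaves of the `Spec (A / F^{d+1} A)`. -/
def spfSections (U : Opens (PrimeSpectrum P)) :
    Subalgebra ℂ (∀ (d : ℕ) (p : U), Stalk π d p.1) where
  carrier := {s | (∀ d, s d ∈ specSections π d U) ∧
    ∀ (d : ℕ) (p : U), stalkProj π d p.1 (s (d + 1) p) = s d p}
  mul_mem' {x y} hx hy := ⟨fun d => mul_mem (hx.1 d) (hy.1 d), fun d p => by
    rw [Pi.mul_apply, Pi.mul_apply, map_mul, hx.2 d p, hy.2 d p]; rfl⟩
  add_mem' {x y} hx hy := ⟨fun d => add_mem (hx.1 d) (hy.1 d), fun d p => by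
    rw [Pi.add_apply, Pi.add_apply, map_add, hx.2 d p, hy.2 d p]; rfl⟩
  algebraMap_mem' r := ⟨fun d => algebraMap_mem (specSections π d U) r, fun d p => by
    exact FracRing.map_of _ _ _ _ _⟩

/-- Restriction of sections of the structure sheaf of `Spf A`. -/
def spfRestrict {U V : Opens (PrimeSpectrum P)} (h : V ≤ U) :
    spfSections π U →ₐ[ℂ] spfSections π V where
  toFun s := ⟨fun d p => s.1 d ⟨p.1, h p.2⟩, fun d p => by
    obtain ⟨W, hpW, hW, a, t, k⟩ := s.2.1 d ⟨p.1, h p.2⟩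
    exact ⟨W ⊓ V, ⟨hpW, p.2⟩, inf_le_right, a, t, fun q hq => k q hq.1⟩,
    fun d p => s.2.2 d ⟨p.1, h p.2⟩⟩
  map_one' := rfl
  map_mul' _ _ := rfl
  map_zero' := rfl
  map_add' _ _ := rfl
  commutes' _ := rfl

/-- The canonical homomorphism from `A` to the sections of the structure sheaf of `Spf A`. -/
def toSpfSections (U : Opens (PrimeSpectrum P)) : A →+* spfSections π U where
  toFun a := ⟨fun d p => FracRing.of (denoms π d p.1) (Trunc.mk A d a),
    fun d p => ⟨U, p.2, le_rfl, Trunc.mk A d a, 1, fun _ _ => ⟨one_mem _, rfl⟩⟩,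
    fun d p => FracRing.map_of _ _ _ _ _⟩
  map_one' := Subtype.ext (funext fun d => funext fun p => by simp)
  map_mul' _ _ := Subtype.ext (funext fun d => funext fun p => by simp)
  map_zero' := Subtype.ext (funext fun d => funext fun p => by simp)
  map_add' _ _ := Subtype.ext (funext fun d => funext fun p => by simp)

end Spf

/-! ## The noncommutative affine space -/

open TopologicalSpace (Opens)

/-- The NC-completion of the free associative algebra `ℂ⟨x₁, …, xₙ⟩`. -/
def FreeNC (n : ℕ) : Type := ncCompletion (FreeAlgebra ℂ (Fin n))

instance (n : ℕ) : Ring (FreeNC n) :=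
  inferInstanceAs (Ring (ncCompletion (FreeAlgebra ℂ (Fin n))))

instance (n : ℕ) : Algebra ℂ (FreeNC n) :=
  inferInstanceAs (Algebra ℂ (ncCompletion (FreeAlgebra ℂ (Fin n))))

/-- The canonical homomorphism from `ℂ⟨x₁, …, xₙ⟩` to its NC-completion. -/
def toFreeNC (n : ℕ) : FreeAlgebra ℂ (Fin n) →ₐ[ℂ] FreeNC n :=
  toNCCompletion (FreeAlgebra ℂ (Fin n))

/-- The abelianization homomorphism from the NC-completion of `ℂ⟨x₁, …, xₙ⟩` to
`ℂ[x₁, …, xₙ]`. -/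
def abMap (n : ℕ) : FreeNC n →ₐ[ℂ] MvPolynomial (Fin n) ℂ :=
  (Ideal.Quotient.liftₐ (ncFiltration (FreeAlgebra ℂ (Fin n)) 1)
      (FreeAlgebra.lift ℂ (MvPolynomial.X : Fin n → MvPolynomial (Fin n) ℂ))
      (ncFiltration_succ_map_eq_zero _ 0)).comp
    ((Pi.evalAlgHom ℂ (fun d : ℕ => FreeAlgebra ℂ (Fin n) ⧸ ncFiltration (FreeAlgebra ℂ (Fin n)) d)
      1).comp (ncCompletion (FreeAlgebra ℂ (Fin n))).val)

/-- Affine `n`-space over `ℂ`, as the prime spectrum of `ℂ[x₁, …, xₙ]`. -/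
abbrev AffSpace (n : ℕ) : Type := PrimeSpectrum (MvPolynomial (Fin n) ℂ)

/-- The sections over `U` of the structure sheaf of the NC-affine space, the formal spectrum of the
NC-completion of `ℂ⟨x₁, …, xₙ⟩`. -/
abbrev ncAffineSections (n : ℕ) (U : Opens (AffSpace n)) :
    Subalgebra ℂ (∀ (d : ℕ) (p : U), Stalk (abMap n) d p.1) :=
  spfSections (abMap n) U

/-! ## Regular functions and differential operators -/

/-- The field of rational functions in `n` variables. -/
abbrev RatFun (n : ℕ) : Type := FractionRing (MvPolynomial (Fin n) ℂ)

/-- The algebra `𝒪(U)` of the rational functions which are regular in `U`. -/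
def regularFunctions {n : ℕ} (U : Opens (AffSpace n)) : Subalgebra ℂ (RatFun n) where
  carrier := {f | ∀ p ∈ U, ∃ a s : MvPolynomial (Fin n) ℂ, s ∉ p.asIdeal ∧
    f * algebraMap _ (RatFun n) s = algebraMap _ (RatFun n) a}
  mul_mem' {f g} hf hg p hp := by
    obtain ⟨a, s, hs, h⟩ := hf p hp
    obtain ⟨b, t, ht, k⟩ := hg p hp
    refine ⟨a * b, s * t, fun hst => (p.isPrime.mem_or_mem hst).elim hs ht, ?_⟩
    rw [map_mul, map_mul, ← h, ← k]
    ring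
  add_mem' {f g} hf hg p hp := by
    obtain ⟨a, s, hs, h⟩ := hf p hp
    obtain ⟨b, t, ht, k⟩ := hg p hp
    refine ⟨a * t + b * s, s * t, fun hst => (p.isPrime.mem_or_mem hst).elim hs ht, ?_⟩
    rw [map_mul, map_add, map_mul, map_mul, ← h, ← k]
    ring
  algebraMap_mem' r p _ :=
    ⟨algebraMap ℂ _ r, 1, fun h => p.isPrime.ne_top ((Ideal.eq_top_iff_one _).2 h), by
      rw [map_one, mul_one, ← IsScalarTower.algebraMap_apply]⟩

theorem regularFunctions_anti {n : ℕ} {U V : Opens (AffSpace n)} (h : V ≤ U) :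
    regularFunctions U ≤ regularFunctions V := fun _ hf p hp => hf p (h hp)

/-- Polynomials are regular functions. -/
def polyToRegular {n : ℕ} (U : Opens (AffSpace n)) :
    MvPolynomial (Fin n) ℂ →ₐ[ℂ] regularFunctions U :=
  AlgHom.codRestrict (IsScalarTower.toAlgHom ℂ (MvPolynomial (Fin n) ℂ) (RatFun n)) _
    fun f p _ => ⟨f, 1, fun h => p.isPrime.ne_top ((Ideal.eq_top_iff_one _).2 h), by simp⟩

/-- The quotient rule for the partial derivative `∂/∂xᵢ` of a rational function. -/
def ratDerivFun {n : ℕ} (i : Fin n) (f : RatFun n) : RatFun n :=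
  let a := (IsLocalization.sec (nonZeroDivisors (MvPolynomial (Fin n) ℂ)) f).1
  let s : MvPolynomial (Fin n) ℂ :=
    (IsLocalization.sec (nonZeroDivisors (MvPolynomial (Fin n) ℂ)) f).2.1
  algebraMap _ (RatFun n) (s * MvPolynomial.pderiv i a - a * MvPolynomial.pderiv i s) /
    algebraMap _ (RatFun n) s ^ 2

theorem quotientRule_aux {P : Type*} [CommRing P] [Algebra ℂ P] (D : Derivation ℂ P P)
    (a b s t : P) (e : a * t = b * s) :
    (t * D b - b * D t) * s ^ 2 = (s * D a - a * D s) * t ^ 2 := by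
  have e' := congrArg D e
  rw [Derivation.leibniz, Derivation.leibniz] at e'
  simp only [smul_eq_mul] at e'
  linear_combination (-(s * t)) * e' + (s * D t + t * D s) * e

theorem ratDerivFun_eq {n : ℕ} (i : Fin n) (f : RatFun n) (a s : MvPolynomial (Fin n) ℂ)
    (hs : s ≠ 0) (h : f * algebraMap _ (RatFun n) s = algebraMap _ (RatFun n) a) :
    ratDerivFun i f =
      algebraMap _ (RatFun n) (s * MvPolynomial.pderiv i a - a * MvPolynomial.pderiv i s) /
        algebraMap _ (RatFun n) s ^ 2 := by
  set b := (IsLocalization.sec (nonZeroDivisors (MvPolynomial (Fin n) ℂ)) f).1 with hb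
  set t : MvPolynomial (Fin n) ℂ :=
    (IsLocalization.sec (nonZeroDivisors (MvPolynomial (Fin n) ℂ)) f).2.1 with ht
  have hk : f * algebraMap _ (RatFun n) t = algebraMap _ (RatFun n) b :=
    IsLocalization.sec_spec (nonZeroDivisors (MvPolynomial (Fin n) ℂ)) f
  have ht0 : t ≠ 0 := nonZeroDivisors.coe_ne_zero _
  have inj := IsFractionRing.injective (MvPolynomial (Fin n) ℂ) (RatFun n)
  have hs' : algebraMap _ (RatFun n) s ≠ 0 := by simpa using hs
  have ht' : algebraMap _ (RatFun n) t ≠ 0 := by simpa using ht0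
  have e : a * t = b * s := by
    apply inj
    rw [map_mul, map_mul, ← h, ← hk]
    ring
  have hD : ratDerivFun i f =
      algebraMap _ (RatFun n) (t * MvPolynomial.pderiv i b - b * MvPolynomial.pderiv i t) /
        algebraMap _ (RatFun n) t ^ 2 := rfl
  rw [hD, div_eq_div_iff (pow_ne_zero 2 ht') (pow_ne_zero 2 hs'), ← map_pow, ← map_pow, ← map_mul,
    ← map_mul, quotientRule_aux (MvPolynomial.pderiv i) a b s t e]

theorem exists_ratio {n : ℕ} (f : RatFun n) : ∃ a s : MvPolynomial (Fin n) ℂ, s ≠ 0 ∧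
    f * algebraMap _ (RatFun n) s = algebraMap _ (RatFun n) a :=
  ⟨_, _, nonZeroDivisors.coe_ne_zero _,
    IsLocalization.sec_spec (nonZeroDivisors (MvPolynomial (Fin n) ℂ)) f⟩

theorem ratDerivFun_add {n : ℕ} (i : Fin n) (f g : RatFun n) :
    ratDerivFun i (f + g) = ratDerivFun i f + ratDerivFun i g := by
  obtain ⟨a, s, hs, h⟩ := exists_ratio f
  obtain ⟨b, t, ht, k⟩ := exists_ratio g
  have hs' : algebraMap _ (RatFun n) s ≠ 0 := by simpa using hs
  have ht' : algebraMap _ (RatFun n) t ≠ 0 := by simpa using ht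
  rw [ratDerivFun_eq i f a s hs h, ratDerivFun_eq i g b t ht k,
    ratDerivFun_eq i (f + g) (a * t + b * s) (s * t) (mul_ne_zero hs ht) (by
      simp only [map_mul, map_add, ← h, ← k]; ring)]
  simp only [map_add, map_sub, map_mul, Derivation.leibniz, smul_eq_mul]
  generalize algebraMap (MvPolynomial (Fin n) ℂ) (RatFun n) s = S at *
  generalize algebraMap (MvPolynomial (Fin n) ℂ) (RatFun n) t = T at *
  rw [div_add_div _ _ (pow_ne_zero 2 hs') (pow_ne_zero 2 ht'),
    div_eq_div_iff (pow_ne_zero 2 (mul_ne_zero hs' ht'))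
      (mul_ne_zero (pow_ne_zero 2 hs') (pow_ne_zero 2 ht'))]
  ring

theorem ratDerivFun_mul {n : ℕ} (i : Fin n) (f g : RatFun n) :
    ratDerivFun i (f * g) = f * ratDerivFun i g + g * ratDerivFun i f := by
  obtain ⟨a, s, hs, h⟩ := exists_ratio f
  obtain ⟨b, t, ht, k⟩ := exists_ratio g
  have hs' : algebraMap _ (RatFun n) s ≠ 0 := by simpa using hs
  have ht' : algebraMap _ (RatFun n) t ≠ 0 := by simpa using ht
  rw [ratDerivFun_eq i f a s hs h, ratDerivFun_eq i g b t ht k,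
    ratDerivFun_eq i (f * g) (a * b) (s * t) (mul_ne_zero hs ht) (by
      simp only [map_mul, ← h, ← k]; ring)]
  simp only [map_sub, map_mul, Derivation.leibniz, smul_eq_mul, map_add, ← h, ← k]
  generalize algebraMap (MvPolynomial (Fin n) ℂ) (RatFun n) s = S at *
  generalize algebraMap (MvPolynomial (Fin n) ℂ) (RatFun n) t = T at *
  rw [← mul_div_assoc, ← mul_div_assoc, div_add_div _ _ (pow_ne_zero 2 ht') (pow_ne_zero 2 hs'),
    div_eq_div_iff (pow_ne_zero 2 (mul_ne_zero hs' ht'))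
      (mul_ne_zero (pow_ne_zero 2 ht') (pow_ne_zero 2 hs'))]
  ring

theorem ratDerivFun_algebraMap {n : ℕ} (i : Fin n) (a : MvPolynomial (Fin n) ℂ) :
    ratDerivFun i (algebraMap _ (RatFun n) a) =
      algebraMap _ (RatFun n) (MvPolynomial.pderiv i a) := by
  rw [ratDerivFun_eq i _ a 1 one_ne_zero (by simp)]
  simp

theorem ratDerivFun_smul {n : ℕ} (i : Fin n) (c : ℂ) (f : RatFun n) :
    ratDerivFun i (c • f) = c • ratDerivFun i f := by
  rw [Algebra.smul_def, Algebra.smul_def,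
    IsScalarTower.algebraMap_apply ℂ (MvPolynomial (Fin n) ℂ) (RatFun n), ratDerivFun_mul,
    ratDerivFun_algebraMap]
  simp [MvPolynomial.algebraMap_eq]

/-- The partial derivative `∂/∂xᵢ` on rational functions. -/
def ratDeriv {n : ℕ} (i : Fin n) : Derivation ℂ (RatFun n) (RatFun n) :=
  Derivation.mk'
    { toFun := ratDerivFun i
      map_add' := ratDerivFun_add i
      map_smul' := ratDerivFun_smul i }
    (ratDerivFun_mul i)

theorem ratDeriv_mem {n : ℕ} (U : Opens (AffSpace n)) (i : Fin n) (f : RatFun n)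
    (hf : f ∈ regularFunctions U) : ratDeriv i f ∈ regularFunctions U := by
  intro p hp
  obtain ⟨a, s, hs, h⟩ := hf p hp
  have hs0 : s ≠ 0 := fun h0 => hs (h0 ▸ p.asIdeal.zero_mem)
  have hs' : algebraMap _ (RatFun n) s ≠ 0 := by simpa using hs0
  refine ⟨s * MvPolynomial.pderiv i a - a * MvPolynomial.pderiv i s, s ^ 2,
    fun h2 => hs (p.isPrime.mem_of_pow_mem 2 h2), ?_⟩
  change ratDerivFun i f * _ = _
  rw [ratDerivFun_eq i f a s hs0 h, map_pow, div_mul_cancel₀ _ (pow_ne_zero 2 hs')]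

/-- The partial derivative `∂/∂xᵢ` on the regular functions in `U`. -/
def regularDeriv {n : ℕ} (U : Opens (AffSpace n)) (i : Fin n) :
    Derivation ℂ (regularFunctions U) (regularFunctions U) :=
  Derivation.mk'
    { toFun := fun f => ⟨ratDeriv i f.1, ratDeriv_mem U i f.1 f.2⟩
      map_add' := fun f g => Subtype.ext (map_add (ratDeriv i) f.1 g.1)
      map_smul' := fun c f => Subtype.ext ((ratDeriv i).map_smul c f.1) }
    (fun f g => Subtype.ext ((ratDeriv i).leibniz f.1 g.1))

/-- A bilinear differential operator with polynomial coefficients in `n` variables: the finitely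
supported family `c` stands for the formal expression `∑ c (α, β) · ∂^α ⊗ ∂^β`. -/
abbrev BiDiffOp (n : ℕ) : Type :=
  ((Fin n →₀ ℕ) × (Fin n →₀ ℕ)) →₀ MvPolynomial (Fin n) ℂ

/-- The iterated derivation `D₁^{α₁} ⋯ Dₙ^{αₙ}`. -/
def iterDeriv {n : ℕ} {A : Type*} [CommRing A] [Algebra ℂ A] (D : Fin n → Derivation ℂ A A)
    (α : Fin n →₀ ℕ) : Module.End ℂ A :=
  (List.ofFn fun i => ((D i : A →ₗ[ℂ] A) : Module.End ℂ A) ^ α i).prod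

/-- The value of a bilinear differential operator on two elements of a commutative algebra `A` on
which `xᵢ` acts through `e : ℂ[x₁, …, xₙ] → A` and `∂/∂xᵢ` acts as the derivation `D i`. -/
def BiDiffOp.eval {n : ℕ} {A : Type*} [CommRing A] [Algebra ℂ A]
    (e : MvPolynomial (Fin n) ℂ →ₐ[ℂ] A) (D : Fin n → Derivation ℂ A A) (C : BiDiffOp n)
    (f g : A) : A :=
  C.sum fun αβ c => e c * (iterDeriv D αβ.1 f * iterDeriv D αβ.2 g)

/-- The value of a bilinear differential operator on polynomials. -/
def BiDiffOp.evalPoly {n : ℕ} (C : BiDiffOp n) (f g : MvPolynomial (Fin n) ℂ) :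
    MvPolynomial (Fin n) ℂ :=
  C.eval (AlgHom.id ℂ _) MvPolynomial.pderiv f g

/-- The value of a bilinear differential operator on regular functions in `U`. -/
def BiDiffOp.evalRegular {n : ℕ} (U : Opens (AffSpace n)) (C : BiDiffOp n)
    (f g : regularFunctions U) : regularFunctions U :=
  C.eval (polyToRegular U) (regularDeriv U) f g

/-! ## The free Lie algebra and the normal form -/

/-- Lie monomials in `x₁, …, xₙ` of a given degree. -/
inductive IsLieMonomial {n : ℕ} : ℕ → FreeLieAlgebra ℂ (Fin n) → Prop
  | of (i : Fin n) : IsLieMonomial 1 (FreeLieAlgebra.of ℂ i)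
  | bracket {d e : ℕ} {u v : FreeLieAlgebra ℂ (Fin n)} (hu : IsLieMonomial d u)
      (hv : IsLieMonomial e v) : IsLieMonomial (d + e) ⁅u, v⁆

/-- The degree `d` part of the free Lie algebra on `x₁, …, xₙ`. -/
def lieDegree (n d : ℕ) : Submodule ℂ (FreeLieAlgebra ℂ (Fin n)) :=
  Submodule.span ℂ {u | IsLieMonomial d u}

section

attribute [local instance] LieRing.ofAssociativeRing

/-- The embedding of the free Lie algebra into the free associative algebra, where the bracket is
the commutator. -/
def lieToFree (n : ℕ) : FreeLieAlgebra ℂ (Fin n) →ₗ[ℂ] FreeAlgebra ℂ (Fin n) :=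
  (FreeLieAlgebra.lift ℂ (FreeAlgebra.ι ℂ : Fin n → FreeAlgebra ℂ (Fin n)) :
    FreeLieAlgebra ℂ (Fin n) →ₗ[ℂ] FreeAlgebra ℂ (Fin n))

end

/-- The index set of the disjoint union of ordered sets `B₂, B₃, …`, where `B_{d+2}` has `m d`
elements, with the lexicographic order (`B_d` precedes `B_{d'}` if `d < d'`). -/
abbrev LieIndex (m : ℕ → ℕ) : Type := Σₗ d : ℕ, Fin (m d)

/-- The finitely supported functions from the union of the `B_d` to the natural numbers. -/
abbrev MultiIndex (m : ℕ → ℕ) : Type := LieIndex m →₀ ℕ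

/-- `ord(λ) = ∑ λ(β) ord(β)`, where `ord(β)` is the number of brackets in `β`, that is, its degree
minus one. -/
def MultiIndex.ord {m : ℕ → ℕ} (l : MultiIndex m) : ℕ :=
  l.sum fun β k => k * ((ofLex β).1 + 1)

/-- The ordered product `M_λ = β₁^{λ(β₁)} β₂^{λ(β₂)} ⋯` of basic Lie elements. -/
def orderedMonomial {n : ℕ} {m : ℕ → ℕ}
    (B : ∀ d, Module.Basis (Fin (m d)) ℂ (lieDegree n (d + 2))) (l : MultiIndex m) :
    FreeAlgebra ℂ (Fin n) :=
  (l.support.sort.map fun β =>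
    lieToFree n (B (ofLex β).1 (ofLex β).2 : FreeLieAlgebra ℂ (Fin n)) ^ l β).prod

/-- The normal ordering `⟦f⟧` of a polynomial: each monomial `x₁^{a₁} ⋯ xₙ^{aₙ}` is replaced by the
noncommutative monomial with the variables in this order. -/
def normalOrder (n : ℕ) : MvPolynomial (Fin n) ℂ →ₗ[ℂ] FreeAlgebra ℂ (Fin n) :=
  (MvPolynomial.basisMonomials (Fin n) ℂ).constr ℂ fun a =>
    (List.ofFn fun i => FreeAlgebra.ι ℂ i ^ a i).prod

/-- The bilinear differential operators `C λ μ ν` bring products to the normal form: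
`⟦f⟧ M_λ · ⟦g⟧ M_μ = ∑_ν ⟦C λ μ ν (f, g)⟧ M_ν` in `ℂ⟨x₁, …, xₙ⟩`, the sum being finite. -/
def IsNormalFormOperators {n : ℕ} {m : ℕ → ℕ}
    (B : ∀ d, Module.Basis (Fin (m d)) ℂ (lieDegree n (d + 2)))
    (C : MultiIndex m → MultiIndex m → MultiIndex m → BiDiffOp n) : Prop :=
  ∀ (l k : MultiIndex m) (f g : MvPolynomial (Fin n) ℂ),
    {v | (C l k v).evalPoly f g ≠ 0}.Finite ∧
    normalOrder n f * orderedMonomial B l * (normalOrder n g * orderedMonomial B k) =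
      ∑ᶠ v, normalOrder n ((C l k v).evalPoly f g) * orderedMonomial B v

/-- The space `𝒜(U)` of possibly infinite formal sums `∑_λ ⟦f_λ⟧ M_λ` with `f_λ ∈ 𝒪(U)`. -/
abbrev NormalSeries {n : ℕ} (m : ℕ → ℕ) (U : Opens (AffSpace n)) : Type :=
  MultiIndex m → regularFunctions U

/-- The formal sum with the single term `⟦f⟧ M_λ`. -/
def NormalSeries.term {n : ℕ} {m : ℕ → ℕ} {U : Opens (AffSpace n)} (f : regularFunctions U)
    (l : MultiIndex m) : NormalSeries m U :=
  open Classical in Pi.single l f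

/-- The multiplication of formal sums determined by
`⟦f⟧ M_λ · ⟦g⟧ M_μ = ∑_ν ⟦C λ μ ν (f, g)⟧ M_ν`. -/
def NormalSeries.mul {n : ℕ} {m : ℕ → ℕ} {U : Opens (AffSpace n)}
    (C : MultiIndex m → MultiIndex m → MultiIndex m → BiDiffOp n) (s t : NormalSeries m U) :
    NormalSeries m U :=
  fun v => ∑ᶠ lk : MultiIndex m × MultiIndex m,
    (C lk.1 lk.2 v).evalRegular U (s lk.1) (t lk.2)

/-- Restriction of formal sums to a smaller open set. -/
def NormalSeries.restrict {n : ℕ} {m : ℕ → ℕ} {U V : Opens (AffSpace n)} (h : V ≤ U)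
    (s : NormalSeries m U) : NormalSeries m V :=
  fun l => Subalgebra.inclusion (regularFunctions_anti h) (s l)

end NCGeom

end

/-!
The products `x₁^a₁ ⋯ xₙ^aₙ M_λ` form a basis of the free algebra, of Poincaré–Birkhoff–Witt type:
they span because the generators can be sorted at the cost of brackets, and they are independent
because variables and Lie elements are primitive for the coproduct. Sorting never lowers the
number of brackets, so `F^d` is spanned by the products with `ord λ ≥ d`. An element of `F^(e+1)`
is a sum of terms `[xᵢ, u]` and `u [xᵢ, xⱼ]` with `u ∈ F^e`, as many as there are commutators of
this kind, so infinite sums may be collected term by term and the ideal `F^d` of the completion is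
the kernel of the projection to the free algebra modulo its own `F^d`.

The derivation of the free algebra extending `∂/∂xᵢ` kills every Lie element of degree at least
two, so it acts on the coefficients of the normal form. The coefficient of `M_ν` in
`⟦f⟧M_λ ⟦g⟧M_μ` is therefore a bilinear map in `f` and `g` commuting with translations, and it is a
differential operator with constant coefficients, of bounded order because the Euler derivation
makes it homogeneous.

A differential operator on rational functions that vanishes on polynomials is zero, so the
associativity of the free algebra passes to the formal series `∑ ⟦f_λ⟧ M_λ` with rational
coefficients. Such a series is invertible modulo every `F^d` as soon as `f₀ ≠ 0`, by successive
approximation along the order. Hence all the Ore localizations of the truncated free algebra embed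
into the truncated series. Under these embeddings, the germs of a section give a series independent
of the point, and its coefficients are regular because those of a fraction `t⁻¹a` are. Conversely, a
series with regular coefficients is locally a fraction modulo `F^d`: its coefficients are cleared
of denominators one order at a time.
-/

noncomputable section

namespace NCGeom

/-! ## Derivations of the free algebra -/

section FreeDeriv

variable {R X : Type*} [CommSemiring R]

/-- The derivation of the free associative algebra with prescribed values on the generators, as the
second component of a homomorphism to the square-zero extension of the free algebra by itself. -/
def freeDeriv (δ : X → FreeAlgebra R X) : FreeAlgebra R X →ₗ[R] FreeAlgebra R X :=
  (TrivSqZeroExt.sndHom (FreeAlgebra R X) (FreeAlgebra R X)).restrictScalars R ∘ₗ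
    (FreeAlgebra.lift R fun i =>
      (TrivSqZeroExt.inl (FreeAlgebra.ι R i) + TrivSqZeroExt.inr (δ i) :
        TrivSqZeroExt (FreeAlgebra R X) (FreeAlgebra R X))).toLinearMap

theorem freeDeriv_ι (δ : X → FreeAlgebra R X) (i : X) :
    freeDeriv δ (FreeAlgebra.ι R i) = δ i := by
  simp [freeDeriv]

theorem freeDeriv_mul (δ : X → FreeAlgebra R X) (a b : FreeAlgebra R X) :
    freeDeriv δ (a * b) = a * freeDeriv δ b + freeDeriv δ a * b := by
  have fst_lift : (TrivSqZeroExt.fstHom R (FreeAlgebra R X) (FreeAlgebra R X)).comp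
      (FreeAlgebra.lift R fun i => TrivSqZeroExt.inl (FreeAlgebra.ι R i) +
        TrivSqZeroExt.inr (δ i)) = AlgHom.id R _ := by
    ext i
    simp
  have fst_lift_apply := fun x => DFunLike.congr_fun fst_lift x
  simp only [AlgHom.comp_apply, TrivSqZeroExt.fstHom_apply, AlgHom.id_apply] at fst_lift_apply
  simp [freeDeriv, -DualNumber.inr_eq_smul_eps, fst_lift_apply]

theorem freeDeriv_one (δ : X → FreeAlgebra R X) : freeDeriv δ 1 = 0 := by
  simp [freeDeriv]

end FreeDeriv

/-- The derivation of the free algebra lifting `∂/∂xᵢ`. -/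
abbrev freePartial {n : ℕ} (i : Fin n) : FreeAlgebra ℂ (Fin n) →ₗ[ℂ] FreeAlgebra ℂ (Fin n) :=
  freeDeriv (Pi.single i 1)

/-- The Euler derivation of the free algebra, which multiplies words by their length. -/
abbrev freeEuler (n : ℕ) : FreeAlgebra ℂ (Fin n) →ₗ[ℂ] FreeAlgebra ℂ (Fin n) :=
  freeDeriv (FreeAlgebra.ι ℂ)

/-! ## Lie elements -/

section LieElements

variable {n d e : ℕ} {u v : FreeLieAlgebra ℂ (Fin n)}

theorem lieToFree_of (i : Fin n) : lieToFree n (FreeLieAlgebra.of ℂ i) = FreeAlgebra.ι ℂ i := by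
  simp [lieToFree]

theorem lieToFree_lie (u v : FreeLieAlgebra ℂ (Fin n)) :
    lieToFree n ⁅u, v⁆ = lieToFree n u * lieToFree n v - lieToFree n v * lieToFree n u := by
  let _ := LieRing.ofAssociativeRing (A := FreeAlgebra ℂ (Fin n))
  exact LieHom.map_lie (FreeLieAlgebra.lift ℂ (FreeAlgebra.ι ℂ : Fin n → FreeAlgebra ℂ (Fin n)))
    u v

theorem IsLieMonomial.pos (h : IsLieMonomial d u) : 0 < d := by
  induction h with
  | of => exact one_pos
  | bracket => omega

theorem IsLieMonomial.mem_lieDegree (h : IsLieMonomial d u) : u ∈ lieDegree n d :=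
  Submodule.subset_span h

theorem lie_mem_lieDegree (hu : u ∈ lieDegree n d) (hv : v ∈ lieDegree n e) :
    ⁅u, v⁆ ∈ lieDegree n (d + e) := by
  induction hu, hv using Submodule.span_induction₂ with
  | mem_mem u v hu hv => exact (IsLieMonomial.bracket hu hv).mem_lieDegree
  | zero_left | zero_right => simp
  | add_left _ _ _ _ _ _ h h' => rw [add_lie]; exact add_mem h h'
  | add_right _ _ _ _ _ _ h h' => rw [lie_add]; exact add_mem h h'
  | smul_left _ _ _ _ _ h => rw [smul_lie]; exact Submodule.smul_mem _ _ h
  | smul_right _ _ _ _ _ h => rw [lie_smul]; exact Submodule.smul_mem _ _ h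

theorem IsLieMonomial.lie_mem_span_lie_of (hu : IsLieMonomial d u) (hv : v ∈ lieDegree n e) :
    ⁅u, v⁆ ∈ Submodule.span ℂ {w | ∃ i : Fin n, ∃ v ∈ lieDegree n (d + e - 1),
      w = ⁅FreeLieAlgebra.of ℂ i, v⁆} := by
  induction hu generalizing v e with
  | of i => exact Submodule.subset_span ⟨i, v, by simpa using hv, rfl⟩
  | @bracket d₁ d₂ u₁ u₂ h₁ h₂ ih₁ ih₂ =>
    have mem₁ := ih₁ (lie_mem_lieDegree h₂.mem_lieDegree hv)
    have mem₂ := ih₂ (lie_mem_lieDegree h₁.mem_lieDegree hv)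
    rw [← add_assoc] at mem₁
    rw [← add_assoc, add_comm d₂] at mem₂
    rw [lie_lie]
    exact sub_mem mem₁ mem₂

theorem lieDegree_add_two_le_span_lie_of (n k : ℕ) :
    lieDegree n (k + 2) ≤ Submodule.span ℂ {w | ∃ i : Fin n, ∃ v ∈ lieDegree n (k + 1),
      w = ⁅FreeLieAlgebra.of ℂ i, v⁆} := by
  refine Submodule.span_le.2 fun u hu => ?_
  generalize hd : k + 2 = d at hu
  cases hu with
  | of i => omega
  | @bracket d e u v h h' =>
    have mem := h.lie_mem_span_lie_of h'.mem_lieDegree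
    rwa [show d + e - 1 = k + 1 by omega] at mem

theorem lieDegree_one (n : ℕ) :
    lieDegree n 1 = Submodule.span ℂ (Set.range (FreeLieAlgebra.of ℂ)) := by
  refine congrArg (Submodule.span ℂ) (Set.ext fun u => ⟨fun hu => ?_, ?_⟩)
  · rw [Set.mem_ofPred_eq] at hu
    generalize hd : 1 = d at hu
    cases hu with
    | of i => exact ⟨i, rfl⟩
    | bracket h h' => have := h.pos; have := h'.pos; omega
  · rintro ⟨i, rfl⟩
    exact .of i

/-- The representation of the free algebra on `L × ℂ`, for `L` the free Lie algebra, in which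
`xᵢ (v, c) = ([xᵢ, v] + c xᵢ, 0)`. Evaluation at `(0, 1)` is Dynkin's operator, which replaces a
word by the corresponding right normed bracket. -/
def dynkinRep (n : ℕ) :
    FreeAlgebra ℂ (Fin n) →ₐ[ℂ] Module.End ℂ (FreeLieAlgebra ℂ (Fin n) × ℂ) :=
  FreeAlgebra.lift ℂ fun i => LinearMap.inl ℂ _ _ ∘ₗ
    LinearMap.coprod (LieAlgebra.ad ℂ _ (FreeLieAlgebra.of ℂ i))
      (LinearMap.toSpanSingleton ℂ _ (FreeLieAlgebra.of ℂ i))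

theorem IsLieMonomial.dynkinRep_lieToFree (hu : IsLieMonomial d u)
    (x : FreeLieAlgebra ℂ (Fin n) × ℂ) :
    dynkinRep n (lieToFree n u) x = (⁅u, x.1⁆ + (x.2 * d) • u, 0) := by
  induction hu generalizing x with
  | of i => simp [dynkinRep, lieToFree_of]
  | @bracket d e u v _ _ ihu ihv =>
    rw [lieToFree_lie, map_sub, map_mul, map_mul, LinearMap.sub_apply, Module.End.mul_apply,
      Module.End.mul_apply, ihu, ihv, ihu, ihv]
    ext
    · simp only [Prod.fst_sub, lie_add, lie_smul, zero_mul, zero_smul, add_zero, lie_lie]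
      rw [← lie_skew u v]
      push_cast
      simp only [mul_add, add_smul, smul_neg]
      abel
    · simp

theorem fst_dynkinRep_lieToFree (hu : u ∈ lieDegree n d) :
    (dynkinRep n (lieToFree n u) (0, 1)).1 = (d : ℂ) • u := by
  let dynkin := LinearMap.fst ℂ (FreeLieAlgebra ℂ (Fin n)) ℂ ∘ₗ
    LinearMap.applyₗ ((0, 1) : FreeLieAlgebra ℂ (Fin n) × ℂ) ∘ₗ
    (dynkinRep n).toLinearMap ∘ₗ lieToFree n
  suffices Set.EqOn dynkin ((d : ℂ) • LinearMap.id : FreeLieAlgebra ℂ (Fin n) →ₗ[ℂ] _)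
    (lieDegree n d) from this hu
  refine LinearMap.eqOn_span fun v hv => ?_
  simp [dynkin, IsLieMonomial.dynkinRep_lieToFree hv]

theorem disjoint_lieDegree_ker_lieToFree (hd : d ≠ 0) :
    Disjoint (lieDegree n d) (LinearMap.ker (lieToFree n)) := by
  refine Submodule.disjoint_def.2 fun u hu h => ?_
  have dynkin := fst_dynkinRep_lieToFree hu
  rw [LinearMap.mem_ker.1 h, map_zero, LinearMap.zero_apply, Prod.fst_zero] at dynkin
  exact (smul_eq_zero.1 dynkin.symm).resolve_left (Nat.cast_ne_zero.2 hd)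

theorem IsLieMonomial.freeEuler_lieToFree (hu : IsLieMonomial d u) :
    freeEuler n (lieToFree n u) = (d : ℂ) • lieToFree n u := by
  unfold freeEuler
  induction hu with
  | of i => rw [lieToFree_of, freeDeriv_ι, Nat.cast_one, one_smul]
  | bracket _ _ ihu ihv =>
    rw [lieToFree_lie, map_sub, freeDeriv_mul, freeDeriv_mul, ihu, ihv]
    simp only [mul_smul_comm, smul_mul_assoc, Nat.cast_add]
    module

theorem freeEuler_lieToFree (hu : u ∈ lieDegree n d) :
    freeEuler n (lieToFree n u) = (d : ℂ) • lieToFree n u :=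
  LinearMap.eqOn_span (f := freeEuler n ∘ₗ lieToFree n) (g := (d : ℂ) • lieToFree n)
    (fun _ hv => IsLieMonomial.freeEuler_lieToFree hv) hu

theorem freePartial_lieToFree_lie {i : Fin n} {c c' : ℂ}
    (hu : freePartial i (lieToFree n u) = algebraMap ℂ _ c)
    (hv : freePartial i (lieToFree n v) = algebraMap ℂ _ c') :
    freePartial i (lieToFree n ⁅u, v⁆) = 0 := by
  rw [freePartial] at hu hv ⊢
  rw [lieToFree_lie, map_sub, freeDeriv_mul, freeDeriv_mul, hu, hv, Algebra.commutes c,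
    Algebra.commutes c']
  abel

theorem IsLieMonomial.exists_freePartial_lieToFree_eq (hu : IsLieMonomial d u) (i : Fin n) :
    ∃ c : ℂ, freePartial i (lieToFree n u) = algebraMap ℂ _ c := by
  induction hu with
  | of j =>
    refine ⟨if j = i then 1 else 0, ?_⟩
    rw [lieToFree_of, freePartial, freeDeriv_ι, Pi.single_apply]
    split_ifs <;> simp
  | bracket _ _ ihu ihv =>
    obtain ⟨c, hc⟩ := ihu
    obtain ⟨c', hc'⟩ := ihv
    exact ⟨0, by rw [freePartial_lieToFree_lie hc hc', map_zero]⟩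

theorem IsLieMonomial.freePartial_lieToFree (i : Fin n) (hu : IsLieMonomial d u) (hd : 2 ≤ d) :
    freePartial i (lieToFree n u) = 0 := by
  cases hu with
  | of j => omega
  | bracket hv hw =>
    obtain ⟨c, hc⟩ := hv.exists_freePartial_lieToFree_eq i
    obtain ⟨c', hc'⟩ := hw.exists_freePartial_lieToFree_eq i
    exact freePartial_lieToFree_lie hc hc'

theorem freePartial_lieToFree (i : Fin n) (hu : u ∈ lieDegree n d) (hd : 2 ≤ d) :
    freePartial i (lieToFree n u) = 0 :=
  LinearMap.eqOn_span (f := freePartial i ∘ₗ lieToFree n) (g := 0)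
    (fun _ hv => IsLieMonomial.freePartial_lieToFree i hv hd) hu

end LieElements

/-! ## The NC-filtration -/

section NCFiltration

variable {R R' : Type*} [Ring R] [Algebra ℂ R] [Ring R'] [Algebra ℂ R'] {k d e : ℕ}

theorem lie_mem_lieCentral_succ (a : R) {b : R} (hb : b ∈ lieCentral R k) :
    a * b - b * a ∈ lieCentral R (k + 1) :=
  Submodule.subset_span ⟨a, b, hb, rfl⟩

theorem lie_mem_lieCentral {a b : R} (ha : a ∈ lieCentral R d) (hb : b ∈ lieCentral R e) :
    a * b - b * a ∈ lieCentral R (d + e + 1) := by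
  induction d generalizing a b e with
  | zero => simpa only [zero_add] using lie_mem_lieCentral_succ a hb
  | succ d ih =>
    suffices lieCentral R (d + 1) ≤ (lieCentral R (d + 1 + e + 1)).comap
        (LinearMap.mulRight ℂ b - LinearMap.mulLeft ℂ b : R →ₗ[ℂ] R) from this ha
    refine Submodule.span_le.2 ?_
    rintro _ ⟨c, a, ha, rfl⟩
    have outer_c := lie_mem_lieCentral_succ c (ih ha hb)
    have inner_c := ih ha (lie_mem_lieCentral_succ c hb)
    rw [← add_assoc, add_right_comm d] at inner_c
    rw [add_right_comm d] at outer_c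
    have jacobi : (c * a - a * c) * b - b * (c * a - a * c) =
        c * (a * b - b * a) - (a * b - b * a) * c -
          (a * (c * b - b * c) - (c * b - b * c) * a) := by
      noncomm_ring
    change (c * a - a * c) * b - b * (c * a - a * c) ∈ lieCentral R (d + 1 + e + 1)
    rw [jacobi]
    exact sub_mem outer_c inner_c

theorem lieCentral_map_le (f : R →ₐ[ℂ] R') (k : ℕ) :
    (lieCentral R k).map f.toLinearMap ≤ lieCentral R' k := by
  induction k with
  | zero => exact le_top
  | succ k ih =>
    rw [lieCentral, Submodule.map_span_le]
    rintro _ ⟨a, b, hb, rfl⟩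
    simpa using lie_mem_lieCentral_succ (f a) (ih (Submodule.mem_map_of_mem hb))

theorem lieCentral_map_of_surjective {f : R →ₐ[ℂ] R'} (hf : Function.Surjective f) (k : ℕ) :
    (lieCentral R k).map f.toLinearMap = lieCentral R' k := by
  refine (lieCentral_map_le f k).antisymm ?_
  induction k with
  | zero =>
    exact fun x _ => (hf x).imp fun y hy => ⟨Submodule.mem_top, hy⟩
  | succ k ih =>
    rw [lieCentral, Submodule.span_le]
    rintro _ ⟨a, b, hb, rfl⟩
    obtain ⟨a, rfl⟩ := hf a
    obtain ⟨b', hb', rfl⟩ := ih hb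
    exact ⟨a * b' - b' * a, lie_mem_lieCentral_succ a hb', by simp⟩

theorem ncFiltration_antitone : Antitone (ncFiltration R) :=
  antitone_nat_of_succ_le (ncFiltration_succ_le R)

theorem mem_ncFiltration_zero (x : R) : x ∈ ncFiltration R 0 :=
  Submodule.subset_span ⟨[], x, by simp, by simp, by simp⟩

theorem lieCentral_le_ncFiltration {x : R} (hx : x ∈ lieCentral R k) : x ∈ ncFiltration R k :=
  Submodule.subset_span ⟨[(k, 1, x)], 1, by simpa using hx, by simp, by simp⟩

theorem lieCentral_mul_mem_ncFiltration {l x : R} (hl : l ∈ lieCentral R k)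
    (hx : x ∈ ncFiltration R d) : l * x ∈ ncFiltration R (k + d) := by
  induction hx using Submodule.closure_induction with
  | zero => simp
  | add x y _ _ hx hy => rw [mul_add]; exact add_mem hx hy
  | smul_mem c x hx =>
    obtain ⟨w, r, hw, rfl, rfl⟩ := hx
    refine Submodule.subset_span ⟨(k, 1, l) :: (0, c, 1) :: w, r, ?_, by simp,
      by simp [mul_assoc]⟩
    simpa [hl, lieCentral] using fun e => hw e

@[elab_as_elim]
theorem ncFiltration_induction {p : (d : ℕ) → (x : R) → x ∈ ncFiltration R d → Prop}
    (one : p 0 1 (mem_ncFiltration_zero 1))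
    (mul_left : ∀ d a x hx, p d x hx → p d (a * x) (Ideal.mul_mem_left _ a hx))
    (lieCentral_mul : ∀ k d l x hl hx, p d x hx →
      p (k + d) (l * x) (lieCentral_mul_mem_ncFiltration hl hx))
    (add : ∀ d x y hx hy, p d x hx → p d y hy → p d (x + y) (add_mem hx hy))
    {x : R} (hx : x ∈ ncFiltration R d) : p d x hx := by
  induction hx using Submodule.closure_induction with
  | zero => simpa using lieCentral_mul d 0 0 1 (zero_mem _) (mem_ncFiltration_zero 1) one
  | add x y hx hy hpx hpy => exact add d x y hx hy hpx hpy
  | smul_mem c x hx =>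
    obtain ⟨w, r, hw, rfl, rfl⟩ := hx
    suffices ∃ hx, p _ _ hx from mul_left _ c _ this.1 this.2
    clear c
    induction w with
    | nil => exact ⟨mem_ncFiltration_zero _, by simpa using mul_left 0 r 1 _ one⟩
    | cons e w ih =>
      obtain ⟨hx, hpx⟩ := ih fun e he => hw e (List.mem_cons_of_mem _ he)
      have he := hw e List.mem_cons_self
      have hex := Ideal.mul_mem_left _ e.2.1 (lieCentral_mul_mem_ncFiltration he hx)
      simpa [mul_assoc] using
        ⟨hex, mul_left _ e.2.1 _ _ (lieCentral_mul _ _ _ _ he hx hpx)⟩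

theorem mul_mem_ncFiltration {x y : R} (hx : x ∈ ncFiltration R d) (hy : y ∈ ncFiltration R e) :
    x * y ∈ ncFiltration R (d + e) := by
  induction hx using ncFiltration_induction with
  | one => simpa using hy
  | mul_left d a x _ hx => rw [mul_assoc]; exact Ideal.mul_mem_left _ a hx
  | lieCentral_mul k d l x hl _ hx =>
    rw [mul_assoc, add_assoc]
    exact lieCentral_mul_mem_ncFiltration hl hx
  | add d x y _ _ hx hy => rw [add_mul]; exact add_mem hx hy

theorem lie_mem_ncFiltration_succ (a : R) {x : R} (hx : x ∈ ncFiltration R d) :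
    a * x - x * a ∈ ncFiltration R (d + 1) := by
  have leibniz (y x : R) : a * (y * x) - y * x * a = (a * y - y * a) * x + y * (a * x - x * a) := by
    noncomm_ring
  induction hx using ncFiltration_induction with
  | one => simp
  | mul_left d b x hx ih =>
    have hab : a * b - b * a ∈ ncFiltration R 1 :=
      lieCentral_le_ncFiltration (lie_mem_lieCentral_succ a (k := 0) Submodule.mem_top)
    rw [leibniz]
    exact add_mem (add_comm 1 d ▸ mul_mem_ncFiltration hab hx) (Ideal.mul_mem_left _ b ih)
  | lieCentral_mul k d l x hl hx ih =>
    have hal := lieCentral_mul_mem_ncFiltration (lie_mem_lieCentral_succ a hl) hx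
    rw [add_right_comm, add_assoc] at hal
    rw [leibniz, add_assoc]
    exact add_mem hal (lieCentral_mul_mem_ncFiltration hl ih)
  | add d x y _ _ ihx ihy =>
    rw [mul_add, add_mul, add_sub_add_comm]
    exact add_mem ihx ihy

theorem map_mem_ncFiltration (f : R →ₐ[ℂ] R') {x : R} (hx : x ∈ ncFiltration R d) :
    f x ∈ ncFiltration R' d := by
  induction hx using ncFiltration_induction with
  | one => exact mem_ncFiltration_zero _
  | mul_left d a x _ hx => rw [map_mul]; exact Ideal.mul_mem_left _ _ hx
  | lieCentral_mul k d l x hl _ hx =>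
    rw [map_mul]
    have hfl : f l ∈ lieCentral R' k := lieCentral_map_le f k (Submodule.mem_map_of_mem hl)
    exact lieCentral_mul_mem_ncFiltration hfl hx
  | add d x y _ _ hx hy => rw [map_add]; exact add_mem hx hy

theorem exists_mem_ncFiltration_of_surjective {f : R →ₐ[ℂ] R'} (hf : Function.Surjective f)
    {x : R'} (hx : x ∈ ncFiltration R' d) : ∃ y ∈ ncFiltration R d, f y = x := by
  induction hx using ncFiltration_induction with
  | one => exact ⟨1, mem_ncFiltration_zero 1, map_one f⟩
  | mul_left d a x _ hx =>
    obtain ⟨x, hx, rfl⟩ := hx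
    obtain ⟨a, rfl⟩ := hf a
    exact ⟨a * x, Ideal.mul_mem_left _ a hx, map_mul f a x⟩
  | lieCentral_mul k d l x hl _ hx =>
    obtain ⟨x, hx, rfl⟩ := hx
    obtain ⟨l', hl', rfl⟩ := (lieCentral_map_of_surjective hf k).ge hl
    exact ⟨l' * x, lieCentral_mul_mem_ncFiltration hl' hx, map_mul f l' x⟩
  | add d x y _ _ hx hy =>
    obtain ⟨x, hx, rfl⟩ := hx
    obtain ⟨y, hy, rfl⟩ := hy
    exact ⟨x + y, add_mem hx hy, map_add f x y⟩

end NCFiltration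

theorem lieToFree_mem_lieCentral {n k : ℕ} {u : FreeLieAlgebra ℂ (Fin n)}
    (hu : u ∈ lieDegree n (k + 1)) : lieToFree n u ∈ lieCentral (FreeAlgebra ℂ (Fin n)) k := by
  suffices ∀ d, lieDegree n d ≤
      (lieCentral (FreeAlgebra ℂ (Fin n)) (d - 1)).comap (lieToFree n) from this (k + 1) hu
  refine fun d => Submodule.span_le.2 fun u hu => ?_
  replace hu : IsLieMonomial d u := hu
  change lieToFree n u ∈ lieCentral _ (d - 1)
  induction hu with
  | of i => exact Submodule.mem_top
  | @bracket d e u v hu hv ihu ihv =>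
    have mem := lie_mem_lieCentral ihu ihv
    have := hu.pos
    have := hv.pos
    rwa [← lieToFree_lie, show d - 1 + (e - 1) + 1 = d + e - 1 by omega] at mem

/-! ## Ordered products -/

section Products

variable {K J A : Type*} [CommRing K] [Ring A] [Algebra K A]

variable (K) in
/-- The span of the products of the `b j` of total weight at least `e`. -/
def weightSpan (b : J → A) (w : J → ℕ) (e : ℕ) : Submodule K A :=
  Submodule.span K {x | ∃ l : List J, e ≤ (l.map w).sum ∧ x = (l.map b).prod}

variable (K) in
/-- The span of the products of at most `N` of the `b j` of total weight at least `e`. Induction on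
`N` proves that products can be straightened into ordered ones. -/
def boundedWeightSpan (b : J → A) (w : J → ℕ) (N e : ℕ) : Submodule K A :=
  Submodule.span K {x | ∃ l : List J, l.length ≤ N ∧ e ≤ (l.map w).sum ∧ x = (l.map b).prod}

variable {b : J → A} {w : J → ℕ} {N M e f : ℕ} {x y : A}

theorem boundedWeightSpan_mono {N' e' : ℕ} (hN : N ≤ N') (he : e' ≤ e) :
    boundedWeightSpan K b w N e ≤ boundedWeightSpan K b w N' e' :=
  Submodule.span_mono fun _ ⟨l, hlN, hle, hx⟩ => ⟨l, hlN.trans hN, he.trans hle, hx⟩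

theorem boundedWeightSpan_le_weightSpan : boundedWeightSpan K b w N e ≤ weightSpan K b w e :=
  Submodule.span_mono fun _ ⟨l, _, hle, hx⟩ => ⟨l, hle, hx⟩

theorem weightSpan_antitone : Antitone (weightSpan K b w) :=
  fun _ _ he => Submodule.span_mono fun _ ⟨l, hle, hx⟩ => ⟨l, he.trans hle, hx⟩

theorem mul_mem_boundedWeightSpan (hx : x ∈ boundedWeightSpan K b w N e)
    (hy : y ∈ boundedWeightSpan K b w M f) : x * y ∈ boundedWeightSpan K b w (N + M) (e + f) := by
  have mem := Submodule.mul_mem_mul hx hy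
  rw [boundedWeightSpan, boundedWeightSpan, Submodule.span_mul_span] at mem
  refine Submodule.span_mono ?_ mem
  rintro _ ⟨_, ⟨l, hlN, hle, rfl⟩, _, ⟨l', hlM, hlf, rfl⟩, rfl⟩
  exact ⟨l ++ l', by simp; omega, by simp; omega, by simp⟩

theorem mul_mem_weightSpan (hx : x ∈ weightSpan K b w e) (hy : y ∈ weightSpan K b w f) :
    x * y ∈ weightSpan K b w (e + f) := by
  have mem := Submodule.mul_mem_mul hx hy
  rw [weightSpan, weightSpan, Submodule.span_mul_span] at mem
  refine Submodule.span_mono ?_ mem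
  rintro _ ⟨_, ⟨l, hle, rfl⟩, _, ⟨l', hlf, rfl⟩, rfl⟩
  exact ⟨l ++ l', by simp; omega, by simp⟩

theorem prod_mem_boundedWeightSpan (l : List J) :
    (l.map b).prod ∈ boundedWeightSpan K b w l.length (l.map w).sum :=
  Submodule.subset_span ⟨l, le_rfl, le_rfl, rfl⟩

theorem mem_boundedWeightSpan_one (j : J) : b j ∈ boundedWeightSpan K b w 1 (w j) := by
  simpa using prod_mem_boundedWeightSpan (K := K) (b := b) (w := w) [j]

/-- The product of the elements `b j`, `j ∈ s`, in increasing order. -/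
def sortedProd {J M : Type*} [LinearOrder J] [Monoid M] (b : J → M) (s : Multiset J) : M :=
  (s.sort.map b).prod

section SortedProd

variable {M : Type*} [LinearOrder J] [Monoid M] (b : J → M)

theorem sortedProd_zero : sortedProd b 0 = 1 := by
  simp [sortedProd]

theorem sortedProd_singleton (j : J) : sortedProd b {j} = b j := by
  simp [sortedProd]

theorem sortedProd_cons {j : J} {s : Multiset J} (h : ∀ i ∈ s, j ≤ i) :
    sortedProd b (j ::ₘ s) = b j * sortedProd b s := by
  rw [sortedProd, Multiset.sort_cons _ _ _ h, List.map_cons, List.prod_cons, sortedProd]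

end SortedProd

section Straighten

variable (hb : ∀ i j, b i * b j - b j * b i ∈ Submodule.span K (b '' {k | w k = w i + w j + 1}))

include hb

theorem lie_mem_boundedWeightSpan_one (i j : J) :
    b i * b j - b j * b i ∈ boundedWeightSpan K b w 1 (w i + w j + 1) := by
  refine Submodule.span_le.2 ?_ (hb i j)
  rintro _ ⟨k, hk, rfl⟩
  exact Set.mem_ofPred_eq ▸ hk ▸ mem_boundedWeightSpan_one k

theorem prod_sub_prod_mem_of_perm {l l' : List J} (h : l.Perm l') :
    (l.map b).prod - (l'.map b).prod ∈
      boundedWeightSpan K b w (l.length - 1) ((l.map w).sum + 1) := by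
  induction h with
  | nil => simp
  | @cons x l l' h ih =>
    rcases l with _ | ⟨y, l⟩
    · simp [List.nil_perm.1 h]
    · rw [List.map_cons (f := b), List.prod_cons, List.map_cons (f := b) (a := x), List.prod_cons,
        ← mul_sub]
      refine boundedWeightSpan_mono ?_ ?_
        (mul_mem_boundedWeightSpan (mem_boundedWeightSpan_one x) ih)
      · simp [add_comm]
      · simp [add_assoc]
  | swap x y l =>
    have factor : (List.map b (y :: x :: l)).prod - (List.map b (x :: y :: l)).prod =
        (b y * b x - b x * b y) * (l.map b).prod := by
      simp only [List.map_cons, List.prod_cons]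
      noncomm_ring
    rw [factor]
    refine boundedWeightSpan_mono ?_ ?_ (mul_mem_boundedWeightSpan
      (lie_mem_boundedWeightSpan_one hb y x) (prod_mem_boundedWeightSpan l))
    · simp only [List.length_cons]; omega
    · simp only [List.map_cons, List.sum_cons]; omega
  | trans h _ ih ih' =>
    rw [← h.length_eq, ← (h.map w).sum_eq] at ih'
    simpa using add_mem ih ih'

theorem boundedWeightSpan_le_span_sortedProd [LinearOrder J] (N e : ℕ) :
    boundedWeightSpan K b w N e ≤
      Submodule.span K (sortedProd b '' {s : Multiset J | e ≤ (s.map w).sum}) := by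
  induction N generalizing e with
  | zero =>
    refine Submodule.span_le.2 ?_
    rintro _ ⟨l, hl, hle, rfl⟩
    obtain rfl : l = [] := List.length_eq_zero_iff.1 (Nat.le_zero.1 hl)
    exact Submodule.subset_span ⟨0, by simpa using hle, by simp [sortedProd_zero]⟩
  | succ N ih =>
    refine Submodule.span_le.2 ?_
    rintro _ ⟨l, hl, hle, rfl⟩
    have perm_sort : l.Perm (Multiset.sort ↑l (· ≤ ·)) := by
      rw [← Multiset.coe_eq_coe, Multiset.sort_eq]
    have mem_diff := ih e (boundedWeightSpan_mono (by omega) (by omega)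
      (prod_sub_prod_mem_of_perm hb perm_sort))
    have mem_sorted : sortedProd b ↑l ∈ Submodule.span K (sortedProd b '' {s : Multiset J |
        e ≤ (s.map w).sum}) := Submodule.subset_span ⟨↑l, by simpa using hle, rfl⟩
    simpa [sortedProd] using add_mem mem_diff mem_sorted

theorem weightSpan_eq_span_sortedProd [LinearOrder J] (e : ℕ) :
    weightSpan K b w e =
      Submodule.span K (sortedProd b '' {s : Multiset J | e ≤ (s.map w).sum}) := by
  refine le_antisymm (Submodule.span_le.2 ?_) (Submodule.span_mono ?_)
  · rintro _ ⟨l, hle, rfl⟩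
    exact boundedWeightSpan_le_span_sortedProd hb l.length e
      (boundedWeightSpan_mono le_rfl hle (prod_mem_boundedWeightSpan l))
  · rintro _ ⟨s, hs, rfl⟩
    refine ⟨s.sort, ?_, rfl⟩
    rw [← Multiset.sum_coe, ← Multiset.map_coe, Multiset.sort_eq]
    exact hs

theorem lie_mem_weightSpan (hx : x ∈ weightSpan K b w e) (hy : y ∈ weightSpan K b w f) :
    x * y - y * x ∈ weightSpan K b w (e + f + 1) := by
  have mem := Submodule.apply_mem_map₂ (LinearMap.mul K A - (LinearMap.mul K A).flip) hx hy
  rw [weightSpan, weightSpan, Submodule.map₂_span_span] at mem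
  refine Submodule.span_le.2 ?_ mem
  rintro _ ⟨_, ⟨l, hle, rfl⟩, _, ⟨l', hlf, rfl⟩, rfl⟩
  have mem_append := boundedWeightSpan_le_weightSpan (prod_sub_prod_mem_of_perm hb
    (List.perm_append_comm (l₁ := l) (l₂ := l')))
  simp only [List.map_append, List.prod_append, List.sum_append] at mem_append
  exact weightSpan_antitone (by omega) mem_append

end Straighten

end Products

/-! ## Independence of ordered products of primitive elements -/

section Independence

open TensorProduct

variable {K J A : Type*} [CommRing K] [Ring A] [Algebra K A]

open Classical in
variable (K J) in
/-- The coproduct of ordered products of primitive elements, on the level of formal linear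
combinations. -/
def formalComul : (Multiset J →₀ K) →ₗ[K] (Multiset J × Multiset J →₀ K) :=
  Finsupp.linearCombination K fun s => (s.antidiagonal.map fun p => Finsupp.single p 1).sum

theorem multiset_sum_single_apply {α : Type*} [DecidableEq α] (s : Multiset α) (a : α) :
    (s.map fun p => Finsupp.single p (1 : K)).sum a = s.count a := by
  induction s using Multiset.induction_on with
  | empty => simp
  | cons b s ih =>
    rw [Multiset.map_cons, Multiset.sum_cons, Finsupp.add_apply, ih, Finsupp.single_apply]
    rw [Multiset.count_cons, Nat.cast_add, Nat.cast_ite, add_comm]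
    simp [eq_comm]

theorem formalComul_apply [DecidableEq J] (v : Multiset J →₀ K) (p : Multiset J × Multiset J) :
    formalComul K J v p = v (p.1 + p.2) * (p.1 + p.2).antidiagonal.count p := by
  rw [formalComul, Finsupp.linearCombination_apply, Finsupp.sum, Finsupp.finsetSum_apply,
    Finset.sum_eq_single (p.1 + p.2)]
  · rw [Finsupp.smul_apply, multiset_sum_single_apply, smul_eq_mul]
  · intro s _ hs
    have not_mem : p ∉ s.antidiagonal := fun h => hs (Multiset.mem_antidiagonal.1 h).symm
    rw [Finsupp.smul_apply, multiset_sum_single_apply, Multiset.count_eq_zero_of_notMem not_mem,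
      Nat.cast_zero, smul_zero]
  · intro h
    simp [Finsupp.notMem_support_iff.1 h]

variable [LinearOrder J] {b : J → A}

section Coproduct

variable {Δ : A →ₐ[K] A ⊗[K] A} (hΔ : ∀ j, Δ (b j) = b j ⊗ₜ 1 + 1 ⊗ₜ b j)

include hΔ

theorem comul_sortedProd_coe {l : List J} (hl : l.Pairwise (· ≤ ·)) :
    Δ (sortedProd b ↑l) =
      ((l : Multiset J).antidiagonal.map fun p =>
        sortedProd b p.1 ⊗ₜ[K] sortedProd b p.2).sum := by
  induction l with
  | nil => simp [sortedProd_zero, Algebra.TensorProduct.one_def]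
  | cons j l ih =>
    rw [List.pairwise_cons] at hl
    have le_of_mem : ∀ p ∈ (l : Multiset J).antidiagonal, ∀ i ∈ p.1 + p.2, j ≤ i := by
      intro p hp i hi
      rw [Multiset.mem_antidiagonal.1 hp] at hi
      exact hl.1 i hi
    rw [← Multiset.cons_coe, sortedProd_cons b (by simpa using hl.1), map_mul, ih hl.2, hΔ,
      Multiset.antidiagonal_cons, Multiset.map_add, Multiset.sum_add, Multiset.map_map,
      Multiset.map_map, add_mul, ← Multiset.sum_map_mul_left, ← Multiset.sum_map_mul_left,
      add_comm]
    congr 2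
    · refine Multiset.map_congr rfl fun p hp => ?_
      simp [sortedProd_cons b fun i hi => le_of_mem p hp i (Multiset.mem_add.2 (.inr hi))]
    · refine Multiset.map_congr rfl fun p hp => ?_
      simp [sortedProd_cons b fun i hi => le_of_mem p hp i (Multiset.mem_add.2 (.inl hi))]

theorem comul_sortedProd (s : Multiset J) :
    Δ (sortedProd b s) =
      (s.antidiagonal.map fun p => sortedProd b p.1 ⊗ₜ[K] sortedProd b p.2).sum := by
  have comul := comul_sortedProd_coe hΔ (Multiset.pairwise_sort s (· ≤ ·))
  rwa [Multiset.sort_eq] at comul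

theorem linearCombination_formalComul (v : Multiset J →₀ K) :
    Finsupp.linearCombination K (fun p : Multiset J × Multiset J =>
      sortedProd b p.1 ⊗ₜ[K] sortedProd b p.2) (formalComul K J v) =
      Δ (Finsupp.linearCombination K (sortedProd b) v) := by
  induction v using Finsupp.induction_linear with
  | zero => simp
  | add v v' hv hv' => simp only [map_add, hv, hv']
  | single s c =>
    rw [formalComul, Finsupp.linearCombination_single, Finsupp.linearCombination_single, map_smul,
      map_smul, comul_sortedProd hΔ, map_multiset_sum, Multiset.map_map]
    simp

end Coproduct

section Counit

variable {ε : A →ₐ[K] K} (hε : ∀ j, ε (b j) = 0)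

include hε

theorem counit_sortedProd {s : Multiset J} (hs : s ≠ 0) : ε (sortedProd b s) = 0 := by
  rw [sortedProd, map_list_prod, List.map_map]
  obtain ⟨j, hj⟩ := Multiset.exists_mem_of_ne_zero hs
  exact List.prod_eq_zero (List.mem_map.2 ⟨j, (Multiset.mem_sort _).2 hj, hε j⟩)

theorem counit_linearCombination_sortedProd (v : Multiset J →₀ K) :
    ε (Finsupp.linearCombination K (sortedProd b) v) = v 0 := by
  induction v using Finsupp.induction_linear with
  | zero => simp
  | add v v' hv hv' => simp [hv, hv']
  | single s c =>
    rcases eq_or_ne s 0 with rfl | hs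
    · simp [sortedProd_zero]
    · simp [counit_sortedProd hε hs, Finsupp.single_eq_of_ne hs.symm]

theorem linearIndepOn_sortedProd_card_le_one (hb : LinearIndependent K b) :
    LinearIndepOn K (sortedProd b) {s | s.card ≤ 1} := by
  rw [linearIndepOn_iff]
  intro v hv relation
  have singleton_injective : Function.Injective (fun j : J => ({j} : Multiset J)) :=
    fun _ _ => Multiset.singleton_inj.1
  have v_eq : (v.comapDomain (fun j : J => ({j} : Multiset J))
      singleton_injective.injOn).mapDomain (fun j => {j}) = v := by
    refine Finsupp.mapDomain_comapDomain _ singleton_injective _ fun s hs => ?_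
    have card_ne_zero : s.card ≠ 0 := by
      rw [Ne, Multiset.card_eq_zero]
      rintro rfl
      refine Finsupp.mem_support_iff.1 hs ?_
      rw [← counit_linearCombination_sortedProd hε v, relation, map_zero]
    obtain ⟨j, rfl⟩ := Multiset.card_eq_one.1
      (le_antisymm (hv hs) (Nat.one_le_iff_ne_zero.2 card_ne_zero))
    exact ⟨j, rfl⟩
  rw [← v_eq, Finsupp.linearCombination_mapDomain,
    show (sortedProd b ∘ fun j => {j}) = b from funext (sortedProd_singleton b)] at relation
  rw [← v_eq, linearIndependent_iff.1 hb _ relation, Finsupp.mapDomain_zero]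

theorem map_sub_counit_linearCombination (v : Multiset J × Multiset J →₀ K) :
    TensorProduct.map (LinearMap.id - Algebra.linearMap K A ∘ₗ ε.toLinearMap)
        (LinearMap.id - Algebra.linearMap K A ∘ₗ ε.toLinearMap)
        (Finsupp.linearCombination K (fun p : Multiset J × Multiset J =>
          sortedProd b p.1 ⊗ₜ[K] sortedProd b p.2) v) =
      Finsupp.linearCombination K (fun p : Multiset J × Multiset J =>
        sortedProd b p.1 ⊗ₜ[K] sortedProd b p.2) (v.filter fun p => p.1 ≠ 0 ∧ p.2 ≠ 0) := by
  induction v using Finsupp.induction_linear with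
  | zero => simp only [Finsupp.filter_zero, map_zero]
  | add v v' hv hv' => simp only [map_add, hv, hv', Finsupp.filter_add]
  | single p c =>
    obtain ⟨s, t⟩ := p
    by_cases hp : s ≠ 0 ∧ t ≠ 0
    · rw [Finsupp.filter_single_of_pos (fun p : Multiset J × Multiset J => p.1 ≠ 0 ∧ p.2 ≠ 0) hp]
      simp [counit_sortedProd hε hp.1, counit_sortedProd hε hp.2]
    · rw [Finsupp.filter_single_of_neg (fun p : Multiset J × Multiset J => p.1 ≠ 0 ∧ p.2 ≠ 0) hp]
      rw [not_and_or, not_ne_iff, not_ne_iff] at hp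
      rcases hp with rfl | rfl <;> simp [sortedProd_zero]

variable [IsDomain K] [CharZero K] {Δ : A →ₐ[K] A ⊗[K] A}
  (hΔ : ∀ j, Δ (b j) = b j ⊗ₜ 1 + 1 ⊗ₜ b j)

include hΔ

-- The reduced coproduct sends a relation of degree `N + 1` to a relation between tensor products of
-- ordered products of degree at most `N`.
theorem linearIndepOn_sortedProd_card_le_succ (hN : N ≠ 0)
    (ih : LinearIndepOn K (sortedProd b) {s | s.card ≤ N}) :
    LinearIndepOn K (sortedProd b) {s | s.card ≤ N + 1} := by
  have ih_tmul := ih.tmul_of_isDomain ih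
  rw [linearIndepOn_iff] at ih ih_tmul ⊢
  intro v hv relation
  set reduced := (formalComul K J v).filter fun p => p.1 ≠ 0 ∧ p.2 ≠ 0 with reduced_def
  have reduced_relation : Finsupp.linearCombination K (fun p : Multiset J × Multiset J =>
      sortedProd b p.1 ⊗ₜ[K] sortedProd b p.2) reduced = 0 := by
    rw [← map_sub_counit_linearCombination hε, linearCombination_formalComul hΔ, relation,
      map_zero, map_zero]
  have reduced_mem : reduced ∈ Finsupp.supported K K ({s | s.card ≤ N} ×ˢ {s | s.card ≤ N}) := by
    intro p hp
    rw [Finset.mem_coe, Finsupp.support_filter, Finset.mem_filter, Finsupp.mem_support_iff,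
      formalComul_apply] at hp
    have card_le : (p.1 + p.2).card ≤ N + 1 :=
      hv (Finsupp.mem_support_iff.2 (left_ne_zero_of_mul hp.1))
    have card_fst_pos := Multiset.card_pos.2 hp.2.1
    have card_snd_pos := Multiset.card_pos.2 hp.2.2
    rw [Multiset.card_add] at card_le
    exact ⟨show p.1.card ≤ N by omega, show p.2.card ≤ N by omega⟩
  refine ih v (fun s hs => ?_) relation
  by_contra hcard
  change ¬ s.card ≤ N at hcard
  obtain ⟨j, hj⟩ := Multiset.exists_mem_of_ne_zero (s := s) (by rintro rfl; simp at hcard)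
  obtain ⟨t, rfl⟩ := Multiset.exists_cons_of_mem hj
  have ht : t ≠ 0 := by
    rintro rfl
    rw [Multiset.card_cons, Multiset.card_zero] at hcard
    omega
  have coeff_eq_zero := DFunLike.congr_fun (ih_tmul _ reduced_mem reduced_relation) ({j}, t)
  rw [reduced_def, Finsupp.filter_apply, if_pos ⟨Multiset.singleton_ne_zero j, ht⟩,
    formalComul_apply, Finsupp.zero_apply, mul_eq_zero, Nat.cast_eq_zero, Multiset.count_eq_zero,
    Multiset.mem_antidiagonal] at coeff_eq_zero
  exact coeff_eq_zero.elim (Finsupp.mem_support_iff.1 hs) fun h => h rfl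

theorem linearIndependent_sortedProd (hb : LinearIndependent K b) :
    LinearIndependent K (sortedProd b) := by
  have indep : ∀ N : ℕ, LinearIndepOn K (sortedProd b) {s | s.card ≤ N + 1} := by
    intro N
    induction N with
    | zero => exact linearIndepOn_sortedProd_card_le_one hε hb
    | succ N ih => exact linearIndepOn_sortedProd_card_le_succ hε hΔ N.succ_ne_zero ih
  rw [linearIndependent_iff]
  intro v hv
  refine linearIndepOn_iff.1 (indep (v.support.sup Multiset.card)) v (fun s hs => ?_) hv
  exact (Finset.le_sup (f := Multiset.card) hs).trans (Nat.le_succ _)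

end Counit

end Independence

/-! ## The Poincaré–Birkhoff–Witt basis of the free algebra -/

section PBW

open Sum.Lex TensorProduct

/-- The coproduct of the free algebra for which the variables are primitive. -/
def freeComul (R X : Type*) [CommSemiring R] :
    FreeAlgebra R X →ₐ[R] FreeAlgebra R X ⊗[R] FreeAlgebra R X :=
  FreeAlgebra.lift R fun i => FreeAlgebra.ι R i ⊗ₜ 1 + 1 ⊗ₜ FreeAlgebra.ι R i

section Primitive

variable {n d : ℕ} {u : FreeLieAlgebra ℂ (Fin n)}

theorem IsLieMonomial.freeComul_lieToFree (hu : IsLieMonomial d u) :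
    freeComul ℂ (Fin n) (lieToFree n u) = lieToFree n u ⊗ₜ 1 + 1 ⊗ₜ lieToFree n u := by
  induction hu with
  | of i => simp [freeComul, lieToFree_of]
  | bracket _ _ ihu ihv =>
    rw [lieToFree_lie, map_sub, map_mul, map_mul, ihu, ihv]
    simp only [add_mul, mul_add, Algebra.TensorProduct.tmul_mul_tmul, one_mul, mul_one,
      TensorProduct.sub_tmul, TensorProduct.tmul_sub]
    abel

theorem freeComul_lieToFree (hu : u ∈ lieDegree n d) :
    freeComul ℂ (Fin n) (lieToFree n u) = lieToFree n u ⊗ₜ 1 + 1 ⊗ₜ lieToFree n u :=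
  LinearMap.eqOn_span (f := (freeComul ℂ (Fin n)).toLinearMap ∘ₗ lieToFree n)
    (g := ((TensorProduct.mk ℂ (FreeAlgebra ℂ (Fin n)) (FreeAlgebra ℂ (Fin n))).flip 1 +
      TensorProduct.mk ℂ (FreeAlgebra ℂ (Fin n)) (FreeAlgebra ℂ (Fin n)) 1) ∘ₗ lieToFree n)
    (fun _ hv => IsLieMonomial.freeComul_lieToFree hv) hu

theorem IsLieMonomial.algebraMapInv_lieToFree (hu : IsLieMonomial d u) :
    FreeAlgebra.algebraMapInv (lieToFree n u) = 0 := by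
  induction hu with
  | of i => simp [FreeAlgebra.algebraMapInv, lieToFree_of]
  | bracket _ _ ihu ihv => simp [lieToFree_lie, ihu, ihv]

theorem algebraMapInv_lieToFree (hu : u ∈ lieDegree n d) :
    FreeAlgebra.algebraMapInv (lieToFree n u) = 0 :=
  LinearMap.eqOn_span (f := FreeAlgebra.algebraMapInv.toLinearMap ∘ₗ lieToFree n) (g := 0)
    (fun _ hv => IsLieMonomial.algebraMapInv_lieToFree hv) hu

end Primitive

variable {n : ℕ} {m : ℕ → ℕ} (B : ∀ d, Module.Basis (Fin (m d)) ℂ (lieDegree n (d + 2)))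

/-- The element `β` of the ordered basis of the free Lie algebra, in the free algebra. -/
def basicLie (β : LieIndex m) : FreeAlgebra ℂ (Fin n) :=
  lieToFree n (B (ofLex β).1 (ofLex β).2)

/-- The generators of the Poincaré–Birkhoff–Witt basis: the variables, followed by the basic Lie
elements. -/
def pbwGen (j : Fin n ⊕ₗ LieIndex m) : FreeAlgebra ℂ (Fin n) :=
  Sum.elim (FreeAlgebra.ι ℂ) (basicLie B) (ofLex j)

/-- The number of brackets in a generator of the Poincaré–Birkhoff–Witt basis. -/
def pbwWeight (j : Fin n ⊕ₗ LieIndex m) : ℕ :=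
  Sum.elim (fun _ => 0) (fun β => (ofLex β).1 + 1) (ofLex j)

theorem exists_pbwGen_eq (j : Fin n ⊕ₗ LieIndex m) :
    ∃ u ∈ lieDegree n (pbwWeight j + 1), pbwGen B j = lieToFree n u := by
  rcases j with i | β
  · exact ⟨FreeLieAlgebra.of ℂ i, (IsLieMonomial.of i).mem_lieDegree, (lieToFree_of i).symm⟩
  · exact ⟨_, (B (ofLex β).1 (ofLex β).2).2, rfl⟩

theorem lieToFree_mem_span_pbwGen {d : ℕ} {u : FreeLieAlgebra ℂ (Fin n)}
    (hu : u ∈ lieDegree n (d + 2)) :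
    lieToFree n u ∈ Submodule.span ℂ (pbwGen B '' {k | pbwWeight k = d + 1}) := by
  have expansion := congrArg Subtype.val ((B d).sum_repr ⟨u, hu⟩)
  rw [Submodule.coe_sum] at expansion
  rw [← show _ = u from expansion, map_sum]
  refine sum_mem fun i _ => ?_
  rw [Submodule.coe_smul, map_smul]
  exact Submodule.smul_mem _ _ (Submodule.subset_span ⟨Sum.inrₗ (toLex ⟨d, i⟩), rfl, rfl⟩)

theorem pbwGen_lie_mem_span_pbwGen (i j : Fin n ⊕ₗ LieIndex m) :
    pbwGen B i * pbwGen B j - pbwGen B j * pbwGen B i ∈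
      Submodule.span ℂ (pbwGen B '' {k | pbwWeight k = pbwWeight i + pbwWeight j + 1}) := by
  obtain ⟨u, hu, hui⟩ := exists_pbwGen_eq B i
  obtain ⟨v, hv, hvj⟩ := exists_pbwGen_eq B j
  have mem := lie_mem_lieDegree hu hv
  rw [show pbwWeight i + 1 + (pbwWeight j + 1) = pbwWeight i + pbwWeight j + 2 by ring] at mem
  rw [hui, hvj, ← lieToFree_lie]
  exact lieToFree_mem_span_pbwGen B mem

theorem freePartial_basicLie (i : Fin n) (β : LieIndex m) : freePartial i (basicLie B β) = 0 :=
  freePartial_lieToFree i (B (ofLex β).1 (ofLex β).2).2 (Nat.le_add_left 2 _)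

theorem linearIndependent_ι (n : ℕ) :
    LinearIndependent ℂ (FreeAlgebra.ι ℂ : Fin n → FreeAlgebra ℂ (Fin n)) := by
  rw [Fintype.linearIndependent_iff]
  intro g hg i
  simpa [freePartial, freeDeriv_ι, Pi.single_apply] using congrArg (freePartial i) hg

theorem linearIndependent_basicLie_degree (d : ℕ) :
    LinearIndependent ℂ fun i : Fin (m d) => basicLie B (toLex ⟨d, i⟩) := by
  refine (B d).linearIndependent.map' ((lieToFree n).domRestrict _) ?_
  rw [LinearMap.ker_eq_bot, LinearMap.injective_domRestrict_iff]
  exact (disjoint_lieDegree_ker_lieToFree (Nat.succ_ne_zero _))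

theorem basicLie_mem_eigenspace (β : LieIndex m) :
    basicLie B β ∈ Module.End.eigenspace (freeEuler n) (((ofLex β).1 + 2 : ℕ) : ℂ) :=
  Module.End.mem_eigenspace_iff.2 (freeEuler_lieToFree (B (ofLex β).1 (ofLex β).2).2)

theorem linearIndependent_basicLie : LinearIndependent ℂ (basicLie B) := by
  have span_le (d : ℕ) : Submodule.span ℂ (Set.range fun i => basicLie B (toLex ⟨d, i⟩)) ≤
      Module.End.eigenspace (freeEuler n) ((d + 2 : ℕ) : ℂ) :=
    Submodule.span_le.2 (Set.range_subset_iff.2 fun i => basicLie_mem_eigenspace B (toLex ⟨d, i⟩))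
  have indep : LinearIndependent ℂ fun β : Σ d : ℕ, Fin (m d) => basicLie B (toLex β) := by
    refine linearIndependent_iUnion_finite (f := fun d i => basicLie B (toLex ⟨d, i⟩))
      (linearIndependent_basicLie_degree B) fun d t _ hd => ?_
    refine (Module.End.eigenspaces_iSupIndep (freeEuler n) ((d + 2 : ℕ) : ℂ)).mono (span_le d)
      (iSup₂_le fun e he => (span_le e).trans (le_iSup₂_of_le ((e + 2 : ℕ) : ℂ) ?_ le_rfl))
    have hed : e ≠ d := fun h => hd (h ▸ he)
    exact_mod_cast (add_left_injective 2).ne hed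
  exact indep.comp ofLex ofLex.injective

theorem linearIndependent_pbwGen : LinearIndependent ℂ (pbwGen B) := by
  refine LinearIndependent.comp ((linearIndependent_ι n).sum_type (linearIndependent_basicLie B) ?_)
    ofLex ofLex.injective
  refine (Module.End.eigenspaces_iSupIndep (freeEuler n) 1).mono
    (Submodule.span_le.2 (Set.range_subset_iff.2 fun i => ?_))
    (Submodule.span_le.2 (Set.range_subset_iff.2 fun β => ?_))
  · exact Module.End.mem_eigenspace_iff.2 (by simp [freeEuler, freeDeriv_ι])
  · refine Submodule.mem_iSup_of_mem (((ofLex β).1 + 2 : ℕ) : ℂ)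
      (Submodule.mem_iSup_of_mem ?_ (basicLie_mem_eigenspace B β))
    norm_cast
    omega

theorem linearIndependent_sortedProd_pbwGen : LinearIndependent ℂ (sortedProd (pbwGen B)) := by
  refine linearIndependent_sortedProd (ε := FreeAlgebra.algebraMapInv)
    (Δ := freeComul ℂ (Fin n)) (fun j => ?_) (fun j => ?_) (linearIndependent_pbwGen B) <;>
  obtain ⟨u, hu, hj⟩ := exists_pbwGen_eq B j
  · rw [hj, algebraMapInv_lieToFree hu]
  · rw [hj, freeComul_lieToFree hu]

theorem weightSpan_pbwGen_zero : weightSpan ℂ (pbwGen B) pbwWeight 0 = ⊤ := by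
  rw [eq_top_iff]
  rintro x -
  induction x using FreeAlgebra.induction with
  | grade0 c =>
    rw [Algebra.algebraMap_eq_smul_one]
    exact Submodule.smul_mem _ _ (Submodule.subset_span ⟨[], by simp, by simp⟩)
  | grade1 i => exact Submodule.subset_span ⟨[Sum.inlₗ i], Nat.zero_le _, by simp [pbwGen]⟩
  | mul a b ha hb => exact mul_mem_weightSpan (e := 0) (f := 0) ha hb
  | add a b ha hb => exact add_mem ha hb

theorem mem_weightSpan_pbwGen_zero (x : FreeAlgebra ℂ (Fin n)) :
    x ∈ weightSpan ℂ (pbwGen B) pbwWeight 0 :=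
  weightSpan_pbwGen_zero B ▸ Submodule.mem_top

theorem lieCentral_le_weightSpan (k : ℕ) :
    lieCentral (FreeAlgebra ℂ (Fin n)) k ≤ weightSpan ℂ (pbwGen B) pbwWeight k := by
  induction k with
  | zero => exact fun x _ => mem_weightSpan_pbwGen_zero B x
  | succ k ih =>
    refine Submodule.span_le.2 ?_
    rintro _ ⟨a, b, hb, rfl⟩
    simpa using lie_mem_weightSpan (pbwGen_lie_mem_span_pbwGen B)
      (mem_weightSpan_pbwGen_zero B a) (ih hb)

theorem prod_map_pbwGen_mem_ncFiltration (l : List (Fin n ⊕ₗ LieIndex m)) :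
    (l.map (pbwGen B)).prod ∈ ncFiltration (FreeAlgebra ℂ (Fin n)) (l.map pbwWeight).sum := by
  induction l with
  | nil => exact mem_ncFiltration_zero 1
  | cons j l ih =>
    obtain ⟨u, hu, hj⟩ := exists_pbwGen_eq B j
    rw [List.map_cons, List.map_cons, List.prod_cons, List.sum_cons, hj]
    exact lieCentral_mul_mem_ncFiltration (lieToFree_mem_lieCentral hu) ih

theorem mem_ncFiltration_iff_mem_weightSpan (e : ℕ) (x : FreeAlgebra ℂ (Fin n)) :
    x ∈ ncFiltration (FreeAlgebra ℂ (Fin n)) e ↔ x ∈ weightSpan ℂ (pbwGen B) pbwWeight e := by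
  constructor
  · intro hx
    induction hx using ncFiltration_induction with
    | one => exact mem_weightSpan_pbwGen_zero B 1
    | mul_left d a x _ hx =>
      simpa using mul_mem_weightSpan (mem_weightSpan_pbwGen_zero B a) hx
    | lieCentral_mul k d l x hl _ hx =>
      exact mul_mem_weightSpan (lieCentral_le_weightSpan B k hl) hx
    | add d x y _ _ hx hy => exact add_mem hx hy
  · suffices weightSpan ℂ (pbwGen B) pbwWeight e ≤
        (ncFiltration (FreeAlgebra ℂ (Fin n)) e).restrictScalars ℂ from fun hx => this hx
    refine Submodule.span_le.2 ?_
    rintro _ ⟨l, hl, rfl⟩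
    exact ncFiltration_antitone hl (prod_map_pbwGen_mem_ncFiltration B l)

/-! ## The normal form -/

theorem sortedProd_coe {J M : Type*} [LinearOrder J] [Monoid M] (b : J → M) {l : List J}
    (hl : l.Pairwise (· ≤ ·)) : sortedProd b ↑l = (l.map b).prod := by
  rw [sortedProd, Multiset.coe_sort, List.mergeSort_of_pairwise (by simpa using hl)]

theorem toMultiset_eq_coe_flatMap_replicate {J : Type*} (f : J →₀ ℕ) {l : List J} (hl : l.Nodup)
    (hf : ∀ j, f j ≠ 0 → j ∈ l) :
    Finsupp.toMultiset f = ↑(l.flatMap fun j => List.replicate (f j) j) := by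
  classical
  rw [Finsupp.toMultiset_apply, Finsupp.sum_of_support_subset f (s := l.toFinset)
    (fun j hj => List.mem_toFinset.2 (hf j (Finsupp.mem_support_iff.1 hj))) _ (by simp),
    List.sum_toFinset _ hl]
  simp only [Multiset.nsmul_singleton]
  exact Multiset.coe_bind l fun j => List.replicate (f j) j

theorem sortedProd_toMultiset {J M : Type*} [LinearOrder J] [Monoid M] (b : J → M) (f : J →₀ ℕ)
    {l : List J} (hl : l.Pairwise (· < ·)) (hf : ∀ j, f j ≠ 0 → j ∈ l) :
    sortedProd b (Finsupp.toMultiset f) = (l.map fun j => b j ^ f j).prod := by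
  rw [toMultiset_eq_coe_flatMap_replicate f (hl.imp ne_of_lt) hf, sortedProd_coe b]
  · simp [List.flatMap, List.prod_flatten, Function.comp_def]
  · rw [List.pairwise_flatMap]
    refine ⟨fun j _ => List.pairwise_replicate.2 (.inr le_rfl), hl.imp fun hij x hx y hy => ?_⟩
    rw [List.eq_of_mem_replicate hx, List.eq_of_mem_replicate hy]
    exact hij.le

/-- The exponents of the variables and those of the basic Lie elements, combined. -/
def pbwExponent (a : Fin n →₀ ℕ) (l : MultiIndex m) : (Fin n ⊕ₗ LieIndex m) →₀ ℕ :=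
  (Finsupp.sumElim a l).equivMapDomain toLex

/-- The pairs of exponents of the variables and of the basic Lie elements correspond to the
multisets of generators. -/
def pbwIndexEquiv : (Σ _ : MultiIndex m, Fin n →₀ ℕ) ≃ Multiset (Fin n ⊕ₗ LieIndex m) :=
  ((Equiv.sigmaEquivProd _ _).trans (Equiv.prodComm _ _)).trans
    (Finsupp.sumFinsuppEquivProdFinsupp.symm.trans
      ((Finsupp.equivCongrLeft toLex).trans Multiset.toFinsupp.symm.toEquiv))

theorem pbwIndexEquiv_apply (x : Σ _ : MultiIndex m, Fin n →₀ ℕ) :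
    pbwIndexEquiv x = Finsupp.toMultiset (pbwExponent x.2 x.1) := rfl

theorem sum_pbwWeight_pbwIndexEquiv (x : Σ _ : MultiIndex m, Fin n →₀ ℕ) :
    ((pbwIndexEquiv x).map pbwWeight).sum = x.1.ord := by
  rw [pbwIndexEquiv_apply, Finsupp.toMultiset_map, Finsupp.sum_toMultiset, pbwExponent,
    Finsupp.sum_mapDomain_index (by simp) (by simp [add_mul]), Finsupp.sum_equivMapDomain,
    Finsupp.sum_sumElim]
  simp [pbwWeight, MultiIndex.ord, Finsupp.sum]

theorem normalOrder_monomial (a : Fin n →₀ ℕ) :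
    normalOrder n (MvPolynomial.monomial a 1) =
      (List.ofFn fun i => FreeAlgebra.ι ℂ i ^ a i).prod :=
  (MvPolynomial.basisMonomials (Fin n) ℂ).constr_basis ℂ _ a

theorem sortedProd_pbwIndexEquiv (x : Σ _ : MultiIndex m, Fin n →₀ ℕ) :
    sortedProd (pbwGen B) (pbwIndexEquiv x) =
      normalOrder n (MvPolynomial.monomial x.2 1) * orderedMonomial B x.1 := by
  obtain ⟨l, a⟩ := x
  rw [pbwIndexEquiv_apply, sortedProd_toMultiset (pbwGen B) _
    (l := (List.finRange n).map Sum.inlₗ ++ l.support.sort.map Sum.inrₗ), List.map_append,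
    List.prod_append, List.map_map, List.map_map, normalOrder_monomial, List.ofFn_eq_map]
  · rfl
  · rw [List.pairwise_append, List.pairwise_map, List.pairwise_map]
    refine ⟨(List.pairwise_lt_finRange n).imp Sum.Lex.inl_lt_inl_iff.2,
      (Finset.sortedLT_sort l.support).pairwise.imp Sum.Lex.inr_lt_inr_iff.2, fun x hx y hy => ?_⟩
    obtain ⟨i, -, rfl⟩ := List.mem_map.1 hx
    obtain ⟨β, -, rfl⟩ := List.mem_map.1 hy
    exact Sum.Lex.inl_lt_inr _ _
  · rintro (i | β) hj
    · exact List.mem_append_left _ (List.mem_map_of_mem (List.mem_finRange i))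
    · exact List.mem_append_right _ (List.mem_map_of_mem
        ((Finset.mem_sort _).2 (Finsupp.mem_support_iff.2 hj)))

/-- The Poincaré–Birkhoff–Witt basis of the free algebra: the products `⟦x^a⟧ M_λ`. -/
def pbwBasis : Module.Basis (Σ _ : MultiIndex m, Fin n →₀ ℕ) ℂ (FreeAlgebra ℂ (Fin n)) :=
  (Module.Basis.mk (linearIndependent_sortedProd_pbwGen B) (by
    rw [← weightSpan_pbwGen_zero B, weightSpan_eq_span_sortedProd (pbwGen_lie_mem_span_pbwGen B)]
    exact Submodule.span_mono (Set.image_subset_range _ _))).reindex pbwIndexEquiv.symm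

theorem pbwBasis_eq_sortedProd (x : Σ _ : MultiIndex m, Fin n →₀ ℕ) :
    pbwBasis B x = sortedProd (pbwGen B) (pbwIndexEquiv x) := by
  rw [pbwBasis, Module.Basis.reindex_apply, Equiv.symm_symm, Module.Basis.mk_apply]

/-- The normal form `∑ ⟦f_λ⟧ M_λ` of the elements of the free algebra, as the family of the
polynomials `f_λ`. -/
def normalForm : FreeAlgebra ℂ (Fin n) ≃ₗ[ℂ] (MultiIndex m →₀ MvPolynomial (Fin n) ℂ) :=
  (pbwBasis B).equiv
    (Finsupp.basis fun _ : MultiIndex m => MvPolynomial.basisMonomials (Fin n) ℂ) (Equiv.refl _)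

theorem normalForm_pbwBasis (l : MultiIndex m) (a : Fin n →₀ ℕ) :
    normalForm B (pbwBasis B ⟨l, a⟩) = Finsupp.single l (MvPolynomial.monomial a 1) := by
  rw [normalForm, Module.Basis.equiv_apply, Equiv.refl_apply, Finsupp.coe_basis,
    MvPolynomial.coe_basisMonomials]

theorem coeff_normalForm (x : FreeAlgebra ℂ (Fin n)) (l : MultiIndex m) (a : Fin n →₀ ℕ) :
    (normalForm B x l).coeff a = (pbwBasis B).repr x ⟨l, a⟩ := by
  change (Finsupp.basis fun _ : MultiIndex m => MvPolynomial.basisMonomials (Fin n) ℂ).repr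
    (normalForm B x) ⟨l, a⟩ = _
  rw [normalForm, Module.Basis.equiv, LinearEquiv.trans_apply, Equiv.refl_symm,
    Module.Basis.reindex_refl, LinearEquiv.apply_symm_apply]

theorem normalForm_term (f : MvPolynomial (Fin n) ℂ) (l : MultiIndex m) :
    normalForm B (normalOrder n f * orderedMonomial B l) = Finsupp.single l f := by
  suffices (normalForm B).toLinearMap ∘ₗ LinearMap.mulRight ℂ (orderedMonomial B l) ∘ₗ
      normalOrder n = Finsupp.lsingle l from DFunLike.congr_fun this f
  refine (MvPolynomial.basisMonomials (Fin n) ℂ).ext fun a => ?_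
  have basis_term := normalForm_pbwBasis B l a
  rw [pbwBasis_eq_sortedProd, sortedProd_pbwIndexEquiv] at basis_term
  simpa using basis_term

theorem normalForm_symm_single (f : MvPolynomial (Fin n) ℂ) (l : MultiIndex m) :
    (normalForm B).symm (Finsupp.single l f) = normalOrder n f * orderedMonomial B l := by
  rw [LinearEquiv.symm_apply_eq, normalForm_term]

theorem eq_sum_normalForm (x : FreeAlgebra ℂ (Fin n)) :
    x = (normalForm B x).sum fun l f => normalOrder n f * orderedMonomial B l := by
  conv_lhs => rw [← (normalForm B).symm_apply_apply x, ← Finsupp.sum_single (normalForm B x)]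
  rw [map_finsuppSum]
  simp only [normalForm_symm_single]

theorem normalForm_induction {p : FreeAlgebra ℂ (Fin n) → Prop}
    (term : ∀ (f : MvPolynomial (Fin n) ℂ) (l : MultiIndex m),
      p (normalOrder n f * orderedMonomial B l)) (zero : p 0)
    (add : ∀ x y, p x → p y → p (x + y)) (x : FreeAlgebra ℂ (Fin n)) : p x := by
  rw [eq_sum_normalForm B x]
  exact Finset.sum_induction _ p add zero fun l _ => term _ l

theorem weightSpan_pbwGen_eq_span_pbwBasis (e : ℕ) :
    weightSpan ℂ (pbwGen B) pbwWeight e = Submodule.span ℂ (pbwBasis B '' {x | e ≤ x.1.ord}) := by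
  rw [weightSpan_eq_span_sortedProd (pbwGen_lie_mem_span_pbwGen B),
    ← pbwIndexEquiv.image_preimage {s | _}, Set.image_image]
  simp only [← pbwBasis_eq_sortedProd, Set.preimage_ofPred_eq, sum_pbwWeight_pbwIndexEquiv]

theorem mem_ncFiltration_iff (e : ℕ) (x : FreeAlgebra ℂ (Fin n)) :
    x ∈ ncFiltration (FreeAlgebra ℂ (Fin n)) e ↔
      ∀ l : MultiIndex m, l.ord < e → normalForm B x l = 0 := by
  rw [mem_ncFiltration_iff_mem_weightSpan B, weightSpan_pbwGen_eq_span_pbwBasis,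
    Module.Basis.mem_span_image]
  simp only [MvPolynomial.ext_iff, coeff_normalForm, MvPolynomial.coeff_zero, Set.subset_def,
    Finset.mem_coe, Finsupp.mem_support_iff, Set.mem_ofPred_eq, Sigma.forall, ← not_lt]
  exact forall_congr' fun l => ⟨fun h hl a => by_contra fun ha => h a ha hl,
    fun h a ha hl => ha (h hl a)⟩

end PBW

/-! ## Derivations and the normal form -/

section EigenvectorProducts

variable {R X : Type*} [CommSemiring R] (δ : X → FreeAlgebra R X)

theorem freeDeriv_pow_eq_smul {y : FreeAlgebra R X} {c : R} (hy : freeDeriv δ y = c • y) (r : ℕ) :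
    freeDeriv δ (y ^ r) = (r * c) • y ^ r := by
  induction r with
  | zero => simp [freeDeriv_one]
  | succ r ih =>
    rw [pow_succ, freeDeriv_mul, ih, hy, mul_smul_comm, smul_mul_assoc, ← add_smul]
    push_cast
    ring_nf

theorem freeDeriv_list_prod_eq_smul {ι : Type*} {y : ι → FreeAlgebra R X} {c : ι → R} {k : List ι}
    (hy : ∀ j ∈ k, freeDeriv δ (y j) = c j • y j) :
    freeDeriv δ (k.map y).prod = (k.map c).sum • (k.map y).prod := by
  induction k with
  | nil => simp [freeDeriv_one]
  | cons j k ih =>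
    rw [List.forall_mem_cons] at hy
    rw [List.map_cons, List.prod_cons, freeDeriv_mul, ih hy.2, hy.1, mul_smul_comm, smul_mul_assoc,
      ← add_smul, List.map_cons, List.sum_cons, add_comm]

end EigenvectorProducts

section DerivNormalForm

variable {n : ℕ} {m : ℕ → ℕ} (B : ∀ d, Module.Basis (Fin (m d)) ℂ (lieDegree n (d + 2)))

/-- The degree of `M_λ` in the generators `x_1, …, x_n`. -/
def MultiIndex.deg (l : MultiIndex m) : ℕ :=
  l.sum fun β k => k * ((ofLex β).1 + 2)

theorem freeEuler_orderedMonomial (l : MultiIndex m) :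
    freeEuler n (orderedMonomial B l) = (l.deg : ℂ) • orderedMonomial B l := by
  have euler_prod := freeDeriv_list_prod_eq_smul (FreeAlgebra.ι ℂ) (k := l.support.sort)
    fun β _ => freeDeriv_pow_eq_smul _ (freeEuler_lieToFree (B _ (ofLex β).2).2) (l β)
  have deg_eq : (l.support.sort.map fun β => (l β : ℂ) * ((ofLex β).1 + 2 : ℕ)).sum = l.deg := by
    rw [MultiIndex.deg, Finsupp.sum, Nat.cast_sum, ← Finset.sum_map_toList]
    simp only [Nat.cast_mul]
    exact ((Finset.sort_perm_toList _ _).map _).sum_eq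
  rw [← deg_eq]
  exact euler_prod

theorem freePartial_orderedMonomial (i : Fin n) (l : MultiIndex m) :
    freePartial i (orderedMonomial B l) = 0 := by
  have partial_pow (β : LieIndex m) : freePartial i (basicLie B β ^ l β) =
      (0 : ℂ) • basicLie B β ^ l β := by
    rw [freeDeriv_pow_eq_smul _ ((freePartial_basicLie B i β).trans (zero_smul ℂ _).symm), mul_zero]
  refine (freeDeriv_list_prod_eq_smul _ (k := l.support.sort) fun β _ => partial_pow β).trans ?_
  rw [List.sum_map_zero, zero_smul]

theorem freeEuler_normalOrder_monomial (a : Fin n →₀ ℕ) :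
    freeEuler n (normalOrder n (MvPolynomial.monomial a 1)) =
      (a.degree : ℂ) • normalOrder n (MvPolynomial.monomial a 1) := by
  have euler_pow (j : Fin n) : freeEuler n (FreeAlgebra.ι ℂ j ^ a j) =
      (a j : ℂ) • FreeAlgebra.ι ℂ j ^ a j := by
    simpa using freeDeriv_pow_eq_smul (c := 1) (FreeAlgebra.ι ℂ) (y := FreeAlgebra.ι ℂ j)
      (by rw [freeDeriv_ι, one_smul]) (a j)
  rw [normalOrder_monomial, List.ofFn_eq_map, freeDeriv_list_prod_eq_smul _ fun j _ => euler_pow j,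
    ← List.ofFn_eq_map, List.sum_ofFn, Finsupp.degree_eq_sum, Nat.cast_sum]

theorem freePartial_ι_pow_of_ne {i j : Fin n} (hij : j ≠ i) (r : ℕ) :
    freePartial i (FreeAlgebra.ι ℂ j ^ r) = 0 := by
  rw [freeDeriv_pow_eq_smul (c := 0), mul_zero, zero_smul]
  rw [freeDeriv_ι, Pi.single_eq_of_ne hij, zero_smul]

theorem freePartial_ι_pow_self (i : Fin n) (r : ℕ) :
    freePartial i (FreeAlgebra.ι ℂ i ^ r) = (r : ℂ) • FreeAlgebra.ι ℂ i ^ (r - 1) := by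
  induction r with
  | zero => simp [freeDeriv_one]
  | succ r ih =>
    rw [pow_succ, freeDeriv_mul, ih, freeDeriv_ι, Pi.single_eq_same, mul_one, smul_mul_assoc]
    rcases r with _ | r
    · simp
    · rw [Nat.add_sub_cancel, ← pow_succ, Nat.add_sub_cancel]
      push_cast
      module

theorem freePartial_list_prod_ι_pow_of_notMem (a : Fin n → ℕ) {i : Fin n} {k : List (Fin n)}
    (hi : i ∉ k) : freePartial i (k.map fun j => FreeAlgebra.ι ℂ j ^ a j).prod = 0 := by
  rw [freeDeriv_list_prod_eq_smul (c := 0), List.sum_eq_zero (by simp), zero_smul]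
  intro j hj
  rw [Pi.zero_apply, zero_smul]
  exact freePartial_ι_pow_of_ne (ne_of_mem_of_not_mem hj hi) _

theorem freePartial_normalOrder_monomial (i : Fin n) (a : Fin n →₀ ℕ) :
    freePartial i (normalOrder n (MvPolynomial.monomial a 1)) =
      (a i : ℂ) • normalOrder n (MvPolynomial.monomial (a - Finsupp.single i 1) 1) := by
  obtain ⟨k₁, k₂, split⟩ := List.append_of_mem (List.mem_finRange i)
  have nodup := List.nodup_finRange n
  rw [split, List.nodup_middle, List.nodup_cons, List.mem_append, not_or] at nodup
  obtain ⟨⟨hk₁, hk₂⟩, -⟩ := nodup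
  have map_sub {k : List (Fin n)} (hk : i ∉ k) :
      (k.map fun j => FreeAlgebra.ι ℂ j ^ (a - Finsupp.single i 1 : Fin n →₀ ℕ) j) =
        k.map fun j => FreeAlgebra.ι ℂ j ^ a j :=
    List.map_congr_left fun j hj => by
      rw [Finsupp.tsub_apply, Finsupp.single_eq_of_ne (by rintro rfl; exact hk hj), tsub_zero]
  simp only [normalOrder_monomial, List.ofFn_eq_map, split, List.map_append, List.map_cons,
    List.prod_append, List.prod_cons, freeDeriv_mul, map_sub hk₁, map_sub hk₂]
  rw [freePartial_list_prod_ι_pow_of_notMem _ hk₁, freePartial_list_prod_ι_pow_of_notMem _ hk₂,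
    freePartial_ι_pow_self]
  simp

/-- The partial derivative as an element of the endomorphism algebra. -/
abbrev pderivEnd (i : Fin n) : Module.End ℂ (MvPolynomial (Fin n) ℂ) :=
  ↑(MvPolynomial.pderiv i : Derivation ℂ (MvPolynomial (Fin n) ℂ) (MvPolynomial (Fin n) ℂ))

theorem freePartial_normalOrder (i : Fin n) (f : MvPolynomial (Fin n) ℂ) :
    freePartial i (normalOrder n f) = normalOrder n (MvPolynomial.pderiv i f) := by
  suffices freePartial i ∘ₗ normalOrder n = normalOrder n ∘ₗ pderivEnd i from
    DFunLike.congr_fun this f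
  refine (MvPolynomial.basisMonomials (Fin n) ℂ).ext fun a => ?_
  rw [LinearMap.comp_apply, LinearMap.comp_apply, MvPolynomial.coe_basisMonomials,
    freePartial_normalOrder_monomial, ← map_smul, Derivation.coeFn_coe,
    MvPolynomial.pderiv_monomial, one_mul, MvPolynomial.smul_monomial,
    smul_eq_mul, mul_one]

theorem normalForm_freePartial (i : Fin n) (x : FreeAlgebra ℂ (Fin n)) (l : MultiIndex m) :
    normalForm B (freePartial i x) l = MvPolynomial.pderiv i (normalForm B x l) := by
  induction x using normalForm_induction B with
  | term f k =>
    rw [freeDeriv_mul, freePartial_orderedMonomial, mul_zero, zero_add, freePartial_normalOrder,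
      normalForm_term, normalForm_term, Finsupp.single_apply, Finsupp.single_apply, apply_ite
      (MvPolynomial.pderiv i), map_zero]
  | zero => simp
  | add x y hx hy => simp only [map_add, Finsupp.add_apply, hx, hy]

theorem freeEuler_term (a : Fin n →₀ ℕ) (l : MultiIndex m) :
    freeEuler n (normalOrder n (MvPolynomial.monomial a 1) * orderedMonomial B l) =
      (a.degree + l.deg : ℂ) •
        (normalOrder n (MvPolynomial.monomial a 1) * orderedMonomial B l) := by
  rw [freeDeriv_mul, freeEuler_orderedMonomial, freeEuler_normalOrder_monomial, mul_smul_comm,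
    smul_mul_assoc, ← add_smul, add_comm]

theorem coeff_zero_normalForm_freeEuler (x : FreeAlgebra ℂ (Fin n)) (l : MultiIndex m) :
    (normalForm B (freeEuler n x) l).coeff 0 = l.deg * (normalForm B x l).coeff 0 := by
  rw [coeff_normalForm, coeff_normalForm]
  suffices (pbwBasis B).coord ⟨l, 0⟩ ∘ₗ freeEuler n = (l.deg : ℂ) • (pbwBasis B).coord ⟨l, 0⟩ from
    DFunLike.congr_fun this x
  refine (pbwBasis B).ext fun ⟨k, a⟩ => ?_
  have euler_basis : freeEuler n (pbwBasis B ⟨k, a⟩) =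
      (a.degree + k.deg : ℂ) • pbwBasis B ⟨k, a⟩ := by
    rw [pbwBasis_eq_sortedProd, sortedProd_pbwIndexEquiv, freeEuler_term]
  rw [LinearMap.comp_apply, euler_basis, map_smul, LinearMap.smul_apply, Module.Basis.coord_apply,
    Module.Basis.repr_self, Finsupp.single_apply]
  split_ifs with h
  · cases h
    simp
  · simp

end DerivNormalForm

/-! ## Bidifferential operators -/

section IterDeriv

variable {n : ℕ}

theorem coeff_pderivEnd_pow (i : Fin n) (k : ℕ) (c : Fin n →₀ ℕ) : ∃ r : ℕ, r ≠ 0 ∧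
    ∀ f, ((pderivEnd i ^ k) f).coeff c = r * f.coeff (c + Finsupp.single i k) := by
  induction k generalizing c with
  | zero => exact ⟨1, one_ne_zero, by simp⟩
  | succ k ih =>
    obtain ⟨r, hr, coeff_eq⟩ := ih (c + Finsupp.single i 1)
    refine ⟨r * (c i + 1), by positivity, fun f => ?_⟩
    rw [pow_succ', Module.End.mul_apply, Derivation.coeFn_coe,
      MvPolynomial.coeff_pderiv, coeff_eq, add_assoc, ← Finsupp.single_add, add_comm 1 k]
    push_cast
    ring

theorem coeff_list_prod_pderivEnd_pow (a : Fin n → ℕ) (k : List (Fin n)) (c : Fin n →₀ ℕ) :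
    ∃ r : ℕ, r ≠ 0 ∧ ∀ f, ((k.map fun i => pderivEnd i ^ a i).prod f).coeff c =
      r * f.coeff (c + (k.map fun i => Finsupp.single i (a i)).sum) := by
  induction k generalizing c with
  | nil => exact ⟨1, one_ne_zero, by simp⟩
  | cons i k ih =>
    obtain ⟨r, hr, coeff_pow⟩ := coeff_pderivEnd_pow i (a i) c
    obtain ⟨r', hr', coeff_prod⟩ := ih (c + Finsupp.single i (a i))
    refine ⟨r * r', mul_ne_zero hr hr', fun f => ?_⟩
    rw [List.map_cons, List.prod_cons, Module.End.mul_apply, coeff_pow, coeff_prod, List.map_cons,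
      List.sum_cons, add_assoc, Nat.cast_mul, mul_assoc]

theorem coeff_iterDeriv_pderiv (a c : Fin n →₀ ℕ) : ∃ r : ℕ, r ≠ 0 ∧
    ∀ f, (iterDeriv MvPolynomial.pderiv a f).coeff c = r * f.coeff (c + a) := by
  obtain ⟨r, hr, coeff_eq⟩ := coeff_list_prod_pderivEnd_pow a (List.finRange n) c
  refine ⟨r, hr, fun f => ?_⟩
  rw [← List.ofFn_eq_map, ← List.ofFn_eq_map, List.sum_ofFn, Finsupp.univ_sum_single] at coeff_eq
  exact coeff_eq f

theorem commute_pderivEnd (i j : Fin n) : Commute (pderivEnd i) (pderivEnd j) := by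
  have bracket_eq_zero : ⁅MvPolynomial.pderiv i, MvPolynomial.pderiv j⁆ =
      (0 : Derivation ℂ (MvPolynomial (Fin n) ℂ) (MvPolynomial (Fin n) ℂ)) :=
    MvPolynomial.derivation_ext fun k => by
      rw [Derivation.commutator_apply, MvPolynomial.pderiv_X, MvPolynomial.pderiv_X]
      simp [Pi.single_apply, apply_ite]
  exact LinearMap.ext fun f => sub_eq_zero.1 (DFunLike.congr_fun bracket_eq_zero f)

theorem pderiv_iterDeriv (i : Fin n) (a : Fin n →₀ ℕ) (f : MvPolynomial (Fin n) ℂ) :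
    MvPolynomial.pderiv i (iterDeriv MvPolynomial.pderiv a f) =
      iterDeriv MvPolynomial.pderiv a (MvPolynomial.pderiv i f) := by
  have commute : Commute (pderivEnd i) (iterDeriv MvPolynomial.pderiv a) := by
    refine Commute.list_prod_right _ _ fun x hx => ?_
    obtain ⟨j, rfl⟩ := (List.mem_ofFn' _ _).1 hx
    exact (commute_pderivEnd i j).pow_right _
  exact DFunLike.congr_fun commute f

theorem coeff_zero_iterDeriv_monomial_of_ne {a c : Fin n →₀ ℕ} (h : a ≠ c) :
    (iterDeriv MvPolynomial.pderiv a (MvPolynomial.monomial c (1 : ℂ))).coeff 0 = 0 := by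
  obtain ⟨r, -, coeff_eq⟩ := coeff_iterDeriv_pderiv a 0
  rw [coeff_eq, zero_add, MvPolynomial.coeff_monomial, if_neg h.symm, mul_zero]

theorem iterDeriv_monomial_of_not_le {a c : Fin n →₀ ℕ} (h : ¬ a ≤ c) :
    iterDeriv MvPolynomial.pderiv a (MvPolynomial.monomial c (1 : ℂ)) = 0 := by
  ext b
  obtain ⟨r, -, coeff_eq⟩ := coeff_iterDeriv_pderiv a b
  rw [coeff_eq, MvPolynomial.coeff_monomial, if_neg, mul_zero, MvPolynomial.coeff_zero]
  rintro rfl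
  exact h le_add_self

/-- The nonzero number `∂^a(x^a)`. -/
def derivFactor (a : Fin n →₀ ℕ) : ℂ :=
  (iterDeriv MvPolynomial.pderiv a (MvPolynomial.monomial a (1 : ℂ))).coeff 0

theorem derivFactor_ne_zero (a : Fin n →₀ ℕ) : derivFactor a ≠ 0 := by
  obtain ⟨r, hr, coeff_eq⟩ := coeff_iterDeriv_pderiv a 0
  rw [derivFactor, coeff_eq, zero_add, MvPolynomial.coeff_monomial, if_pos rfl, mul_one]
  exact_mod_cast hr

theorem iterDeriv_monomial_self (a : Fin n →₀ ℕ) :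
    iterDeriv MvPolynomial.pderiv a (MvPolynomial.monomial a (1 : ℂ)) =
      MvPolynomial.C (derivFactor a) := by
  ext b
  rcases eq_or_ne b 0 with rfl | hb
  · simp [derivFactor]
  · obtain ⟨r, -, coeff_eq⟩ := coeff_iterDeriv_pderiv a b
    rw [coeff_eq, MvPolynomial.coeff_monomial, if_neg (by simpa using hb), mul_zero,
      MvPolynomial.coeff_C, if_neg hb.symm]

end IterDeriv

namespace BiDiffOp

variable {n : ℕ} {A : Type*} [CommRing A] [Algebra ℂ A] (e : MvPolynomial (Fin n) ℂ →ₐ[ℂ] A)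
  (D : Fin n → Derivation ℂ A A)

/-- The bilinear map given by a bilinear differential operator. -/
def bilin (C : BiDiffOp n) : A →ₗ[ℂ] A →ₗ[ℂ] A :=
  C.sum fun αβ c => ((LinearMap.mul ℂ A).compl₁₂ (iterDeriv D αβ.1) (iterDeriv D αβ.2)).compr₂
    (LinearMap.mulLeft ℂ (e c))

theorem eval_eq_bilin (C : BiDiffOp n) (f g : A) : C.eval e D f g = C.bilin e D f g := by
  simp [eval, bilin, Finsupp.sum, LinearMap.sum_apply]

theorem eval_sub (C C' : BiDiffOp n) (f g : A) :
    (C - C').eval e D f g = C.eval e D f g - C'.eval e D f g :=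
  Finsupp.sum_sub_index fun _ _ _ => by rw [map_sub, sub_mul]

section Map

variable {A' : Type*} [CommRing A'] [Algebra ℂ A'] {D} {D' : Fin n → Derivation ℂ A' A'}
  {φ : A →ₐ[ℂ] A'} (hD : ∀ i a, φ (D i a) = D' i (φ a))

include hD

theorem map_iterDeriv (α : Fin n →₀ ℕ) (a : A) : φ (iterDeriv D α a) = iterDeriv D' α (φ a) := by
  have map_pow (i : Fin n) (k : ℕ) (a : A) : φ (((D i : A →ₗ[ℂ] A) ^ k) a) =
      ((D' i : A' →ₗ[ℂ] A') ^ k) (φ a) := by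
    rw [Module.End.pow_apply, Module.End.pow_apply]
    exact Function.Semiconj.iterate_right (f := φ) (fun a => hD i a) k a
  rw [iterDeriv, iterDeriv, List.ofFn_eq_map, List.ofFn_eq_map]
  induction List.finRange n generalizing a with
  | nil => simp
  | cons i l ih => rw [List.map_cons, List.map_cons, List.prod_cons, List.prod_cons,
      Module.End.mul_apply, Module.End.mul_apply, map_pow, ih]

variable {e} {e' : MvPolynomial (Fin n) ℂ →ₐ[ℂ] A'}

theorem map_eval (he : ∀ p, φ (e p) = e' p) (C : BiDiffOp n) (f g : A) :
    φ (C.eval e D f g) = C.eval e' D' (φ f) (φ g) := by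
  simp only [eval, Finsupp.sum, map_sum, map_mul, he, map_iterDeriv hD]

end Map

theorem evalPoly_monomial_of_minimal {C : BiDiffOp n} {α β : Fin n →₀ ℕ}
    (hmin : ∀ y ∈ C.support, α.degree + β.degree ≤ y.1.degree + y.2.degree) :
    C.evalPoly (MvPolynomial.monomial α 1) (MvPolynomial.monomial β 1) =
      C (α, β) * (MvPolynomial.C (derivFactor α) * MvPolynomial.C (derivFactor β)) := by
  rw [evalPoly, eval, Finsupp.sum, Finset.sum_eq_single (α, β)]
  · rw [iterDeriv_monomial_self, iterDeriv_monomial_self, AlgHom.id_apply]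
  · rintro ⟨α', β'⟩ hy hne
    by_cases hα : α' ≤ α
    · by_cases hβ : β' ≤ β
      · obtain ⟨u, rfl⟩ := exists_add_of_le hα
        obtain ⟨v, rfl⟩ := exists_add_of_le hβ
        have degree_le := hmin _ hy
        simp only [map_add] at degree_le
        obtain rfl : u = 0 := (Finsupp.degree_eq_zero_iff u).1 (by lia)
        obtain rfl : v = 0 := (Finsupp.degree_eq_zero_iff v).1 (by lia)
        simp at hne
      · rw [iterDeriv_monomial_of_not_le hβ, mul_zero, mul_zero]
    · rw [iterDeriv_monomial_of_not_le hα, zero_mul, mul_zero]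
  · intro h
    rw [Finsupp.notMem_support_iff.1 h, map_zero, zero_mul]

theorem eq_zero_of_evalPoly_eq_zero {C : BiDiffOp n} (h : ∀ f g, C.evalPoly f g = 0) : C = 0 := by
  by_contra hC
  obtain ⟨x, hx, hmin⟩ := Finset.exists_min_image C.support
    (fun x => x.1.degree + x.2.degree) (Finsupp.support_nonempty_iff.2 hC)
  have value := h (MvPolynomial.monomial x.1 1) (MvPolynomial.monomial x.2 1)
  rw [evalPoly_monomial_of_minimal hmin] at value
  simp [derivFactor_ne_zero, Finsupp.mem_support_iff.1 hx] at value

end BiDiffOp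

section TranslationInvariant

variable {n : ℕ}
  {b b' : MvPolynomial (Fin n) ℂ →ₗ[ℂ] MvPolynomial (Fin n) ℂ →ₗ[ℂ] MvPolynomial (Fin n) ℂ}

/-- A bilinear map on polynomials is translation invariant if the partial derivatives satisfy the
Leibniz rule with respect to it. -/
def IsTranslationInvariant
    (b : MvPolynomial (Fin n) ℂ →ₗ[ℂ] MvPolynomial (Fin n) ℂ →ₗ[ℂ] MvPolynomial (Fin n) ℂ) : Prop :=
  ∀ i f g, MvPolynomial.pderiv i (b f g) =
    b (MvPolynomial.pderiv i f) g + b f (MvPolynomial.pderiv i g)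

namespace IsTranslationInvariant

theorem sub (hb : IsTranslationInvariant b) (hb' : IsTranslationInvariant b') :
    IsTranslationInvariant (b - b') := fun i f g => by
  simp only [LinearMap.sub_apply, map_sub, hb i, hb' i]
  abel

theorem coeff_eq_zero (hb : IsTranslationInvariant b)
    (coeff_zero : ∀ f g, (b f g).coeff 0 = 0) (c : Fin n →₀ ℕ) (f g : MvPolynomial (Fin n) ℂ) :
    (b f g).coeff c = 0 := by
  induction hN : c.degree generalizing c f g with
  | zero => rw [(Finsupp.degree_eq_zero_iff c).1 hN, coeff_zero]
  | succ N ih =>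
    obtain ⟨i, hi⟩ : ∃ i, c i ≠ 0 := Finsupp.ne_iff.1 fun hc : c = 0 => by
      simp [hc] at hN
    obtain ⟨c', rfl⟩ : ∃ c', c = c' + Finsupp.single i 1 :=
      ⟨_, (tsub_add_cancel_of_le (Finsupp.single_le_iff.2 (Nat.one_le_iff_ne_zero.2 hi))).symm⟩
    rw [map_add, Finsupp.degree_single, Nat.add_right_cancel_iff] at hN
    have coeff_leibniz := congrArg (MvPolynomial.coeff c') (hb i f g)
    rw [MvPolynomial.coeff_pderiv, MvPolynomial.coeff_add, ih c' _ _ hN, ih c' _ _ hN, add_zero,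
      mul_eq_zero] at coeff_leibniz
    exact coeff_leibniz.resolve_right (by exact_mod_cast (c' i).succ_ne_zero)

theorem ext (hb : IsTranslationInvariant b) (hb' : IsTranslationInvariant b')
    (coeff_zero : ∀ α β, (b (MvPolynomial.monomial α 1) (MvPolynomial.monomial β 1)).coeff 0 =
      (b' (MvPolynomial.monomial α 1) (MvPolynomial.monomial β 1)).coeff 0) : b = b' := by
  have comp_eq_zero : (b - b').compr₂ (MvPolynomial.lcoeff ℂ 0) = 0 :=
    (MvPolynomial.basisMonomials (Fin n) ℂ).ext fun α =>
      (MvPolynomial.basisMonomials (Fin n) ℂ).ext fun β => by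
        simpa [sub_eq_zero] using coeff_zero α β
  refine sub_eq_zero.1 (LinearMap.ext₂ fun f g => MvPolynomial.ext _ _ fun c => ?_)
  exact (hb.sub hb').coeff_eq_zero (LinearMap.congr_fun₂ comp_eq_zero) c f g

end IsTranslationInvariant

variable (b)
  (hfin : {αβ : (Fin n →₀ ℕ) × (Fin n →₀ ℕ) |
    (b (MvPolynomial.monomial αβ.1 1) (MvPolynomial.monomial αβ.2 1)).coeff 0 ≠ 0}.Finite)

/-- The bilinear differential operator with constant coefficients whose values have the same
constant terms as those of a bilinear map `b`. -/
def constCoeffOp : BiDiffOp n :=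
  Finsupp.ofSupportFinite (fun αβ => MvPolynomial.C
    ((b (MvPolynomial.monomial αβ.1 1) (MvPolynomial.monomial αβ.2 1)).coeff 0 /
      (derivFactor αβ.1 * derivFactor αβ.2)))
    (hfin.subset fun αβ hαβ h => hαβ (by simp only [h, zero_div, map_zero]))

theorem constCoeffOp_apply (αβ : (Fin n →₀ ℕ) × (Fin n →₀ ℕ)) :
    constCoeffOp b hfin αβ = MvPolynomial.C
      ((b (MvPolynomial.monomial αβ.1 1) (MvPolynomial.monomial αβ.2 1)).coeff 0 /
        (derivFactor αβ.1 * derivFactor αβ.2)) := rfl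

theorem isTranslationInvariant_bilin_constCoeffOp : IsTranslationInvariant
    ((constCoeffOp b hfin).bilin (AlgHom.id ℂ _) MvPolynomial.pderiv) := fun i f g => by
  simp only [← BiDiffOp.eval_eq_bilin, BiDiffOp.eval, Finsupp.sum, map_sum,
    ← Finset.sum_add_distrib]
  refine Finset.sum_congr rfl fun αβ _ => ?_
  rw [constCoeffOp_apply, AlgHom.id_apply, MvPolynomial.pderiv_C_mul, MvPolynomial.pderiv_mul,
    pderiv_iterDeriv, pderiv_iterDeriv, mul_add]

theorem coeff_zero_evalPoly_constCoeffOp (α β : Fin n →₀ ℕ) :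
    ((constCoeffOp b hfin).evalPoly (MvPolynomial.monomial α 1)
      (MvPolynomial.monomial β 1)).coeff 0 =
        (b (MvPolynomial.monomial α 1) (MvPolynomial.monomial β 1)).coeff 0 := by
  rw [BiDiffOp.evalPoly, BiDiffOp.eval, Finsupp.sum, MvPolynomial.coeff_sum,
    Finset.sum_eq_single (α, β)]
  · rw [iterDeriv_monomial_self, iterDeriv_monomial_self, constCoeffOp_apply, AlgHom.id_apply,
      ← map_mul, ← map_mul, MvPolynomial.coeff_zero_C,
      div_mul_cancel₀ _ (mul_ne_zero (derivFactor_ne_zero α) (derivFactor_ne_zero β))]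
  · rintro ⟨α', β'⟩ _ hne
    rw [constCoeffOp_apply, AlgHom.id_apply, MvPolynomial.coeff_C_mul,
      ← MvPolynomial.constantCoeff_eq, map_mul, MvPolynomial.constantCoeff_eq]
    by_cases hα : α' = α
    · rw [coeff_zero_iterDeriv_monomial_of_ne fun hβ => hne (Prod.ext hα hβ), mul_zero, mul_zero]
    · rw [coeff_zero_iterDeriv_monomial_of_ne hα, zero_mul, mul_zero]
  · intro h
    rw [Finsupp.notMem_support_iff.1 h, map_zero, zero_mul, MvPolynomial.coeff_zero]

theorem evalPoly_constCoeffOp (hb : IsTranslationInvariant b) (f g : MvPolynomial (Fin n) ℂ) :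
    (constCoeffOp b hfin).evalPoly f g = b f g := by
  rw [BiDiffOp.evalPoly, BiDiffOp.eval_eq_bilin]
  refine LinearMap.congr_fun₂
    ((isTranslationInvariant_bilin_constCoeffOp b hfin).ext hb fun α β => ?_) f g
  rw [← BiDiffOp.eval_eq_bilin]
  exact coeff_zero_evalPoly_constCoeffOp b hfin α β

end TranslationInvariant

/-! ## The operators of the normal form -/

section NormalOp

variable {n : ℕ} {m : ℕ → ℕ} (B : ∀ d, Module.Basis (Fin (m d)) ℂ (lieDegree n (d + 2)))
  (l k v : MultiIndex m)

/-- The coefficient of `M_ν` in the normal form of `⟦f⟧ M_λ ⟦g⟧ M_μ`, a bilinear map in `f`, `g`. -/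
def prodForm : MvPolynomial (Fin n) ℂ →ₗ[ℂ] MvPolynomial (Fin n) ℂ →ₗ[ℂ] MvPolynomial (Fin n) ℂ :=
  ((LinearMap.mul ℂ (FreeAlgebra ℂ (Fin n))).compl₁₂
    (LinearMap.mulRight ℂ (orderedMonomial B l) ∘ₗ normalOrder n)
    (LinearMap.mulRight ℂ (orderedMonomial B k) ∘ₗ normalOrder n)).compr₂
      (Finsupp.lapply v ∘ₗ (normalForm B).toLinearMap)

theorem prodForm_apply (f g : MvPolynomial (Fin n) ℂ) :
    prodForm B l k v f g = normalForm B
      (normalOrder n f * orderedMonomial B l * (normalOrder n g * orderedMonomial B k)) v := by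
  simp [prodForm]

theorem isTranslationInvariant_prodForm : IsTranslationInvariant (prodForm B l k v) :=
  fun i f g => by
    have partial_term (f : MvPolynomial (Fin n) ℂ) (l : MultiIndex m) :
        freePartial i (normalOrder n f * orderedMonomial B l) =
          normalOrder n (MvPolynomial.pderiv i f) * orderedMonomial B l := by
      rw [freeDeriv_mul, freePartial_orderedMonomial, mul_zero, zero_add, freePartial_normalOrder]
    rw [prodForm_apply, prodForm_apply, prodForm_apply, ← normalForm_freePartial, freeDeriv_mul,
      partial_term, partial_term, map_add, Finsupp.add_apply, add_comm]

variable {l k v} in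
theorem degree_add_degree_of_coeff_zero_prodForm_ne_zero {α β : Fin n →₀ ℕ}
    (h : (prodForm B l k v (MvPolynomial.monomial α 1) (MvPolynomial.monomial β 1)).coeff 0 ≠ 0) :
    α.degree + β.degree + l.deg + k.deg = v.deg := by
  rw [prodForm_apply] at h
  have euler_coeff := coeff_zero_normalForm_freeEuler B
    (normalOrder n (MvPolynomial.monomial α 1) * orderedMonomial B l *
      (normalOrder n (MvPolynomial.monomial β 1) * orderedMonomial B k)) v
  rw [freeDeriv_mul, freeEuler_term, freeEuler_term, mul_smul_comm, smul_mul_assoc, ← add_smul,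
    map_smul, Finsupp.smul_apply, MvPolynomial.coeff_smul, smul_eq_mul] at euler_coeff
  have degree_eq := mul_right_cancel₀ h euler_coeff
  norm_cast at degree_eq
  lia

/-- The operator `C^ν_{λμ}`. -/
def normalOp : BiDiffOp n :=
  constCoeffOp (prodForm B l k v) <|
    ((Finsupp.finite_of_degree_le v.deg).prod (Finsupp.finite_of_degree_le v.deg)).subset
      fun αβ hαβ => by
        have degree_eq := degree_add_degree_of_coeff_zero_prodForm_ne_zero B hαβ
        exact ⟨show αβ.1.degree ≤ _ by lia, show αβ.2.degree ≤ _ by lia⟩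

theorem evalPoly_normalOp (f g : MvPolynomial (Fin n) ℂ) :
    (normalOp B l k v).evalPoly f g = prodForm B l k v f g :=
  evalPoly_constCoeffOp _ _ (isTranslationInvariant_prodForm B l k v) f g

variable {l k v}

theorem finsum_term_eq (c : MultiIndex m →₀ MvPolynomial (Fin n) ℂ) :
    ∑ᶠ v, normalOrder n (c v) * orderedMonomial B v = (normalForm B).symm c := by
  rw [eq_sum_normalForm B ((normalForm B).symm c), LinearEquiv.apply_symm_apply, Finsupp.sum]
  refine finsum_eq_sum_of_support_subset _ fun v hv => Finsupp.mem_support_iff.2 fun h => hv ?_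
  simp only [h, map_zero, zero_mul]

theorem isNormalFormOperators_iff {C : MultiIndex m → MultiIndex m → MultiIndex m → BiDiffOp n} :
    IsNormalFormOperators B C ↔ ∀ l k v f g, (C l k v).evalPoly f g = prodForm B l k v f g := by
  constructor
  · intro h l k v f g
    obtain ⟨hfin, prod_eq⟩ := h l k f g
    have prod_eq_symm := prod_eq.trans (finsum_term_eq B (Finsupp.ofSupportFinite _ hfin))
    rw [prodForm_apply, prod_eq_symm, LinearEquiv.apply_symm_apply]
    rfl
  · intro h l k f g
    simp only [h, prodForm_apply]
    exact ⟨Finsupp.hasFiniteSupport _, by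
      rw [finsum_term_eq, LinearEquiv.symm_apply_apply]⟩

theorem isNormalFormOperators_normalOp : IsNormalFormOperators B (normalOp B) :=
  (isNormalFormOperators_iff B).2 (evalPoly_normalOp B)

theorem IsNormalFormOperators.unique {C : MultiIndex m → MultiIndex m → MultiIndex m → BiDiffOp n}
    (hC : IsNormalFormOperators B C) : C = normalOp B := by
  funext l k v
  refine sub_eq_zero.1 (BiDiffOp.eq_zero_of_evalPoly_eq_zero fun f g => ?_)
  rw [BiDiffOp.evalPoly, BiDiffOp.eval_sub, ← BiDiffOp.evalPoly, ← BiDiffOp.evalPoly,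
    evalPoly_normalOp, (isNormalFormOperators_iff B).1 hC, sub_self]

theorem term_mem_ncFiltration (f : MvPolynomial (Fin n) ℂ) (l : MultiIndex m) :
    normalOrder n f * orderedMonomial B l ∈ ncFiltration (FreeAlgebra ℂ (Fin n)) l.ord := by
  rw [mem_ncFiltration_iff B]
  intro k hk
  rw [normalForm_term, Finsupp.single_eq_of_ne (ne_of_apply_ne MultiIndex.ord hk.ne)]

theorem ord_add_ord_le_of_normalOp_ne_zero (h : normalOp B l k v ≠ 0) :
    l.ord + k.ord ≤ v.ord := by
  contrapose! h
  ext1 αβ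
  have mem_filtration := mul_mem_ncFiltration
    (term_mem_ncFiltration B (MvPolynomial.monomial αβ.1 1) l)
    (term_mem_ncFiltration B (MvPolynomial.monomial αβ.2 1) k)
  rw [normalOp, constCoeffOp_apply, prodForm_apply,
    (mem_ncFiltration_iff B _ _).1 mem_filtration v h]
  simp

end NormalOp

namespace MultiIndex

variable {m : ℕ → ℕ}

theorem mul_le_ord (l : MultiIndex m) (β : LieIndex m) : l β * ((ofLex β).1 + 1) ≤ l.ord := by
  by_cases hβ : l β = 0
  · simp [hβ]
  · exact Finset.single_le_sum (f := fun β => l β * ((ofLex β).1 + 1)) (fun _ _ => Nat.zero_le _)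
      (Finsupp.mem_support_iff.2 hβ)

theorem ord_zero : (0 : MultiIndex m).ord = 0 :=
  Finsupp.sum_zero_index

theorem eq_zero_of_ord_eq_zero {l : MultiIndex m} (h : l.ord = 0) : l = 0 := by
  ext β
  simpa [h] using mul_le_ord l β

theorem finite_ord_le (d : ℕ) : {l : MultiIndex m | l.ord ≤ d}.Finite := by
  classical
  let lowDegree : Finset (LieIndex m) := ((Finset.range d).sigma fun _ => Finset.univ).image toLex
  refine (Set.finite_Iic (Finsupp.indicator lowDegree fun _ _ => d)).subset fun l hl β => ?_
  have mul_le : l β * ((ofLex β).1 + 1) ≤ d := (mul_le_ord l β).trans hl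
  by_cases hβ : β ∈ lowDegree
  · rw [Finsupp.indicator_of_mem hβ]
    exact (Nat.le_mul_of_pos_right _ (Nat.succ_pos _)).trans mul_le
  · have degree_le : d ≤ (ofLex β).1 := not_lt.1 fun h => hβ <| Finset.mem_image.2
      ⟨ofLex β, Finset.mem_sigma.2 ⟨Finset.mem_range.2 h, Finset.mem_univ _⟩, rfl⟩
    rw [Finsupp.indicator_of_notMem hβ]
    nlinarith

end MultiIndex

/-! ## The filtration of the completed free algebra -/

section Commutators

variable {I A A' : Type*} [Ring A] [Algebra ℂ A] [Ring A'] [Algebra ℂ A']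

/-- The operators `u ↦ [xᵢ, u]` and `u ↦ u [xᵢ, xⱼ]` of a family `x`, which raise the
NC-filtration by one. -/
def commTerm (x : I → A) : I ⊕ I × I → A →ₗ[ℂ] A
  | .inl i => LinearMap.mulLeft ℂ (x i) - LinearMap.mulRight ℂ (x i)
  | .inr (i, j) => LinearMap.mulRight ℂ (x i * x j - x j * x i)

theorem map_commTerm (f : A →ₐ[ℂ] A') (x : I → A) (p : I ⊕ I × I) (u : A) :
    f (commTerm x p u) = commTerm (f ∘ x) p (f u) := by
  rcases p with i | ⟨i, j⟩ <;> simp [commTerm]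

theorem commTerm_mem_ncFiltration (x : I → A) (p : I ⊕ I × I) {e : ℕ} {u : A}
    (hu : u ∈ ncFiltration A e) : commTerm x p u ∈ ncFiltration A (e + 1) := by
  rcases p with i | ⟨i, j⟩
  · exact lie_mem_ncFiltration_succ (x i) hu
  · exact mul_mem_ncFiltration hu (lie_mem_ncFiltration_succ (x i) (mem_ncFiltration_zero (x j)))

variable {n e k : ℕ}

/-- The sums of elements `[xᵢ, u]` and `u [xᵢ, xⱼ]` with `u` in the layer `F^e`. -/
def commSpan (n e : ℕ) : Submodule ℂ (FreeAlgebra ℂ (Fin n)) :=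
  ⨆ p, ((ncFiltration (FreeAlgebra ℂ (Fin n)) e).restrictScalars ℂ).map
    (commTerm (FreeAlgebra.ι ℂ) p)

theorem commSpan_antitone (n : ℕ) : Antitone (commSpan n) := fun _ _ h =>
  iSup_mono fun _ => Submodule.map_mono (ncFiltration_antitone h)

theorem commTerm_mem_commSpan (p : Fin n ⊕ Fin n × Fin n) {u : FreeAlgebra ℂ (Fin n)}
    (hu : u ∈ ncFiltration (FreeAlgebra ℂ (Fin n)) e) :
    commTerm (FreeAlgebra.ι ℂ) p u ∈ commSpan n e :=
  Submodule.mem_iSup_of_mem p (Submodule.mem_map_of_mem hu)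

theorem exists_eq_sum_commTerm {y : FreeAlgebra ℂ (Fin n)} (hy : y ∈ commSpan n e) :
    ∃ u : Fin n ⊕ Fin n × Fin n → FreeAlgebra ℂ (Fin n),
      (∀ p, u p ∈ ncFiltration (FreeAlgebra ℂ (Fin n)) e) ∧
      y = ∑ p, commTerm (FreeAlgebra.ι ℂ) p (u p) := by
  rw [commSpan, ← iSup_univ, ← Finset.coe_univ] at hy
  obtain ⟨c, rfl⟩ := (Submodule.mem_iSup_finset_iff_exists_sum _ _).1 hy
  choose u hu hc using fun p => Submodule.mem_map.1 (c p).2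
  exact ⟨u, hu, Finset.sum_congr rfl fun p _ => (hc p).symm⟩

theorem mul_lieToFree_mem_commSpan {u : FreeLieAlgebra ℂ (Fin n)} (hu : u ∈ lieDegree n (k + 2))
    {g : FreeAlgebra ℂ (Fin n)} (hg : g ∈ ncFiltration (FreeAlgebra ℂ (Fin n)) e) :
    g * lieToFree n u ∈ commSpan n (e + k) := by
  suffices h : lieDegree n (k + 2) ≤
      (commSpan n (e + k)).comap (LinearMap.mulLeft ℂ g ∘ₗ lieToFree n) from h hu
  clear hu u
  induction k generalizing e g with
  | zero =>
    refine (lieDegree_add_two_le_span_lie_of n 0).trans (Submodule.span_le.2 ?_)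
    rintro _ ⟨i, v, hv, rfl⟩
    have le_comap : lieDegree n 1 ≤ (commSpan n e).comap (LinearMap.mulLeft ℂ g ∘ₗ
        (LinearMap.mulLeft ℂ (FreeAlgebra.ι ℂ i) - LinearMap.mulRight ℂ (FreeAlgebra.ι ℂ i)) ∘ₗ
        lieToFree n) := by
      rw [lieDegree_one, Submodule.span_le]
      rintro _ ⟨j, rfl⟩
      simpa [commTerm, lieToFree_of] using commTerm_mem_commSpan (.inr (i, j)) hg
    simpa [lieToFree_lie, lieToFree_of] using le_comap hv
  | succ k ih =>
    refine (lieDegree_add_two_le_span_lie_of n (k + 1)).trans (Submodule.span_le.2 ?_)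
    rintro _ ⟨i, v, hv, rfl⟩
    have lie_mul_mem : FreeAlgebra.ι ℂ i * (g * lieToFree n v) -
        g * lieToFree n v * FreeAlgebra.ι ℂ i ∈ commSpan n (e + (k + 1)) :=
      commTerm_mem_commSpan (.inl i) (mul_mem_ncFiltration hg
        (lieCentral_le_ncFiltration (lieToFree_mem_lieCentral hv)))
    have lie_mul_mem' : (FreeAlgebra.ι ℂ i * g - g * FreeAlgebra.ι ℂ i) * lieToFree n v ∈
        commSpan n (e + 1 + k) := ih (lie_mem_ncFiltration_succ (FreeAlgebra.ι ℂ i) hg) hv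
    rw [add_right_comm, add_assoc] at lie_mul_mem'
    change g * lieToFree n ⁅FreeLieAlgebra.of ℂ i, v⁆ ∈ commSpan n (e + (k + 1))
    rw [lieToFree_lie, lieToFree_of]
    convert sub_mem lie_mul_mem lie_mul_mem' using 1
    noncomm_ring

variable {m : ℕ → ℕ} (B : ∀ d, Module.Basis (Fin (m d)) ℂ (lieDegree n (d + 2)))

/-- In a sorted product of positive weight, the last factor is a basic Lie element. -/
theorem sortedProd_pbwGen_mem_commSpan {s : Multiset (Fin n ⊕ₗ LieIndex m)}
    (hs : e + 1 ≤ (s.map pbwWeight).sum) : sortedProd (pbwGen B) s ∈ commSpan n e := by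
  have sorted := Multiset.pairwise_sort s (· ≤ ·)
  rw [← Multiset.sort_eq s (· ≤ ·), Multiset.map_coe, Multiset.sum_coe] at hs
  rw [sortedProd]
  rcases List.eq_nil_or_concat' s.sort with h | ⟨l, j, h⟩
  · simp [h] at hs
  simp only [h, List.map_append, List.sum_append, List.map_singleton, List.sum_singleton,
    List.prod_append, List.prod_singleton] at hs sorted ⊢
  rcases j with i | β
  · have weight_eq_zero : (l.map pbwWeight).sum = 0 := by
      refine List.sum_eq_zero fun k hk => ?_
      obtain ⟨j, hj, rfl⟩ := List.mem_map.1 hk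
      have j_le := (List.pairwise_append.1 sorted).2.2 j hj _ (List.mem_singleton_self _)
      rcases j with i | β
      · rfl
      · exact absurd j_le Sum.Lex.not_inr_le_inl
    rw [weight_eq_zero] at hs
    exact absurd hs (Nat.not_succ_le_zero e)
  · refine commSpan_antitone n ?_ (mul_lieToFree_mem_commSpan (B (ofLex β).1 (ofLex β).2).2
      (prod_map_pbwGen_mem_ncFiltration B l))
    change e + 1 ≤ _ + ((ofLex β).1 + 1) at hs
    lia

include B in
theorem ncFiltration_succ_le_commSpan :
    (ncFiltration (FreeAlgebra ℂ (Fin n)) (e + 1)).restrictScalars ℂ ≤ commSpan n e := by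
  intro x hx
  rw [Submodule.restrictScalars_mem, mem_ncFiltration_iff_mem_weightSpan B,
    weightSpan_eq_span_sortedProd (pbwGen_lie_mem_span_pbwGen B)] at hx
  refine Submodule.span_le.2 ?_ hx
  rintro _ ⟨s, hs, rfl⟩
  exact sortedProd_pbwGen_mem_commSpan B hs

end Commutators

section Completion

variable {n d e : ℕ}

/-- The projection of the completed free algebra to `ℂ⟨x₁, …, xₙ⟩ / F^d`. -/
def freeNCProj (n d : ℕ) :
    FreeNC n →ₐ[ℂ] FreeAlgebra ℂ (Fin n) ⧸ ncFiltration (FreeAlgebra ℂ (Fin n)) d :=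
  (Pi.evalAlgHom ℂ (fun d : ℕ => FreeAlgebra ℂ (Fin n) ⧸ ncFiltration (FreeAlgebra ℂ (Fin n)) d)
      d).comp (ncCompletion (FreeAlgebra ℂ (Fin n))).val

theorem freeNC_ext {x y : FreeNC n} (h : ∀ d, freeNCProj n d x = freeNCProj n d y) : x = y :=
  Subtype.ext (funext h)

theorem factor_freeNCProj_succ (d : ℕ) (x : FreeNC n) :
    Ideal.Quotient.factor (ncFiltration_succ_le (FreeAlgebra ℂ (Fin n)) d)
      (freeNCProj n (d + 1) x) = freeNCProj n d x :=
  x.2 d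

theorem freeNCProj_eq_zero_of_le {x : FreeNC n} (hde : d ≤ e) (h : freeNCProj n e x = 0) :
    freeNCProj n d x = 0 := by
  induction hde with
  | refl => exact h
  | @step e _ ih => exact ih (by rw [← factor_freeNCProj_succ, h, map_zero])

theorem sub_mem_ncFiltration_of_freeNCProj_eq_mk {x : FreeNC n} {r r' : FreeAlgebra ℂ (Fin n)}
    (hr : freeNCProj n d x = Ideal.Quotient.mk _ r)
    (hr' : freeNCProj n (d + 1) x = Ideal.Quotient.mk _ r') :
    r' - r ∈ ncFiltration (FreeAlgebra ℂ (Fin n)) d := by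
  rw [← Ideal.Quotient.eq, ← hr, ← factor_freeNCProj_succ, hr', Ideal.Quotient.factor_mk]

/-- The sum of a series whose `k`-th term is in `F^k`. -/
def freeNCSeries (t : ℕ → FreeAlgebra ℂ (Fin n))
    (ht : ∀ k, t k ∈ ncFiltration (FreeAlgebra ℂ (Fin n)) k) : FreeNC n :=
  ⟨fun d => Ideal.Quotient.mk _ (∑ k ∈ Finset.range d, t k), fun d => by
    change Ideal.Quotient.mk _ _ = Ideal.Quotient.mk _ _
    rw [Ideal.Quotient.eq, Finset.sum_range_succ, add_sub_cancel_left]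
    exact ht d⟩

theorem freeNCProj_freeNCSeries (t : ℕ → FreeAlgebra ℂ (Fin n))
    (ht : ∀ k, t k ∈ ncFiltration (FreeAlgebra ℂ (Fin n)) k) (d : ℕ) :
    freeNCProj n d (freeNCSeries t ht) = Ideal.Quotient.mk _ (∑ k ∈ Finset.range d, t k) := rfl

theorem freeNCProj_freeNCSeries_eq_zero {t : ℕ → FreeAlgebra ℂ (Fin n)}
    (ht : ∀ k, t k ∈ ncFiltration (FreeAlgebra ℂ (Fin n)) k) (h : ∀ k < d, t k = 0) :
    freeNCProj n d (freeNCSeries t ht) = 0 := by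
  rw [freeNCProj_freeNCSeries, Finset.sum_eq_zero fun k hk => h k (Finset.mem_range.1 hk),
    map_zero]

theorem exists_series_of_freeNCProj_eq_zero {x : FreeNC n} (hx : freeNCProj n (e + 1) x = 0) :
    ∃ y : ℕ → FreeAlgebra ℂ (Fin n),
      (∀ k, y k ∈ ncFiltration (FreeAlgebra ℂ (Fin n)) (k + 1)) ∧ (∀ k < e, y k = 0) ∧
      ∀ d, freeNCProj n d x = Ideal.Quotient.mk _ (∑ k ∈ Finset.range d, y k) := by
  have exists_rep (d : ℕ) : ∃ r, freeNCProj n d x = Ideal.Quotient.mk _ r ∧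
      (d ≤ e + 1 → r = 0) := by
    by_cases hd : d ≤ e + 1
    · exact ⟨0, (freeNCProj_eq_zero_of_le hd hx).trans (map_zero _).symm, fun _ => rfl⟩
    · obtain ⟨r, hr⟩ := Ideal.Quotient.mk_surjective (freeNCProj n d x)
      exact ⟨r, hr.symm, fun h => absurd h hd⟩
  choose r hr r_eq_zero using exists_rep
  refine ⟨fun k => r (k + 2) - r (k + 1), fun k =>
    sub_mem_ncFiltration_of_freeNCProj_eq_mk (hr _) (hr _), fun k (hk : k < e) => ?_, fun d => ?_⟩
  · change r (k + 2) - r (k + 1) = 0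
    rw [r_eq_zero (k + 2) (by lia), r_eq_zero (k + 1) (by lia), sub_zero]
  · rw [Finset.sum_range_sub (fun k => r (k + 1)), r_eq_zero (0 + 1) (by lia), sub_zero,
      hr d, eq_comm, Ideal.Quotient.eq]
    exact sub_mem_ncFiltration_of_freeNCProj_eq_mk (hr _) (hr _)

variable {m : ℕ → ℕ} (B : ∀ d, Module.Basis (Fin (m d)) ℂ (lieDegree n (d + 2)))

include B in
theorem exists_eq_sum_commTerm_of_freeNCProj_eq_zero {x : FreeNC n}
    (hx : freeNCProj n (e + 1) x = 0) :
    ∃ U : Fin n ⊕ Fin n × Fin n → FreeNC n, (∀ p, freeNCProj n e (U p) = 0) ∧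
      x = ∑ p, commTerm (toFreeNC n ∘ FreeAlgebra.ι ℂ) p (U p) := by
  obtain ⟨y, hy, y_eq_zero, hxy⟩ := exists_series_of_freeNCProj_eq_zero hx
  have exists_terms (k : ℕ) : ∃ u : Fin n ⊕ Fin n × Fin n → FreeAlgebra ℂ (Fin n),
      (∀ p, u p ∈ ncFiltration (FreeAlgebra ℂ (Fin n)) k) ∧ (k < e → u = 0) ∧
      y k = ∑ p, commTerm (FreeAlgebra.ι ℂ) p (u p) := by
    by_cases hk : k < e
    · exact ⟨0, fun _ => zero_mem _, fun _ => rfl, by simp [y_eq_zero k hk]⟩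
    · obtain ⟨u, hu, hyu⟩ := exists_eq_sum_commTerm (ncFiltration_succ_le_commSpan B (hy k))
      exact ⟨u, hu, fun h => absurd h hk, hyu⟩
  choose u hu u_eq_zero hyu using exists_terms
  refine ⟨fun p => freeNCSeries (fun k => u k p) fun k => hu k p, fun p =>
    freeNCProj_freeNCSeries_eq_zero _ fun k hk => by rw [u_eq_zero k hk, Pi.zero_apply],
    freeNC_ext fun d => ?_⟩
  calc freeNCProj n d x
      = Ideal.Quotient.mkₐ ℂ _ (∑ p, commTerm (FreeAlgebra.ι ℂ) p
          (∑ k ∈ Finset.range d, u k p)) := by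
        simp only [hxy, hyu, map_sum, Ideal.Quotient.mkₐ_eq_mk]
        exact Finset.sum_comm
    _ = freeNCProj n d (∑ p, commTerm (toFreeNC n ∘ FreeAlgebra.ι ℂ) p
          (freeNCSeries (fun k => u k p) fun k => hu k p)) := by
        rw [map_sum, map_sum]
        simp only [map_commTerm, freeNCProj_freeNCSeries]
        rfl

include B in
theorem mem_ncFiltration_freeNC_of_freeNCProj_eq_zero {x : FreeNC n}
    (hx : freeNCProj n e x = 0) : x ∈ ncFiltration (FreeNC n) e := by
  induction e generalizing x with
  | zero => exact mem_ncFiltration_zero x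
  | succ e ih =>
    obtain ⟨U, hU, rfl⟩ := exists_eq_sum_commTerm_of_freeNCProj_eq_zero B hx
    exact sum_mem fun p _ => commTerm_mem_ncFiltration _ p (ih (hU p))

theorem freeNCProj_eq_zero_of_mem_ncFiltration {x : FreeNC n} (hx : x ∈ ncFiltration (FreeNC n) e) :
    freeNCProj n e x = 0 := by
  obtain ⟨y, hy, h⟩ := exists_mem_ncFiltration_of_surjective
    (Ideal.Quotient.mkₐ_surjective ℂ (ncFiltration (FreeAlgebra ℂ (Fin n)) e))
    (map_mem_ncFiltration (freeNCProj n e) hx)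
  rw [← h]
  exact Ideal.Quotient.eq_zero_iff_mem.2 hy

/-- The homomorphism from the free algebra to the truncations of its completion. -/
def freeToTrunc (n d : ℕ) : FreeAlgebra ℂ (Fin n) →ₐ[ℂ] Trunc (FreeNC n) d :=
  (Trunc.mk (FreeNC n) d).comp (toFreeNC n)

theorem mem_ncFiltration_of_freeToTrunc_eq_zero {r : FreeAlgebra ℂ (Fin n)}
    (h : freeToTrunc n d r = 0) : r ∈ ncFiltration (FreeAlgebra ℂ (Fin n)) (d + 1) :=
  Ideal.Quotient.eq_zero_iff_mem.1
    (freeNCProj_eq_zero_of_mem_ncFiltration (Ideal.Quotient.eq_zero_iff_mem.1 h))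

include B in
theorem freeToTrunc_surjective (d : ℕ) : Function.Surjective (freeToTrunc n d) := by
  intro x
  obtain ⟨x, rfl⟩ := Trunc.mk_surjective _ d x
  obtain ⟨r, hr⟩ := Ideal.Quotient.mk_surjective (freeNCProj n (d + 1) x)
  refine ⟨r, Ideal.Quotient.eq.2 (mem_ncFiltration_freeNC_of_freeNCProj_eq_zero B ?_)⟩
  rw [map_sub, ← hr, sub_eq_zero]
  rfl

/-! ## The abelianization -/

theorem lift_X_normalOrder (f : MvPolynomial (Fin n) ℂ) :
    FreeAlgebra.lift ℂ (MvPolynomial.X : Fin n → MvPolynomial (Fin n) ℂ) (normalOrder n f) = f := by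
  suffices h : (FreeAlgebra.lift ℂ MvPolynomial.X).toLinearMap ∘ₗ normalOrder n = LinearMap.id from
    LinearMap.congr_fun h f
  refine (MvPolynomial.basisMonomials (Fin n) ℂ).ext fun a => ?_
  rw [LinearMap.comp_apply, MvPolynomial.coe_basisMonomials, normalOrder_monomial]
  simp [map_list_prod, List.map_ofFn, List.prod_ofFn, MvPolynomial.monomial_eq,
    Finsupp.prod_fintype]

theorem lift_X_eq_normalForm_zero (r : FreeAlgebra ℂ (Fin n)) :
    FreeAlgebra.lift ℂ (MvPolynomial.X : Fin n → MvPolynomial (Fin n) ℂ) r =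
      normalForm B r 0 := by
  induction r using normalForm_induction B with
  | zero => simp
  | add r s hr hs => simp [hr, hs]
  | term f l =>
    rw [normalForm_term]
    rcases eq_or_ne l 0 with rfl | hl
    · rw [Finsupp.single_eq_same, map_mul, lift_X_normalOrder]
      simp [orderedMonomial]
    · rw [Finsupp.single_eq_of_ne hl.symm]
      refine ncFiltration_succ_map_eq_zero _ 0 _ (ncFiltration_antitone ?_
        (term_mem_ncFiltration B _ l))
      exact Nat.one_le_iff_ne_zero.2 fun h => hl (MultiIndex.eq_zero_of_ord_eq_zero h)

theorem lift_X_surjective (n : ℕ) : Function.Surjective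
    (FreeAlgebra.lift ℂ (MvPolynomial.X : Fin n → MvPolynomial (Fin n) ℂ)) := by
  rw [← AlgHom.range_eq_top, eq_top_iff, ← MvPolynomial.adjoin_range_X, Algebra.adjoin_le_iff]
  rintro _ ⟨i, rfl⟩
  exact ⟨FreeAlgebra.ι ℂ i, FreeAlgebra.lift_ι_apply _ _⟩

theorem abMap_surjective : Function.Surjective (abMap n) := by
  intro f
  obtain ⟨r, rfl⟩ := lift_X_surjective n f
  exact ⟨toFreeNC n r, rfl⟩

include B in
theorem abMap_eq_zero_iff (x : FreeNC n) :
    abMap n x = 0 ↔ x ∈ ncFiltration (FreeNC n) 1 := by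
  refine ⟨fun h => mem_ncFiltration_freeNC_of_freeNCProj_eq_zero B ?_,
    ncFiltration_succ_map_eq_zero (abMap n) 0 x⟩
  obtain ⟨r, hr⟩ := Ideal.Quotient.mk_surjective (freeNCProj n 1 x)
  have lift_eq_zero :
      FreeAlgebra.lift ℂ (MvPolynomial.X : Fin n → MvPolynomial (Fin n) ℂ) r = 0 := by
    rw [← h]
    exact congrArg (Ideal.Quotient.liftₐ (ncFiltration (FreeAlgebra ℂ (Fin n)) 1)
      (FreeAlgebra.lift ℂ (MvPolynomial.X : Fin n → MvPolynomial (Fin n) ℂ))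
      (ncFiltration_succ_map_eq_zero _ 0)) hr
  rw [← hr]
  refine Ideal.Quotient.eq_zero_iff_mem.2 ((mem_ncFiltration_iff B 1 r).2 fun l hl => ?_)
  rw [MultiIndex.eq_zero_of_ord_eq_zero (Nat.lt_one_iff.1 hl), ← lift_X_eq_normalForm_zero,
    lift_eq_zero]

end Completion

/-! ## Differential operators on localizations -/

section DiffOps

variable {k K : Type*} [CommRing k] [CommRing K] [Algebra k K] {P Q : Module.End k K} {r r' : ℕ}

/-- The differential operators of order less than `r` on a commutative algebra, in the sense of
Grothendieck: those with vanishing `r`-fold commutators with multiplication operators. -/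
def IsDiffOpOfOrderLT : ℕ → Module.End k K → Prop
  | 0, P => P = 0
  | r + 1, P => ∀ a : K,
      IsDiffOpOfOrderLT r (P * LinearMap.mulLeft k a - LinearMap.mulLeft k a * P)

namespace IsDiffOpOfOrderLT

theorem zero (r : ℕ) : IsDiffOpOfOrderLT r (0 : Module.End k K) := by
  induction r with
  | zero => rfl
  | succ r ih => intro a; rwa [zero_mul, mul_zero, sub_zero]

theorem succ (hP : IsDiffOpOfOrderLT r P) : IsDiffOpOfOrderLT (r + 1) P := by
  induction r generalizing P with
  | zero => cases hP; exact zero 1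
  | succ r ih => exact fun a => ih (hP a)

theorem mono (hr : r ≤ r') (hP : IsDiffOpOfOrderLT r P) : IsDiffOpOfOrderLT r' P := by
  induction hr with
  | refl => exact hP
  | step _ ih => exact ih.succ

theorem add (hP : IsDiffOpOfOrderLT r P) (hQ : IsDiffOpOfOrderLT r Q) :
    IsDiffOpOfOrderLT r (P + Q) := by
  induction r generalizing P Q with
  | zero => cases hP; cases hQ; exact add_zero _
  | succ r ih =>
    intro a
    convert ih (hP a) (hQ a) using 1
    noncomm_ring

theorem mul (hP : IsDiffOpOfOrderLT r P) (hQ : IsDiffOpOfOrderLT r' Q) :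
    IsDiffOpOfOrderLT (r + r') (P * Q) := by
  induction hs : r + r' generalizing r r' P Q with
  | zero =>
    obtain rfl : r = 0 := by lia
    cases hP
    exact zero_mul _
  | succ s ih =>
    rcases r with _ | r
    · cases hP
      rw [zero_mul]
      exact zero _
    rcases r' with _ | r'
    · cases hQ
      rw [mul_zero]
      exact zero _
    intro a
    -- Leibniz rule for commutators: `[PQ, a] = P[Q, a] + [P, a]Q`.
    convert (ih hP (hQ a) (by lia)).add (ih (hP a) hQ (by lia)) using 1
    rw [mul_sub, sub_mul, mul_assoc, mul_assoc, mul_assoc, sub_add_sub_cancel]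

theorem mulLeft (a : K) : IsDiffOpOfOrderLT 1 (LinearMap.mulLeft k a) := by
  intro b
  refine LinearMap.ext fun x => ?_
  simp [mul_left_comm]

theorem derivation (D : Derivation k K K) :
    IsDiffOpOfOrderLT 2 (D.toLinearMap : Module.End k K) := by
  intro a
  convert mulLeft (D a) using 1
  refine LinearMap.ext fun x => ?_
  simp [mul_comm]

end IsDiffOpOfOrderLT

variable (k K) in
/-- The algebra of differential operators on a commutative algebra. -/
def diffOps : Subalgebra k (Module.End k K) where
  carrier := {P | ∃ r, IsDiffOpOfOrderLT r P}
  mul_mem' := fun ⟨r, hP⟩ ⟨r', hQ⟩ => ⟨r + r', hP.mul hQ⟩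
  add_mem' := fun ⟨r, hP⟩ ⟨r', hQ⟩ =>
    ⟨max r r', (hP.mono (le_max_left _ _)).add (hQ.mono (le_max_right _ _))⟩
  algebraMap_mem' c := ⟨1, by
    convert IsDiffOpOfOrderLT.mulLeft (algebraMap k K c) using 1
    refine LinearMap.ext fun x => ?_
    simp [Algebra.smul_def]⟩

theorem mulLeft_mem_diffOps (a : K) : LinearMap.mulLeft k a ∈ diffOps k K :=
  ⟨1, IsDiffOpOfOrderLT.mulLeft a⟩

variable (k K) in
/-- The bilinear maps that are differential operators in each of the two arguments. -/
def biDiffOps : Submodule k (K →ₗ[k] K →ₗ[k] K) where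
  carrier := {T | (∀ a, T a ∈ diffOps k K) ∧ ∀ b, T.flip b ∈ diffOps k K}
  add_mem' hS hT := ⟨fun a => add_mem (hS.1 a) (hT.1 a), fun b => add_mem (hS.2 b) (hT.2 b)⟩
  zero_mem' := ⟨fun _ => zero_mem _, fun _ => zero_mem _⟩
  smul_mem' c _ hT := ⟨fun a => (diffOps k K).smul_mem (hT.1 a) c,
    fun b => (diffOps k K).smul_mem (hT.2 b) c⟩

variable {T : K →ₗ[k] K →ₗ[k] K}

theorem compr₂_mem_biDiffOps (hT : T ∈ biDiffOps k K) (hP : P ∈ diffOps k K) :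
    T.compr₂ P ∈ biDiffOps k K :=
  ⟨fun a => mul_mem hP (hT.1 a), fun b => mul_mem hP (hT.2 b)⟩

theorem compl₂_mem_biDiffOps (hT : T ∈ biDiffOps k K) (hP : P ∈ diffOps k K) :
    T.compl₂ P ∈ biDiffOps k K :=
  ⟨fun a => mul_mem (hT.1 a) hP, fun b => hT.2 (P b)⟩

theorem comp_mem_biDiffOps (hT : T ∈ biDiffOps k K) (hP : P ∈ diffOps k K) :
    T ∘ₗ P ∈ biDiffOps k K :=
  ⟨fun a => hT.1 (P a), fun b => mul_mem (hT.2 b) hP⟩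

theorem mul_mem_biDiffOps : LinearMap.mul k K ∈ biDiffOps k K :=
  ⟨mulLeft_mem_diffOps, fun b => by
    convert mulLeft_mem_diffOps (k := k) b using 1
    exact LinearMap.ext fun a => mul_comm a b⟩

section Localization

variable {A : Type*} [CommRing A] (M : Submonoid A) [Algebra A K] [IsLocalization M K]

include M

theorem eq_of_mem_diffOps (hP : P ∈ diffOps k K) (hQ : Q ∈ diffOps k K)
    (h : ∀ a : A, P (algebraMap A K a) = Q (algebraMap A K a)) : P = Q := by
  suffices eq_zero : ∀ r, ∀ P : Module.End k K, IsDiffOpOfOrderLT r P →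
      (∀ a : A, P (algebraMap A K a) = 0) → P = 0 by
    obtain ⟨r, hr⟩ := sub_mem hP hQ
    exact sub_eq_zero.1 (eq_zero r _ hr fun a => sub_eq_zero.2 (h a))
  intro r
  induction r with
  | zero => exact fun P hP _ => hP
  | succ r ih =>
    intro P hP h
    refine LinearMap.ext fun x => ?_
    obtain ⟨⟨a, s⟩, hx⟩ := IsLocalization.surj M x
    have commutator_eq_zero := ih _ (hP (algebraMap A K s)) fun b => by
      simp [← map_mul, h]
    have map_mul_eq := LinearMap.congr_fun commutator_eq_zero x
    rw [LinearMap.sub_apply, Module.End.mul_apply, Module.End.mul_apply, LinearMap.mulLeft_apply,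
      LinearMap.mulLeft_apply, mul_comm, hx, h, zero_sub, LinearMap.zero_apply,
      neg_eq_zero] at map_mul_eq
    exact (IsLocalization.map_units K s).mul_right_eq_zero.1 map_mul_eq

theorem eq_of_mem_biDiffOps {S T : K →ₗ[k] K →ₗ[k] K} (hS : S ∈ biDiffOps k K)
    (hT : T ∈ biDiffOps k K) (h : ∀ a b : A, S (algebraMap A K a) (algebraMap A K b) =
      T (algebraMap A K a) (algebraMap A K b)) : S = T :=
  LinearMap.ext fun x => eq_of_mem_diffOps M (hS.1 x) (hT.1 x) fun b =>
    LinearMap.congr_fun (eq_of_mem_diffOps M (hS.2 (algebraMap A K b)) (hT.2 _) fun a => h a b) x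

end Localization

end DiffOps

section IterDeriv

variable {n : ℕ} {K : Type*} [CommRing K] [Algebra ℂ K] (D : Fin n → Derivation ℂ K K)

theorem iterDeriv_mem_diffOps (α : Fin n →₀ ℕ) : iterDeriv D α ∈ diffOps ℂ K := by
  refine Subalgebra.list_prod_mem _ fun P hP => ?_
  obtain ⟨j, rfl⟩ := (List.mem_ofFn' _ _).1 hP
  exact pow_mem (show _ ∈ diffOps ℂ K from ⟨2, .derivation (D j)⟩) _

theorem BiDiffOp.bilin_mem_biDiffOps (e : MvPolynomial (Fin n) ℂ →ₐ[ℂ] K) (C : BiDiffOp n) :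
    C.bilin e D ∈ biDiffOps ℂ K := by
  refine sum_mem fun αβ _ => ?_
  convert compr₂_mem_biDiffOps (comp_mem_biDiffOps (compl₂_mem_biDiffOps mul_mem_biDiffOps
    (iterDeriv_mem_diffOps D αβ.2)) (iterDeriv_mem_diffOps D αβ.1))
    (mulLeft_mem_diffOps (e (C αβ))) using 1
  exact LinearMap.ext₂ fun _ _ => rfl

end IterDeriv

/-! ## The algebra of formal normal series over the rational functions -/

section StructMap

variable {n : ℕ} {m : ℕ → ℕ} (B : ∀ d, Module.Basis (Fin (m d)) ℂ (lieDegree n (d + 2)))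
  {l k v : MultiIndex m}

variable (m) in
/-- The finite set of multi-indices of order at most `d`. -/
def ordLE (d : ℕ) : Finset (MultiIndex m) := (MultiIndex.finite_ord_le d).toFinset

theorem mem_ordLE {d : ℕ} : l ∈ ordLE m d ↔ l.ord ≤ d := by
  simp [ordLE]

theorem zero_mem_ordLE (d : ℕ) : 0 ∈ ordLE m d :=
  mem_ordLE.2 (MultiIndex.ord_zero.trans_le d.zero_le)

theorem normalOp_eq_zero (h : v.ord < l.ord + k.ord) : normalOp B l k v = 0 :=
  of_not_not fun hC => h.not_ge (ord_add_ord_le_of_normalOp_ne_zero B hC)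

theorem prodForm_eq_zero (h : v.ord < l.ord + k.ord) : prodForm B l k v = 0 := by
  refine LinearMap.ext₂ fun f g => ?_
  rw [← evalPoly_normalOp, normalOp_eq_zero B h]
  simp [BiDiffOp.evalPoly, BiDiffOp.eval]

theorem sum_prodForm_single_left (f g : MvPolynomial (Fin n) ℂ) :
    ∑ u ∈ ordLE m v.ord, prodForm B u k v (Finsupp.single l f u) g = prodForm B l k v f g := by
  rw [Finset.sum_eq_single l, Finsupp.single_eq_same]
  · intro u _ hu
    rw [Finsupp.single_eq_of_ne hu, map_zero, LinearMap.zero_apply]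
  · intro hl
    rw [mem_ordLE] at hl
    rw [prodForm_eq_zero B (by lia)]
    rfl

theorem sum_prodForm_single_right (f g : MvPolynomial (Fin n) ℂ) :
    ∑ u ∈ ordLE m v.ord, prodForm B l u v f (Finsupp.single k g u) = prodForm B l k v f g := by
  rw [Finset.sum_eq_single k, Finsupp.single_eq_same]
  · intro u _ hu
    rw [Finsupp.single_eq_of_ne hu, map_zero]
  · intro hk
    rw [mem_ordLE] at hk
    rw [prodForm_eq_zero B (by lia)]
    rfl

theorem normalForm_mul_term (x : FreeAlgebra ℂ (Fin n)) (g : MvPolynomial (Fin n) ℂ)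
    (k v : MultiIndex m) :
    normalForm B (x * (normalOrder n g * orderedMonomial B k)) v =
      ∑ l ∈ ordLE m v.ord, prodForm B l k v (normalForm B x l) g := by
  induction x using normalForm_induction B with
  | zero => simp
  | add x x' hx hx' => simp [add_mul, hx, hx', Finset.sum_add_distrib]
  | term f l => rw [← prodForm_apply, normalForm_term, sum_prodForm_single_left]

theorem normalForm_term_mul (f : MvPolynomial (Fin n) ℂ) (y : FreeAlgebra ℂ (Fin n))
    (l v : MultiIndex m) :
    normalForm B (normalOrder n f * orderedMonomial B l * y) v =
      ∑ k ∈ ordLE m v.ord, prodForm B l k v f (normalForm B y k) := by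
  induction y using normalForm_induction B with
  | zero => simp
  | add y y' hy hy' => simp [mul_add, hy, hy', Finset.sum_add_distrib]
  | term g k => rw [← prodForm_apply, normalForm_term, sum_prodForm_single_right]

theorem normalForm_mul (x y : FreeAlgebra ℂ (Fin n)) (v : MultiIndex m) :
    normalForm B (x * y) v = ∑ l ∈ ordLE m v.ord, ∑ k ∈ ordLE m v.ord,
      prodForm B l k v (normalForm B x l) (normalForm B y k) := by
  induction y using normalForm_induction B with
  | zero => simp
  | add y y' hy hy' => simp [mul_add, hy, hy', Finset.sum_add_distrib]
  | term g k => simp only [normalForm_mul_term, normalForm_term, sum_prodForm_single_right]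

theorem prodForm_assoc (l k r v : MultiIndex m) (f g h : MvPolynomial (Fin n) ℂ) :
    ∑ u ∈ ordLE m v.ord, prodForm B u r v (prodForm B l k u f g) h =
      ∑ u ∈ ordLE m v.ord, prodForm B l u v f (prodForm B k r u g h) := by
  simp only [prodForm_apply B l k, prodForm_apply B k r]
  rw [← normalForm_mul_term, ← normalForm_term_mul, mul_assoc]

variable (l k v) in
/-- The bilinear differential operator `C^ν_{λμ}` on rational functions. -/
def structMap : RatFun n →ₗ[ℂ] RatFun n →ₗ[ℂ] RatFun n :=
  (normalOp B l k v).bilin (IsScalarTower.toAlgHom ℂ (MvPolynomial (Fin n) ℂ) (RatFun n)) ratDeriv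

theorem structMap_mem_biDiffOps : structMap B l k v ∈ biDiffOps ℂ (RatFun n) :=
  BiDiffOp.bilin_mem_biDiffOps _ _ _

theorem structMap_algebraMap (f g : MvPolynomial (Fin n) ℂ) :
    structMap B l k v (algebraMap _ _ f) (algebraMap _ _ g) =
      algebraMap _ _ (prodForm B l k v f g) := by
  rw [structMap, ← BiDiffOp.eval_eq_bilin, ← evalPoly_normalOp]
  exact (BiDiffOp.map_eval (φ := IsScalarTower.toAlgHom ℂ (MvPolynomial (Fin n) ℂ) (RatFun n))
    (fun i a => (ratDerivFun_algebraMap i a).symm) (fun p => rfl) _ f g).symm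

theorem structMap_eq_zero (h : v.ord < l.ord + k.ord) : structMap B l k v = 0 := by
  rw [structMap, normalOp_eq_zero B h]
  exact Finsupp.sum_zero_index

theorem structMap_assoc_algebraMap (l k r v : MultiIndex m) (f g : RatFun n)
    (h : MvPolynomial (Fin n) ℂ) :
    ∑ u ∈ ordLE m v.ord, structMap B u r v (structMap B l k u f g) (algebraMap _ _ h) =
      ∑ u ∈ ordLE m v.ord, structMap B l u v f (structMap B k r u g (algebraMap _ _ h)) := by
  have bilinear_eq := eq_of_mem_biDiffOps (nonZeroDivisors (MvPolynomial (Fin n) ℂ))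
    (S := ∑ u ∈ ordLE m v.ord,
      (structMap B l k u).compr₂ ((structMap B u r v).flip (algebraMap _ _ h)))
    (T := ∑ u ∈ ordLE m v.ord,
      (structMap B l u v).compl₂ ((structMap B k r u).flip (algebraMap _ _ h)))
    (sum_mem fun u _ => compr₂_mem_biDiffOps (structMap_mem_biDiffOps B)
      ((structMap_mem_biDiffOps B).2 _))
    (sum_mem fun u _ => compl₂_mem_biDiffOps (structMap_mem_biDiffOps B)
      ((structMap_mem_biDiffOps B).2 _))
    fun f g => by
      simp [LinearMap.sum_apply, structMap_algebraMap, ← map_sum, prodForm_assoc]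
  simpa [LinearMap.sum_apply] using LinearMap.congr_fun₂ bilinear_eq f g

theorem structMap_assoc (l k r v : MultiIndex m) (f g h : RatFun n) :
    ∑ u ∈ ordLE m v.ord, structMap B u r v (structMap B l k u f g) h =
      ∑ u ∈ ordLE m v.ord, structMap B l u v f (structMap B k r u g h) := by
  have linear_eq := eq_of_mem_diffOps (nonZeroDivisors (MvPolynomial (Fin n) ℂ))
    (P := ∑ u ∈ ordLE m v.ord, structMap B u r v (structMap B l k u f g))
    (Q := ∑ u ∈ ordLE m v.ord, structMap B l u v f * structMap B k r u g)
    (sum_mem fun u _ => (structMap_mem_biDiffOps B).1 _)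
    (sum_mem fun u _ => mul_mem ((structMap_mem_biDiffOps B).1 _)
      ((structMap_mem_biDiffOps B).1 _))
    fun h => by
      simpa [LinearMap.sum_apply] using structMap_assoc_algebraMap B l k r v f g h
  simpa [LinearMap.sum_apply] using LinearMap.congr_fun linear_eq h

theorem normalOrder_one : normalOrder n 1 = 1 := by
  rw [← MvPolynomial.C_1, ← MvPolynomial.monomial_zero', normalOrder_monomial]
  simp [List.ofFn_const]

theorem orderedMonomial_zero : orderedMonomial B 0 = 1 := by
  simp [orderedMonomial]

theorem structMap_zero_left_one (k v : MultiIndex m) (g : RatFun n) [Decidable (v = k)] :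
    structMap B 0 k v 1 g = if v = k then g else 0 := by
  have operator_eq : structMap B 0 k v 1 = if v = k then 1 else 0 := by
    refine eq_of_mem_diffOps (nonZeroDivisors (MvPolynomial (Fin n) ℂ))
      ((structMap_mem_biDiffOps B).1 _) (by split_ifs; exacts [one_mem _, zero_mem _]) fun g => ?_
    rw [← map_one (algebraMap (MvPolynomial (Fin n) ℂ) (RatFun n)), structMap_algebraMap,
      prodForm_apply, normalOrder_one, orderedMonomial_zero, one_mul, one_mul, normalForm_term,
      Finsupp.single_apply]
    split_ifs <;> simp_all
  rw [operator_eq]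
  split_ifs <;> rfl

theorem structMap_zero_right_one (l v : MultiIndex m) (f : RatFun n) [Decidable (v = l)] :
    structMap B l 0 v f 1 = if v = l then f else 0 := by
  have operator_eq : (structMap B l 0 v).flip 1 = if v = l then 1 else 0 := by
    refine eq_of_mem_diffOps (nonZeroDivisors (MvPolynomial (Fin n) ℂ))
      ((structMap_mem_biDiffOps B).2 _) (by split_ifs; exacts [one_mem _, zero_mem _]) fun f => ?_
    rw [LinearMap.flip_apply, ← map_one (algebraMap (MvPolynomial (Fin n) ℂ) (RatFun n)),
      structMap_algebraMap, prodForm_apply, normalOrder_one, orderedMonomial_zero, mul_one,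
      mul_one, normalForm_term, Finsupp.single_apply]
    split_ifs <;> simp_all
  rw [← LinearMap.flip_apply, operator_eq]
  split_ifs <;> rfl

end StructMap

section RatSeries

variable {n : ℕ} {m : ℕ → ℕ}

/-- The space of formal series `∑_λ ⟦f_λ⟧ M_λ` with rational functions `f_λ`, encoded by their
coefficients. The basis is an argument because the product depends on it. -/
def RatSeries (_ : ∀ d, Module.Basis (Fin (m d)) ℂ (lieDegree n (d + 2))) : Type :=
  MultiIndex m → RatFun n

variable (B : ∀ d, Module.Basis (Fin (m d)) ℂ (lieDegree n (d + 2)))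

instance : AddCommGroup (RatSeries B) := inferInstanceAs (AddCommGroup (MultiIndex m → RatFun n))

instance : Module ℂ (RatSeries B) := inferInstanceAs (Module ℂ (MultiIndex m → RatFun n))

variable {B} in
/-- The coefficient of `M_λ` in a formal series. -/
def RatSeries.coeff (l : MultiIndex m) : RatSeries B →ₗ[ℂ] RatFun n :=
  LinearMap.proj (R := ℂ) (φ := fun _ : MultiIndex m => RatFun n) l

/-- The series with the single term `⟦f⟧ M_λ`. -/
def RatSeries.single (l : MultiIndex m) (f : RatFun n) : RatSeries B :=
  open Classical in (Pi.single l f : MultiIndex m → RatFun n)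

namespace RatSeries

variable {B} {l k v : MultiIndex m} {d : ℕ}

@[ext]
theorem ext {s t : RatSeries B} (h : ∀ l, coeff l s = coeff l t) : s = t := funext h

theorem coeff_single_same (l : MultiIndex m) (f : RatFun n) : coeff l (single B l f) = f := by
  classical exact Pi.single_eq_same _ _

theorem coeff_single_of_ne (h : k ≠ l) (f : RatFun n) : coeff k (single B l f) = 0 := by
  classical exact Pi.single_eq_of_ne h _

instance : Mul (RatSeries B) := ⟨fun s t => fun v =>
  ∑ l ∈ ordLE m v.ord, ∑ k ∈ ordLE m v.ord, structMap B l k v (coeff l s) (coeff k t)⟩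

instance : One (RatSeries B) := ⟨single B 0 1⟩

theorem one_def : (1 : RatSeries B) = single B 0 1 := rfl

theorem coeff_mul (s t : RatSeries B) (v : MultiIndex m) : coeff v (s * t) =
    ∑ l ∈ ordLE m v.ord, ∑ k ∈ ordLE m v.ord, structMap B l k v (coeff l s) (coeff k t) := rfl

theorem coeff_mul_of_ord_le (s t : RatSeries B) (hv : v.ord ≤ d) : coeff v (s * t) =
    ∑ l ∈ ordLE m d, ∑ k ∈ ordLE m d, structMap B l k v (coeff l s) (coeff k t) := by
  have ordLE_subset : ordLE m v.ord ⊆ ordLE m d :=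
    fun l hl => mem_ordLE.2 ((mem_ordLE.1 hl).trans hv)
  rw [coeff_mul, ← Finset.sum_product', ← Finset.sum_product']
  refine Finset.sum_subset (Finset.product_subset_product ordLE_subset ordLE_subset)
    fun lk _ h => ?_
  rw [Finset.mem_product, mem_ordLE, mem_ordLE] at h
  rw [structMap_eq_zero B (by lia), LinearMap.zero_apply, LinearMap.zero_apply]

theorem coeff_mul_mul_left (s t u : RatSeries B) (v : MultiIndex m) : coeff v (s * t * u) =
    ∑ l ∈ ordLE m v.ord, ∑ k ∈ ordLE m v.ord, ∑ r ∈ ordLE m v.ord, ∑ j ∈ ordLE m v.ord,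
      structMap B j r v (structMap B l k j (coeff l s) (coeff k t)) (coeff r u) :=
  calc
    _ = ∑ r ∈ ordLE m v.ord, ∑ j ∈ ordLE m v.ord, ∑ l ∈ ordLE m v.ord, ∑ k ∈ ordLE m v.ord,
        structMap B j r v (structMap B l k j (coeff l s) (coeff k t)) (coeff r u) := by
      rw [coeff_mul, Finset.sum_comm]
      refine Finset.sum_congr rfl fun r _ => Finset.sum_congr rfl fun j hj => ?_
      rw [coeff_mul_of_ord_le s t (mem_ordLE.1 hj)]
      simp only [map_sum, LinearMap.sum_apply]
    _ = ∑ r ∈ ordLE m v.ord, ∑ l ∈ ordLE m v.ord, ∑ k ∈ ordLE m v.ord, ∑ j ∈ ordLE m v.ord,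
        structMap B j r v (structMap B l k j (coeff l s) (coeff k t)) (coeff r u) :=
      Finset.sum_congr rfl fun r _ =>
        Finset.sum_comm.trans (Finset.sum_congr rfl fun l _ => Finset.sum_comm)
    _ = _ := Finset.sum_comm.trans (Finset.sum_congr rfl fun l _ => Finset.sum_comm)

theorem coeff_mul_mul_right (s t u : RatSeries B) (v : MultiIndex m) : coeff v (s * (t * u)) =
    ∑ l ∈ ordLE m v.ord, ∑ k ∈ ordLE m v.ord, ∑ r ∈ ordLE m v.ord, ∑ j ∈ ordLE m v.ord,
      structMap B l j v (coeff l s) (structMap B k r j (coeff k t) (coeff r u)) := by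
  rw [coeff_mul]
  refine Finset.sum_congr rfl fun l _ => ?_
  rw [Finset.sum_congr rfl fun j hj => by rw [coeff_mul_of_ord_le t u (mem_ordLE.1 hj)]]
  simp only [map_sum]
  rw [Finset.sum_comm]
  exact Finset.sum_congr rfl fun k _ => Finset.sum_comm

protected theorem one_mul (s : RatSeries B) : 1 * s = s := by
  classical
  ext v
  rw [coeff_mul, Finset.sum_eq_single_of_mem 0 (zero_mem_ordLE _)]
  · simp only [one_def, coeff_single_same, structMap_zero_left_one]
    rw [Finset.sum_ite_eq, if_pos (mem_ordLE.2 le_rfl)]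
  · intro l _ hl
    simp [one_def, coeff_single_of_ne hl]

protected theorem mul_one (s : RatSeries B) : s * 1 = s := by
  classical
  ext v
  rw [coeff_mul, Finset.sum_comm, Finset.sum_eq_single_of_mem 0 (zero_mem_ordLE _)]
  · simp only [one_def, coeff_single_same, structMap_zero_right_one]
    rw [Finset.sum_ite_eq, if_pos (mem_ordLE.2 le_rfl)]
  · intro k _ hk
    simp [one_def, coeff_single_of_ne hk]

instance : Ring (RatSeries B) where
  __ := instAddCommGroupRatSeries B
  left_distrib s t u := by
    ext v
    simp only [map_add, coeff_mul, Finset.sum_add_distrib]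
  right_distrib s t u := by
    ext v
    simp only [map_add, coeff_mul, Finset.sum_add_distrib, LinearMap.add_apply]
  zero_mul s := by
    ext v
    simp [coeff_mul]
  mul_zero s := by
    ext v
    simp [coeff_mul]
  one_mul := RatSeries.one_mul
  mul_one := RatSeries.mul_one
  mul_assoc s t u := by
    ext v
    simp only [coeff_mul_mul_left, coeff_mul_mul_right, structMap_assoc]

end RatSeries

end RatSeries

open TopologicalSpace (Opens)

namespace RatSeries

variable {n : ℕ} {m : ℕ → ℕ} {B : ∀ d, Module.Basis (Fin (m d)) ℂ (lieDegree n (d + 2))}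
  {k l v : MultiIndex m} {d : ℕ}

instance : Algebra ℂ (RatSeries B) := Algebra.ofModule
  (fun c s t => by
    ext v
    simp only [map_smul, coeff_mul, LinearMap.smul_apply, Finset.smul_sum])
  (fun c s t => by
    ext v
    simp only [map_smul, coeff_mul, Finset.smul_sum])

variable (B) in
/-- The homomorphism from the free algebra to formal series given by the normal form. -/
def ofFree : FreeAlgebra ℂ (Fin n) →ₐ[ℂ] RatSeries B :=
  AlgHom.ofLinearMap
    (LinearMap.pi fun l => (Algebra.linearMap (MvPolynomial (Fin n) ℂ) (RatFun n)).restrictScalars ℂ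
      ∘ₗ Finsupp.lapply l ∘ₗ (normalForm B).toLinearMap)
    (by
      have one_eq := normalForm_term B 1 0
      rw [normalOrder_one, orderedMonomial_zero, one_mul] at one_eq
      ext l
      change algebraMap _ _ (normalForm B 1 l) = _
      rw [one_eq, one_def]
      rcases eq_or_ne l 0 with rfl | hl
      · rw [Finsupp.single_eq_same, coeff_single_same, map_one]
      · rw [Finsupp.single_eq_of_ne hl, coeff_single_of_ne hl, map_zero])
    (fun x y => by
      ext v
      change algebraMap _ _ (normalForm B (x * y) v) = _
      rw [normalForm_mul B x y, coeff_mul]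
      simp only [map_sum, ← structMap_algebraMap]
      rfl)

theorem coeff_ofFree (r : FreeAlgebra ℂ (Fin n)) (l : MultiIndex m) :
    coeff l (ofFree B r) = algebraMap _ _ (normalForm B r l) := rfl

theorem ofFree_term (f : MvPolynomial (Fin n) ℂ) (l : MultiIndex m) :
    ofFree B (normalOrder n f * orderedMonomial B l) = single B l (algebraMap _ _ f) := by
  ext k
  rw [coeff_ofFree, normalForm_term]
  rcases eq_or_ne k l with rfl | hk
  · rw [Finsupp.single_eq_same, coeff_single_same]
  · rw [Finsupp.single_eq_of_ne hk, map_zero, coeff_single_of_ne hk]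

variable (B) in
/-- The ideal of formal series all of whose terms have order at least `d`. -/
def filtration (d : ℕ) : Ideal (RatSeries B) where
  carrier := {s | ∀ l : MultiIndex m, l.ord < d → coeff l s = 0}
  add_mem' {s t} hs ht l hl := by rw [map_add, hs l hl, ht l hl, add_zero]
  zero_mem' l _ := map_zero _
  smul_mem' s t ht v hv := by
    rw [smul_eq_mul, coeff_mul]
    refine Finset.sum_eq_zero fun l _ => Finset.sum_eq_zero fun k hk => ?_
    rw [ht k ((mem_ordLE.1 hk).trans_lt hv), map_zero]

theorem mem_filtration {s : RatSeries B} :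
    s ∈ filtration B d ↔ ∀ l : MultiIndex m, l.ord < d → coeff l s = 0 := Iff.rfl

instance (d : ℕ) : (filtration B d).IsTwoSided where
  mul_mem_of_left {s} t hs v hv := by
    rw [coeff_mul]
    refine Finset.sum_eq_zero fun l hl => Finset.sum_eq_zero fun k _ => ?_
    rw [hs l ((mem_ordLE.1 hl).trans_lt hv), map_zero, LinearMap.zero_apply]

theorem ofFree_mem_filtration {r : FreeAlgebra ℂ (Fin n)} :
    ofFree B r ∈ filtration B d ↔ r ∈ ncFiltration (FreeAlgebra ℂ (Fin n)) d := by
  rw [mem_filtration, mem_ncFiltration_iff B]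
  simp only [coeff_ofFree, map_eq_zero_iff _
    (IsFractionRing.injective (MvPolynomial (Fin n) ℂ) (RatFun n))]

variable (B) in
include B in
theorem normalOrder_mul_sub_mem_ncFiltration_one (f g : MvPolynomial (Fin n) ℂ) :
    normalOrder n f * normalOrder n g - normalOrder n (f * g) ∈
      ncFiltration (FreeAlgebra ℂ (Fin n)) 1 := by
  rw [mem_ncFiltration_iff B]
  intro l hl
  rw [MultiIndex.eq_zero_of_ord_eq_zero (Nat.lt_one_iff.1 hl), ← lift_X_eq_normalForm_zero B,
    map_sub, map_mul, lift_X_normalOrder, lift_X_normalOrder, lift_X_normalOrder, sub_self]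

theorem prodForm_zero_left (h : v.ord ≤ k.ord) (f g : MvPolynomial (Fin n) ℂ)
    [Decidable (v = k)] : prodForm B 0 k v f g = if v = k then f * g else 0 := by
  have mem_filtration_succ := mul_mem_ncFiltration
    (normalOrder_mul_sub_mem_ncFiltration_one B f g) (term_mem_ncFiltration B 1 k)
  have coeff_eq_zero := (mem_ncFiltration_iff B _ _).1 mem_filtration_succ v (by lia)
  rw [normalOrder_one, one_mul, sub_mul, map_sub, Finsupp.sub_apply, sub_eq_zero, normalForm_term]
    at coeff_eq_zero
  rw [prodForm_apply, orderedMonomial_zero, mul_one, ← mul_assoc, coeff_eq_zero,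
    Finsupp.single_apply]
  simp only [eq_comm]

theorem structMap_zero_left (h : v.ord ≤ k.ord) (f g : RatFun n) [Decidable (v = k)] :
    structMap B 0 k v f g = if v = k then f * g else 0 := by
  have operator_eq : structMap B 0 k v = if v = k then LinearMap.mul ℂ (RatFun n) else 0 := by
    refine eq_of_mem_biDiffOps (nonZeroDivisors (MvPolynomial (Fin n) ℂ))
      (structMap_mem_biDiffOps B) ?_ fun f g => ?_
    · split_ifs
      exacts [mul_mem_biDiffOps, zero_mem _]
    · rw [structMap_algebraMap, prodForm_zero_left h]
      split_ifs <;> simp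
  rw [operator_eq]
  split_ifs <;> rfl

theorem coeff_mul_of_mem_filtration (s : RatSeries B) {t : RatSeries B} (ht : t ∈ filtration B d)
    (hv : v.ord ≤ d) : coeff v (s * t) = coeff 0 s * coeff v t := by
  classical
  rw [coeff_mul, Finset.sum_eq_single_of_mem 0 (zero_mem_ordLE _),
    Finset.sum_eq_single_of_mem v (mem_ordLE.2 le_rfl), structMap_zero_left le_rfl, if_pos rfl]
  · intro k _ hkv
    rcases lt_or_ge k.ord d with hk | hk
    · rw [ht k hk, map_zero]
    · rw [structMap_zero_left (hv.trans hk), if_neg hkv.symm]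
  · intro l _ hl
    have ord_ne_zero : l.ord ≠ 0 := fun h => hl (MultiIndex.eq_zero_of_ord_eq_zero h)
    refine Finset.sum_eq_zero fun k _ => ?_
    rcases lt_or_ge k.ord d with hk | hk
    · rw [ht k hk, map_zero]
    · rw [structMap_eq_zero B (by lia)]
      rfl

theorem coeff_zero_mul (s t : RatSeries B) : coeff 0 (s * t) = coeff 0 s * coeff 0 t :=
  coeff_mul_of_mem_filtration (d := 0) s (fun _ hl => absurd hl (Nat.not_lt_zero _))
    MultiIndex.ord_zero.le

/-! ## Series with regular coefficients -/

theorem coe_evalRegular (U : Opens (AffSpace n)) (l k v : MultiIndex m)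
    (f g : regularFunctions U) :
    ((normalOp B l k v).evalRegular U f g : RatFun n) = structMap B l k v f g := by
  rw [structMap, ← BiDiffOp.eval_eq_bilin]
  exact BiDiffOp.map_eval (φ := (regularFunctions U).val) (fun _ _ => rfl) (fun _ => rfl) _ f g

variable (B) in
/-- The algebra of formal series with coefficients regular in `U`. -/
def regularSeries (U : Opens (AffSpace n)) : Subalgebra ℂ (RatSeries B) where
  carrier := {s | ∀ l, coeff l s ∈ regularFunctions U}
  add_mem' {s t} hs ht l := by
    rw [map_add]
    exact add_mem (hs l) (ht l)
  mul_mem' {s t} hs ht v := by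
    rw [coeff_mul]
    refine sum_mem fun l _ => sum_mem fun k _ => ?_
    rw [← coe_evalRegular U l k v ⟨_, hs l⟩ ⟨_, ht k⟩]
    exact Subtype.coe_prop _
  algebraMap_mem' c l := by
    rw [← (ofFree B).commutes, coeff_ofFree]
    exact (polyToRegular U _).2

theorem ofFree_mem_regularSeries (U : Opens (AffSpace n)) (r : FreeAlgebra ℂ (Fin n)) :
    ofFree B r ∈ regularSeries B U := fun _ => (polyToRegular U _).2

variable (B) in
/-- A formal sum with regular coefficients, as a formal series with rational coefficients. -/
def ofNormalSeries (U : Opens (AffSpace n)) : NormalSeries m U →ₗ[ℂ] RatSeries B where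
  toFun s := (fun l => (s l : RatFun n) : MultiIndex m → RatFun n)
  map_add' _ _ := rfl
  map_smul' _ _ := rfl

variable {U : Opens (AffSpace n)}

theorem coeff_ofNormalSeries (s : NormalSeries m U) (l : MultiIndex m) :
    coeff l (ofNormalSeries B U s) = s l := rfl

theorem ofNormalSeries_mem (s : NormalSeries m U) :
    ofNormalSeries B U s ∈ regularSeries B U := fun l => (s l).2

theorem ofNormalSeries_term (f : regularFunctions U) (l : MultiIndex m) :
    ofNormalSeries B U (NormalSeries.term f l) = single B l f := by
  ext k
  rw [coeff_ofNormalSeries, NormalSeries.term]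
  rcases eq_or_ne k l with rfl | hk
  · rw [Pi.single_eq_same, coeff_single_same]
  · rw [Pi.single_eq_of_ne hk, coeff_single_of_ne hk]
    rfl

variable (B) in
theorem mem_ordLE_product_of_normalOp_ne_zero {lk : MultiIndex m × MultiIndex m}
    (h : normalOp B lk.1 lk.2 v ≠ 0) : lk ∈ ordLE m v.ord ×ˢ ordLE m v.ord := by
  have ord_le := ord_add_ord_le_of_normalOp_ne_zero B h
  rw [Finset.mem_product, mem_ordLE, mem_ordLE]
  lia

variable (B) in
theorem finite_normalOp_ne_zero (v : MultiIndex m) :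
    {lk : MultiIndex m × MultiIndex m | normalOp B lk.1 lk.2 v ≠ 0}.Finite :=
  (ordLE m v.ord ×ˢ ordLE m v.ord).finite_toSet.subset
    fun _ h => mem_ordLE_product_of_normalOp_ne_zero B h

theorem ofNormalSeries_mul (s t : NormalSeries m U) :
    ofNormalSeries B U (NormalSeries.mul (normalOp B) s t) =
      ofNormalSeries B U s * ofNormalSeries B U t := by
  ext v
  rw [coeff_ofNormalSeries, NormalSeries.mul, coeff_mul, ← Finset.sum_product',
    finsum_eq_sum_of_support_subset (s := ordLE m v.ord ×ˢ ordLE m v.ord)]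
  · rw [AddSubmonoidClass.coe_finsetSum]
    exact Finset.sum_congr rfl fun lk _ => coe_evalRegular U _ _ _ _ _
  · intro lk eval_ne_zero
    refine mem_ordLE_product_of_normalOp_ne_zero B fun op_eq_zero => eval_ne_zero ?_
    simp [op_eq_zero, BiDiffOp.evalRegular, BiDiffOp.eval]

/-! ## Invertible series -/

variable {s : RatSeries B}

theorem exists_add_mul_mem_filtration_succ (coeff_ne : coeff 0 s ≠ 0)
    (hU : (coeff 0 s)⁻¹ ∈ regularFunctions U) {e : RatSeries B} (he : e ∈ filtration B d)
    (heU : e ∈ regularSeries B U) :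
    ∃ t ∈ regularSeries B U, e + s * t ∈ filtration B (d + 1) := by
  classical
  let t : RatSeries B := fun l => if l.ord = d then -((coeff 0 s)⁻¹ * coeff l e) else 0
  have coeff_t (l : MultiIndex m) :
      coeff l t = if l.ord = d then -((coeff 0 s)⁻¹ * coeff l e) else 0 := rfl
  have ht : t ∈ filtration B d := fun l hl => by rw [coeff_t, if_neg hl.ne]
  refine ⟨t, fun l => ?_, fun l hl => ?_⟩
  · rw [coeff_t]
    split_ifs
    exacts [neg_mem (mul_mem hU (heU l)), zero_mem _]
  · rw [map_add, coeff_mul_of_mem_filtration s ht (Nat.lt_succ_iff.1 hl), coeff_t]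
    split_ifs with hld
    · rw [mul_neg, mul_inv_cancel_left₀ coeff_ne, add_neg_cancel]
    · rw [mul_zero, add_zero, he l (by lia)]

theorem exists_mul_sub_one_mem_filtration (hs : s ∈ regularSeries B U) (coeff_ne : coeff 0 s ≠ 0)
    (hU : (coeff 0 s)⁻¹ ∈ regularFunctions U) (d : ℕ) :
    ∃ t ∈ regularSeries B U, s * t - 1 ∈ filtration B d := by
  induction d with
  | zero => exact ⟨0, zero_mem _, fun l hl => absurd hl (Nat.not_lt_zero _)⟩
  | succ d ih =>
    obtain ⟨t, ht, remainder_mem⟩ := ih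
    obtain ⟨t', ht', add_mem_succ⟩ := exists_add_mul_mem_filtration_succ coeff_ne hU
      remainder_mem (sub_mem (mul_mem hs ht) (one_mem _))
    exact ⟨t + t', add_mem ht ht', by rwa [mul_add, add_sub_right_comm]⟩

theorem exists_mk_mul_mk_eq_one (coeff_ne : coeff 0 s ≠ 0) (d : ℕ) :
    ∃ t : RatSeries B, coeff 0 t ≠ 0 ∧
      Ideal.Quotient.mk (filtration B (d + 1)) s * Ideal.Quotient.mk _ t = 1 := by
  -- Over the empty open set every rational function is regular.
  obtain ⟨t, -, ht⟩ := exists_mul_sub_one_mem_filtration (U := ⊥) (fun l p hp => hp.elim)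
    coeff_ne (fun p hp => hp.elim) (d + 1)
  refine ⟨t, fun coeff_eq_zero => ?_, ?_⟩
  · have coeff_sub := ht 0 (by rw [MultiIndex.ord_zero]; lia)
    rw [map_sub, coeff_zero_mul, coeff_eq_zero, mul_zero, zero_sub, one_def, coeff_single_same,
      neg_eq_zero] at coeff_sub
    exact one_ne_zero coeff_sub
  · rw [← map_mul, ← map_one (Ideal.Quotient.mk _), Ideal.Quotient.eq]
    exact ht

theorem isUnit_mk (coeff_ne : coeff 0 s ≠ 0) (d : ℕ) :
    IsUnit (Ideal.Quotient.mk (filtration B (d + 1)) s) := by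
  obtain ⟨t, t_coeff_ne, s_mul_t⟩ := exists_mk_mul_mk_eq_one coeff_ne d
  obtain ⟨u, -, t_mul_u⟩ := exists_mk_mul_mk_eq_one t_coeff_ne d
  refine ⟨⟨_, _, s_mul_t, ?_⟩, rfl⟩
  rw [left_inv_eq_right_inv s_mul_t t_mul_u, t_mul_u]

end RatSeries

/-! ## The stalks in terms of formal series -/

theorem FracRing.of_mul_frac {R : Type*} [Ring R] (S : Submonoid R) [OreLocalization.OreSet S]
    (a : R) (t : S) : FracRing.of S t * FracRing.frac a t = FracRing.of S a := by
  rw [FracRing.of_apply, FracRing.of_apply,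
    FracRing.frac_mul_frac (t : R) a 1 t 1 1 (by simp)]
  simp

theorem FracRing.exists_frac {R : Type*} [Ring R] (S : Submonoid R) [OreLocalization.OreSet S]
    (x : FracRing S) : ∃ a t, x = FracRing.frac a t := by
  induction x using OreLocalization.ind with | _ a t
  exact ⟨a, t, rfl⟩

namespace RatSeries

variable {n : ℕ} {m : ℕ → ℕ} (B : ∀ d, Module.Basis (Fin (m d)) ℂ (lieDegree n (d + 2))) {d : ℕ}

/-- The ring of formal series modulo terms of order greater than `d`. -/
abbrev Truncated (d : ℕ) : Type := RatSeries B ⧸ filtration B (d + 1)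

/-- The homomorphism from the truncated free algebra to truncated formal series. -/
def ofTrunc (d : ℕ) : Trunc (FreeNC n) d →+* Truncated B d :=
  (freeToTrunc n d).toRingHom.liftOfSurjective (freeToTrunc_surjective B d)
    ⟨(Ideal.Quotient.mk _).comp (ofFree B).toRingHom, fun _ hr =>
      Ideal.Quotient.eq_zero_iff_mem.2
        (ofFree_mem_filtration.2 (mem_ncFiltration_of_freeToTrunc_eq_zero hr))⟩

theorem ofTrunc_freeToTrunc (d : ℕ) (r : FreeAlgebra ℂ (Fin n)) :
    ofTrunc B d (freeToTrunc n d r) = Ideal.Quotient.mk _ (ofFree B r) :=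
  RingHom.liftOfSurjective_comp_apply _ (freeToTrunc_surjective B d) _ r

theorem ofTrunc_injective (d : ℕ) : Function.Injective (ofTrunc B d) := by
  rw [injective_iff_map_eq_zero]
  intro x hx
  obtain ⟨r, rfl⟩ := freeToTrunc_surjective B d x
  rw [ofTrunc_freeToTrunc, Ideal.Quotient.eq_zero_iff_mem, ofFree_mem_filtration] at hx
  exact Ideal.Quotient.eq_zero_iff_mem.2 (map_mem_ncFiltration (toFreeNC n) hx)

theorem freeToTrunc_mem_denoms {p : AffSpace n} {r : FreeAlgebra ℂ (Fin n)} :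
    freeToTrunc n d r ∈ denoms (abMap n) d p ↔ normalForm B r 0 ∉ p.asIdeal := by
  rw [mem_denoms_iff, ← lift_X_eq_normalForm_zero B]
  rfl

variable {B} in
theorem coeff_zero_ofFree_ne_zero {p : AffSpace n} {r : FreeAlgebra ℂ (Fin n)}
    (hr : normalForm B r 0 ∉ p.asIdeal) : coeff 0 (ofFree B r) ≠ 0 := by
  rw [coeff_ofFree, map_ne_zero_iff _
    (IsFractionRing.injective (MvPolynomial (Fin n) ℂ) (RatFun n))]
  exact ne_of_mem_of_not_mem p.asIdeal.zero_mem hr |>.symm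

theorem isUnit_ofTrunc {p : AffSpace n} (t : denoms (abMap n) d p) : IsUnit (ofTrunc B d t) := by
  obtain ⟨t, ht⟩ := t
  obtain ⟨r, rfl⟩ := freeToTrunc_surjective B d t
  rw [ofTrunc_freeToTrunc]
  exact isUnit_mk (coeff_zero_ofFree_ne_zero ((freeToTrunc_mem_denoms B).1 ht)) d

/-- The homomorphism from the stalks of the truncated structure sheaf to truncated formal series. -/
def ofStalk (d : ℕ) (p : AffSpace n) : Stalk (abMap n) d p →+* Truncated B d :=
  OreLocalization.universalHom (ofTrunc B d)
    (IsUnit.liftRight ((ofTrunc B d).toMonoidHom.comp (denoms (abMap n) d p).subtype)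
      (isUnit_ofTrunc B)) fun _ => rfl

theorem ofStalk_of (d : ℕ) (p : AffSpace n) (x : Trunc (FreeNC n) d) :
    ofStalk B d p (FracRing.of _ x) = ofTrunc B d x :=
  OreLocalization.universalHom_commutes _ _ _

theorem ofStalk_algebraMap (d : ℕ) (p : AffSpace n) (c : ℂ) :
    ofStalk B d p (algebraMap ℂ _ c) = Ideal.Quotient.mk _ (algebraMap ℂ _ c) := by
  have ofTrunc_eq := ofTrunc_freeToTrunc B d (algebraMap ℂ _ c)
  rw [AlgHom.commutes, AlgHom.commutes] at ofTrunc_eq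
  rw [← ofTrunc_eq]
  exact ofStalk_of B d p _

theorem ofTrunc_mul_ofStalk_frac (d : ℕ) (p : AffSpace n) (a : Trunc (FreeNC n) d)
    (t : denoms (abMap n) d p) :
    ofTrunc B d t * ofStalk B d p (FracRing.frac a t) = ofTrunc B d a := by
  rw [← ofStalk_of B d p, ← ofStalk_of B d p a, ← map_mul, FracRing.of_mul_frac]

theorem ofStalk_frac_eq_iff {p : AffSpace n} {a : Trunc (FreeNC n) d}
    {t : denoms (abMap n) d p} {q : Truncated B d} :
    ofStalk B d p (FracRing.frac a t) = q ↔ ofTrunc B d t * q = ofTrunc B d a := by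
  rw [← ofTrunc_mul_ofStalk_frac B d p a t, (isUnit_ofTrunc B t).mul_right_inj, eq_comm]

theorem ofStalk_injective (d : ℕ) (p : AffSpace n) : Function.Injective (ofStalk B d p) := by
  rw [injective_iff_map_eq_zero]
  intro x hx
  obtain ⟨a, t, rfl⟩ := FracRing.exists_frac _ x
  rw [ofStalk_frac_eq_iff, mul_zero, eq_comm, map_eq_zero_iff _ (ofTrunc_injective B d)] at hx
  rw [hx]
  exact OreLocalization.zero_oreDiv t

variable {B}

theorem mk_eq_mk_iff {s t : RatSeries B} :
    (Ideal.Quotient.mk _ s : Truncated B d) = Ideal.Quotient.mk _ t ↔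
      ∀ l : MultiIndex m, l.ord ≤ d → coeff l s = coeff l t := by
  rw [Ideal.Quotient.eq, mem_filtration]
  simp only [map_sub, sub_eq_zero, Nat.lt_succ_iff]

theorem filtration_succ_le (d : ℕ) : filtration B (d + 1) ≤ filtration B d :=
  fun _ hs l hl => hs l (hl.trans (Nat.lt_succ_self d))

/-- The transition homomorphism between rings of truncated formal series. -/
def truncatedProj (d : ℕ) : Truncated B (d + 1) →+* Truncated B d :=
  Ideal.Quotient.factor (filtration_succ_le (d + 1))

theorem truncatedProj_mk (d : ℕ) (s : RatSeries B) :
    truncatedProj d (Ideal.Quotient.mk _ s) = Ideal.Quotient.mk _ s := rfl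

variable (B)

theorem truncatedProj_ofTrunc (d : ℕ) (x : Trunc (FreeNC n) (d + 1)) :
    truncatedProj d (ofTrunc B (d + 1) x) = ofTrunc B d (Trunc.proj _ d x) := by
  obtain ⟨r, rfl⟩ := freeToTrunc_surjective B (d + 1) x
  rw [ofTrunc_freeToTrunc, truncatedProj_mk, ← ofTrunc_freeToTrunc]
  rfl

theorem truncatedProj_ofStalk (d : ℕ) (p : AffSpace n) (x : Stalk (abMap n) (d + 1) p) :
    truncatedProj d (ofStalk B (d + 1) p x) = ofStalk B d p (stalkProj (abMap n) d p x) := by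
  obtain ⟨a, t, rfl⟩ := FracRing.exists_frac _ x
  have stalkProj_of (y) : stalkProj (abMap n) d p (FracRing.of _ y) =
      FracRing.of _ (Trunc.proj _ d y) := FracRing.map_of _ _ _ _ _
  refine (isUnit_ofTrunc B ⟨_, proj_mem_denoms _ d p t t.2⟩).mul_left_cancel ?_
  calc ofTrunc B d (Trunc.proj _ d t) * truncatedProj d (ofStalk B (d + 1) p (FracRing.frac a t))
    _ = ofTrunc B d (Trunc.proj _ d a) := by
      rw [← truncatedProj_ofTrunc, ← map_mul, ofTrunc_mul_ofStalk_frac, truncatedProj_ofTrunc]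
    _ = _ := by
      rw [← ofStalk_of B d p, ← ofStalk_of B d p, ← stalkProj_of, ← stalkProj_of, ← map_mul,
        ← map_mul, FracRing.of_mul_frac]

/-! ## Fractions representing regular series -/

variable {B} {U : Opens (AffSpace n)} {p : AffSpace n} {s : RatSeries B}

theorem exists_common_denominator (hp : p ∈ U) (hs : s ∈ regularSeries B U)
    (T : Finset (MultiIndex m)) :
    ∃ q : MvPolynomial (Fin n) ℂ, q ∉ p.asIdeal ∧ ∃ a : MultiIndex m → MvPolynomial (Fin n) ℂ,
      ∀ l ∈ T, algebraMap _ _ q * coeff l s = algebraMap _ _ (a l) := by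
  classical
  choose a t ht coeff_eq using fun l => hs l p hp
  refine ⟨∏ l ∈ T, t l, fun hq => ?_, fun l => (∏ j ∈ T.erase l, t j) * a l, fun l hl => ?_⟩
  · obtain ⟨l, -, hl⟩ := p.isPrime.prod_mem_iff.1 hq
    exact ht l hl
  · rw [← Finset.prod_erase_mul _ _ hl, map_mul, map_mul, ← coeff_eq]
    ring

theorem exists_ofFree_normalOrder_mul_sub_mem_filtration_succ (hp : p ∈ U)
    (hs : s ∈ regularSeries B U) (hsd : s ∈ filtration B d) :
    ∃ q : MvPolynomial (Fin n) ℂ, q ∉ p.asIdeal ∧ ∃ r : FreeAlgebra ℂ (Fin n),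
      ofFree B (normalOrder n q) * s - ofFree B r ∈ filtration B (d + 1) := by
  obtain ⟨q, hq, a, ha⟩ := exists_common_denominator hp hs (ordLE m d)
  refine ⟨q, hq, ∑ l ∈ ordLE m d, normalOrder n (a l) * orderedMonomial B l, fun v hv => ?_⟩
  have hvd : v.ord ≤ d := Nat.lt_succ_iff.1 hv
  have hv_mem : v ∈ ordLE m d := mem_ordLE.2 hvd
  simp only [map_sub, map_sum, ofFree_term]
  rw [coeff_mul_of_mem_filtration _ hsd hvd,
    Finset.sum_eq_single_of_mem v hv_mem fun l _ hl => coeff_single_of_ne hl.symm _,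
    coeff_single_same, coeff_ofFree, ← lift_X_eq_normalForm_zero B, lift_X_normalOrder, ha v hv_mem,
    sub_self]

/-- An equality `t s = r` modulo terms of order at least `d`, with `t` invertible at `p`, presents
`s` as the fraction `t⁻¹ r` near `p`. -/
theorem exists_ofFree_mul_sub_mem_filtration (hp : p ∈ U) (hs : s ∈ regularSeries B U) (d : ℕ) :
    ∃ r t : FreeAlgebra ℂ (Fin n), normalForm B t 0 ∉ p.asIdeal ∧
      ofFree B t * s - ofFree B r ∈ filtration B d := by
  simp only [← lift_X_eq_normalForm_zero B]
  induction d with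
  | zero =>
    refine ⟨0, 1, ?_, fun l hl => absurd hl (Nat.not_lt_zero _)⟩
    rw [map_one]
    exact p.isPrime.one_notMem
  | succ d ih =>
    obtain ⟨r, t, ht, remainder_mem⟩ := ih
    have remainder_regular : ofFree B t * s - ofFree B r ∈ regularSeries B U :=
      sub_mem (mul_mem (ofFree_mem_regularSeries U t) hs) (ofFree_mem_regularSeries U r)
    obtain ⟨q, hq, r', hr'⟩ :=
      exists_ofFree_normalOrder_mul_sub_mem_filtration_succ hp remainder_regular remainder_mem
    refine ⟨normalOrder n q * r + r', normalOrder n q * t, ?_, ?_⟩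
    · rw [map_mul, lift_X_normalOrder]
      exact fun h => (p.isPrime.mem_or_mem h).elim hq ht
    · convert hr' using 1
      rw [map_mul, map_add, map_mul]
      noncomm_ring

end RatSeries

namespace RatSeries

variable {n : ℕ} {m : ℕ → ℕ} (B : ∀ d, Module.Basis (Fin (m d)) ℂ (lieDegree n (d + 2)))
  {U : Opens (AffSpace n)} {d : ℕ}

/-! ## Formal sums as sections -/

theorem section_ext {x y : ncAffineSections n U}
    (h : ∀ (d : ℕ) (p : U), ofStalk B d p.1 (x.1 d p) = ofStalk B d p.1 (y.1 d p)) : x = y :=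
  Subtype.ext (funext fun d => funext fun p => ofStalk_injective B d p.1 (h d p))

theorem exists_ofTrunc_mul_mk_eq {s : RatSeries B} (hs : s ∈ regularSeries B U) (d : ℕ) (p : U) :
    ∃ a t : Trunc (FreeNC n) d,
      t ∈ denoms (abMap n) d p.1 ∧ ofTrunc B d t * Ideal.Quotient.mk _ s = ofTrunc B d a := by
  obtain ⟨r, t, ht, sub_mem⟩ := exists_ofFree_mul_sub_mem_filtration p.2 hs (d + 1)
  refine ⟨freeToTrunc n d r, freeToTrunc n d t, (freeToTrunc_mem_denoms B).2 ht, ?_⟩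
  rw [ofTrunc_freeToTrunc, ofTrunc_freeToTrunc, ← map_mul, Ideal.Quotient.eq]
  exact sub_mem

theorem exists_ofStalk_eq (s : NormalSeries m U) (d : ℕ) (p : U) :
    ∃ x, ofStalk B d p.1 x = Ideal.Quotient.mk _ (ofNormalSeries B U s) := by
  obtain ⟨a, t, ht, mul_eq⟩ := exists_ofTrunc_mul_mk_eq B (ofNormalSeries_mem s) d p
  exact ⟨FracRing.frac a ⟨t, ht⟩, (ofStalk_frac_eq_iff B).2 mul_eq⟩

/-- The germ at `p` of the section given by a formal sum. -/
def germ (s : NormalSeries m U) (d : ℕ) (p : U) : Stalk (abMap n) d p.1 :=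
  (exists_ofStalk_eq B s d p).choose

theorem ofStalk_germ (s : NormalSeries m U) (d : ℕ) (p : U) :
    ofStalk B d p.1 (germ B s d p) = Ideal.Quotient.mk _ (ofNormalSeries B U s) :=
  (exists_ofStalk_eq B s d p).choose_spec

theorem isLocallyFraction_germ (s : NormalSeries m U) (d : ℕ) :
    IsLocallyFraction (abMap n) d U (germ B s d) := by
  intro p
  obtain ⟨a, t, ht, mul_eq⟩ := exists_ofTrunc_mul_mk_eq B (ofNormalSeries_mem s) d p
  have germ_eq (q : U) (hq : t ∈ denoms (abMap n) d q.1) :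
      germ B s d q = FracRing.frac a ⟨t, hq⟩ := by
    apply ofStalk_injective B d q.1
    rw [ofStalk_germ, eq_comm]
    exact (ofStalk_frac_eq_iff B).2 mul_eq
  exact ⟨U ⊓ PrimeSpectrum.basicOpen (truncMap (abMap n) d t), ⟨p.2, ht⟩, inf_le_left, a, t,
    fun q hq => ⟨hq.2, germ_eq ⟨q, hq.1⟩ hq.2⟩⟩

/-- The section of the structure sheaf given by a formal sum. -/
def toSections (U : Opens (AffSpace n)) : NormalSeries m U →ₗ[ℂ] ncAffineSections n U where
  toFun s := ⟨germ B s, isLocallyFraction_germ B s, fun d p => ofStalk_injective B d p.1 (by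
    rw [← truncatedProj_ofStalk, ofStalk_germ, ofStalk_germ, truncatedProj_mk])⟩
  map_add' s t := section_ext B fun d p => by
    change ofStalk B d p.1 (germ B (s + t) d p) = ofStalk B d p.1 (germ B s d p + germ B t d p)
    rw [map_add, ofStalk_germ, ofStalk_germ, ofStalk_germ, map_add, map_add]
  map_smul' c s := section_ext B fun d p => by
    change ofStalk B d p.1 (germ B (c • s) d p) = ofStalk B d p.1 (c • germ B s d p)
    rw [Algebra.smul_def c (germ B s d p), map_mul, ofStalk_germ, ofStalk_germ,
      ofStalk_algebraMap, map_smul, Algebra.smul_def, map_mul]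

theorem ofStalk_toSections (s : NormalSeries m U) (d : ℕ) (p : U) :
    ofStalk B d p.1 ((toSections B U s).1 d p) = Ideal.Quotient.mk _ (ofNormalSeries B U s) :=
  ofStalk_germ B s d p

theorem toSections_one (U : Opens (AffSpace n)) :
    toSections B U (NormalSeries.term 1 0) = 1 := section_ext B fun d p => by
  rw [ofStalk_toSections, ofNormalSeries_term]
  exact (map_one _).trans (map_one (ofStalk B d p.1)).symm

theorem toSections_mul (s t : NormalSeries m U) :
    toSections B U (NormalSeries.mul (normalOp B) s t) = toSections B U s * toSections B U t :=
  section_ext B fun d p => by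
    rw [ofStalk_toSections, ofNormalSeries_mul, map_mul, ← ofStalk_toSections B s d p,
      ← ofStalk_toSections B t d p, ← map_mul]
    rfl

theorem toSections_restrict {V : Opens (AffSpace n)} (hVU : V ≤ U) (s : NormalSeries m U) :
    toSections B V (NormalSeries.restrict hVU s) = spfRestrict _ hVU (toSections B U s) :=
  section_ext B fun d p => by
    rw [ofStalk_toSections]
    exact (ofStalk_toSections B s d ⟨p.1, hVU p.2⟩).symm

theorem toSections_term (U : Opens (AffSpace n)) (f : MvPolynomial (Fin n) ℂ)
    (l : MultiIndex m) : toSections B U (NormalSeries.term (polyToRegular U f) l) =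
      toSpfSections (abMap n) U (toFreeNC n (normalOrder n f * orderedMonomial B l)) :=
  section_ext B fun d p => by
    rw [ofStalk_toSections, ofNormalSeries_term]
    refine Eq.trans ?_ (ofStalk_of B d p.1 (freeToTrunc n d _)).symm
    rw [ofTrunc_freeToTrunc, ofFree_term]
    rfl

theorem mk_ofNormalSeries_eq_zero_iff (s : NormalSeries m U) (d : ℕ) :
    (Ideal.Quotient.mk _ (ofNormalSeries B U s) : Truncated B d) = 0 ↔
      ∀ l : MultiIndex m, l.ord ≤ d → s l = 0 := by
  rw [← map_zero (Ideal.Quotient.mk _), mk_eq_mk_iff]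
  simp only [coeff_ofNormalSeries, map_zero, ZeroMemClass.coe_eq_zero]

theorem toSections_eq_zero_iff (hU : (U : Set (AffSpace n)).Nonempty) (s : NormalSeries m U)
    (d : ℕ) : (toSections B U s).1 d = 0 ↔ ∀ l : MultiIndex m, l.ord ≤ d → s l = 0 := by
  rw [← mk_ofNormalSeries_eq_zero_iff B]
  constructor
  · intro section_eq_zero
    obtain ⟨p, hp⟩ := hU
    rw [← ofStalk_toSections B s d ⟨p, hp⟩, section_eq_zero]
    exact map_zero _
  · refine fun mk_eq_zero => funext fun p => ofStalk_injective B d p.1 ?_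
    rw [ofStalk_toSections, mk_eq_zero]
    exact (map_zero _).symm

theorem toSections_injective (hU : (U : Set (AffSpace n)).Nonempty) :
    Function.Injective (toSections B U : NormalSeries m U → ncAffineSections n U) := by
  rw [injective_iff_map_eq_zero]
  intro s hs
  funext l
  exact (toSections_eq_zero_iff B hU s l.ord).1 (by rw [hs]; rfl) l le_rfl

/-! ## Sections as formal sums -/

/-- The generic point of affine space. -/
def genericPt (n : ℕ) : AffSpace n := ⟨⊥, Ideal.isPrime_bot⟩

theorem genericPt_mem {p : AffSpace n} (hp : p ∈ U) : genericPt n ∈ U :=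
  ((PrimeSpectrum.le_iff_specializes _ _).1 (bot_le : (⊥ : Ideal _) ≤ p.asIdeal)).mem_open U.2 hp

variable {B}

theorem ofStalk_eq_ofStalk_genericPt {σ : ∀ p : U, Stalk (abMap n) d p.1}
    (hσ : IsLocallyFraction (abMap n) d U σ) (p : U) :
    ofStalk B d p.1 (σ p) =
      ofStalk B d (genericPt n) (σ ⟨genericPt n, genericPt_mem p.2⟩) := by
  obtain ⟨V, hpV, hV, a, t, σ_eq⟩ := hσ p
  obtain ⟨hp, σ_p⟩ := σ_eq p hpV
  obtain ⟨hg, σ_generic⟩ := σ_eq (genericPt n) (genericPt_mem hpV)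
  rw [σ_p, ofStalk_frac_eq_iff, σ_generic]
  exact ofTrunc_mul_ofStalk_frac B d (genericPt n) a ⟨t, hg⟩

theorem coeff_mem_regularFunctions_of_ofFree_mul_mk_eq {a t : FreeAlgebra ℂ (Fin n)}
    (ht : ∀ p ∈ U, normalForm B t 0 ∉ p.asIdeal) (coeff_ne : coeff 0 (ofFree B t) ≠ 0)
    {s : RatSeries B} (mul_eq : (Ideal.Quotient.mk _ (ofFree B t * s) : Truncated B d) =
      Ideal.Quotient.mk _ (ofFree B a)) {l : MultiIndex m} (hl : l.ord ≤ d) :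
    coeff l s ∈ regularFunctions U := by
  have inv_regular : (coeff 0 (ofFree B t))⁻¹ ∈ regularFunctions U := fun p hp =>
    ⟨1, normalForm B t 0, ht p hp, by rw [← coeff_ofFree, inv_mul_cancel₀ coeff_ne, map_one]⟩
  obtain ⟨u, hu, t_mul_u⟩ := exists_mul_sub_one_mem_filtration (ofFree_mem_regularSeries U t)
    coeff_ne inv_regular (d + 1)
  have mk_s : (Ideal.Quotient.mk _ s : Truncated B d) = Ideal.Quotient.mk _ (u * ofFree B a) := by
    refine (isUnit_mk coeff_ne d).mul_left_cancel ?_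
    rw [← Ideal.Quotient.eq, map_mul, map_one] at t_mul_u
    rw [← map_mul, mul_eq, map_mul, ← mul_assoc, t_mul_u, one_mul]
  rw [mk_eq_mk_iff.1 mk_s l hl]
  exact mul_mem hu (ofFree_mem_regularSeries U a) l

theorem coeff_mem_regularFunctions {σ : ∀ p : U, Stalk (abMap n) d p.1}
    (hσ : IsLocallyFraction (abMap n) d U σ) {s : RatSeries B}
    (hs : ∀ p : U, ofStalk B d p.1 (σ p) = Ideal.Quotient.mk _ s) {l : MultiIndex m}
    (hl : l.ord ≤ d) : coeff l s ∈ regularFunctions U := by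
  intro p hp
  obtain ⟨V, hpV, hV, a, t, σ_eq⟩ := hσ ⟨p, hp⟩
  obtain ⟨a, rfl⟩ := freeToTrunc_surjective B d a
  obtain ⟨t, rfl⟩ := freeToTrunc_surjective B d t
  have ht : ∀ q ∈ V, normalForm B t 0 ∉ q.asIdeal := fun q hq =>
    (freeToTrunc_mem_denoms B).1 (σ_eq q hq).1
  obtain ⟨_, σ_p⟩ := σ_eq p hpV
  have mul_eq := hs ⟨p, hp⟩
  rw [σ_p, ofStalk_frac_eq_iff, ofTrunc_freeToTrunc, ofTrunc_freeToTrunc, ← map_mul] at mul_eq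
  exact coeff_mem_regularFunctions_of_ofFree_mul_mk_eq ht (coeff_zero_ofFree_ne_zero (ht p hpV))
    mul_eq hl p hpV

theorem exists_forall_mk_eq {y : ∀ d, Truncated B d}
    (hy : ∀ d, truncatedProj d (y (d + 1)) = y d) :
    ∃ s : RatSeries B, ∀ d, Ideal.Quotient.mk _ s = y d := by
  choose s hs using fun d => Ideal.Quotient.mk_surjective (y d)
  have coeff_succ (l : MultiIndex m) (d : ℕ) (hl : l.ord ≤ d) :
      coeff l (s (d + 1)) = coeff l (s d) := by
    refine mk_eq_mk_iff.1 ?_ l hl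
    rw [← truncatedProj_mk, hs, hy, hs]
  have coeff_eq (l : MultiIndex m) (d : ℕ) (hl : l.ord ≤ d) :
      coeff l (s d) = coeff l (s l.ord) := by
    induction d, hl using Nat.le_induction with
    | base => rfl
    | succ d hd ih => rw [coeff_succ l d hd, ih]
  let limit : RatSeries B := fun l => coeff l (s l.ord)
  refine ⟨limit, fun d => ?_⟩
  rw [← hs d, mk_eq_mk_iff]
  exact fun l hl => (coeff_eq l d hl).symm

variable (B)

theorem toSections_surjective (hU : (U : Set (AffSpace n)).Nonempty) :
    Function.Surjective (toSections B U : NormalSeries m U → ncAffineSections n U) := by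
  intro σ
  obtain ⟨p₀, hp₀⟩ := hU
  let g : U := ⟨genericPt n, genericPt_mem hp₀⟩
  obtain ⟨s, hs⟩ := exists_forall_mk_eq (y := fun d => ofStalk B d g.1 (σ.1 d g)) fun d => by
    rw [truncatedProj_ofStalk, σ.2.2]
  have ofStalk_eq (d : ℕ) (p : U) : ofStalk B d p.1 (σ.1 d p) = Ideal.Quotient.mk _ s := by
    rw [hs]
    exact ofStalk_eq_ofStalk_genericPt (σ.2.1 d) p
  refine ⟨fun l => ⟨coeff l s, coeff_mem_regularFunctions (σ.2.1 l.ord) (ofStalk_eq l.ord) le_rfl⟩,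
    section_ext B fun d p => ?_⟩
  rw [ofStalk_toSections, ofStalk_eq]
  rfl

/-- The isomorphism of the formal sums with the sections of the structure sheaf. -/
def sectionsEquiv (hU : (U : Set (AffSpace n)).Nonempty) :
    NormalSeries m U ≃ₗ[ℂ] ncAffineSections n U :=
  LinearEquiv.ofBijective (toSections B U) ⟨toSections_injective B hU, toSections_surjective B hU⟩

end RatSeries

end NCGeom

end

theorem theorem3p5p3 (n : ℕ) (m : ℕ → ℕ)
    (B : ∀ d, Module.Basis (Fin (m d)) ℂ (NCGeom.lieDegree n (d + 2))) :
    -- the underlying space of the NC-affine space is the affine space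
    (Function.Surjective (NCGeom.abMap n) ∧
      ∀ a, NCGeom.abMap n a = 0 ↔ a ∈ NCGeom.ncFiltration (NCGeom.FreeNC n) 1) ∧
    -- the operators of the normal form exist and are unique
    ∃ C : NCGeom.MultiIndex m → NCGeom.MultiIndex m → NCGeom.MultiIndex m → NCGeom.BiDiffOp n,
      NCGeom.IsNormalFormOperators B C ∧
      (∀ C', NCGeom.IsNormalFormOperators B C' → C' = C) ∧
      -- the multiplication of formal sums is well defined
      (∀ v, {lk : NCGeom.MultiIndex m × NCGeom.MultiIndex m | C lk.1 lk.2 v ≠ 0}.Finite) ∧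
      -- the identification of the formal sums with the sections
      ∃ Φ : ∀ U : TopologicalSpace.Opens (NCGeom.AffSpace n), (U : Set (NCGeom.AffSpace n)).Nonempty →
          (NCGeom.NormalSeries m U ≃ₗ[ℂ] NCGeom.ncAffineSections n U),
        -- it is an isomorphism of algebras
        (∀ U hU, Φ U hU (NCGeom.NormalSeries.term 1 0) = 1) ∧
        (∀ U hU s t, Φ U hU (NCGeom.NormalSeries.mul C s t) = Φ U hU s * Φ U hU t) ∧
        -- it is compatible with restriction
        (∀ U hU V hV, ∀ (h : V ≤ U) s,
          Φ V hV (NCGeom.NormalSeries.restrict h s) = NCGeom.spfRestrict _ h (Φ U hU s)) ∧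
        -- it is compatible with the normal form of noncommutative polynomials
        (∀ U hU f l, Φ U hU (NCGeom.NormalSeries.term (NCGeom.polyToRegular U f) l) =
          NCGeom.toSpfSections (NCGeom.abMap n) U (NCGeom.toFreeNC n
            (NCGeom.normalOrder n f * NCGeom.orderedMonomial B l))) ∧
        -- it identifies the truncations, hence the topologies
        (∀ U hU s d, (Φ U hU s).1 d = 0 ↔ ∀ l, NCGeom.MultiIndex.ord l ≤ d → s l = 0) := by
  exact ⟨⟨NCGeom.abMap_surjective, NCGeom.abMap_eq_zero_iff B⟩,
    NCGeom.normalOp B,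
    NCGeom.isNormalFormOperators_normalOp B,
    fun _ hC => hC.unique B,
    NCGeom.RatSeries.finite_normalOp_ne_zero B,
    fun _ hU => NCGeom.RatSeries.sectionsEquiv B hU,
    fun U _ => NCGeom.RatSeries.toSections_one B U,
    fun _ _ => NCGeom.RatSeries.toSections_mul B,
    fun _ _ _ _ => NCGeom.RatSeries.toSections_restrict B,
    fun U _ => NCGeom.RatSeries.toSections_term B U,
    fun _ hU => NCGeom.RatSeries.toSections_eq_zero_iff B hU⟩
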